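/- Let $n\ge 3$, and let $\mathcal B\subset\mathbb R^n$ be a compact set whose boundary is locally the graph of a $C^{2,\alpha}$ function (for some $0<\alpha<1$) with $\mathcal B$ on one side, and whose exterior $\Omega=\mathbb R^n\setminus\mathcal B$ is connected. Let $\mathbf n$ be the unit normal on $\partial\mathcal B$ pointing out of $\mathcal B$, let $q\in\mathbb R$ and $\mathbf u^\infty=(q,0,\dots,0)$. Let $\mathbf u\in C^1(\Omega)\cap C(\overline\Omega)$ be an incompressible airfoil flow, that is, $\operatorname{div}\mathbf u=0$ and $\operatorname{curl}\mathbf u=0$ in $\Omega$, $\mathbf u\cdot\mathbf n=0$ on $\partial\mathcal B$ and $\mathbf u(x)\to\mathbf u^\infty$ as $|x|\to\infty$, and suppose that for some $\sigma>0$ and constants $C,R>0$ $$|\mathbf u(x)-\mathbf u^\infty|\le C|x|^{-1-\sigma}\qquad (x\in\Omega,\ |x|\ge R).$$ (a) Let $\varphi\in C(\overline\Omega)$ be a potential of the flow, $\nabla\varphi=\mathbf u$ in $\Omega$. Then there is a constant $c_0$ such that $\Phi(x)=\varphi(x)-q x_1+c_0\to0$ as $|x|\to\infty$, and $$\varphi(x)+c_0=q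 x_1+\sum_{i=1}^nG_i\,\partial_{x_i}|x|^{2-n}+\sum_{i,j=1}^nG_{ij}\,\partial_{x_ix_j}|x|^{2-n}+O(|x|^{-n-1})\qquad(|x|\to\infty),$$ where, with $\nabla\Phi=\mathbf u-\mathbf u^\infty$ and $\alpha(n)$ the volume of the unit ball, $$G_i=\frac1{n(n-2)\alpha(n)}\int_{\partial\mathcal B}\big(x_i\nabla\Phi\cdot\mathbf n-n_i\Phi\big)\,ds,\qquad G_{ij}=\frac1{n(n-2)\alpha(n)}\int_{\partial\mathcal B}\Big(-\tfrac12x_ix_j\nabla\Phi\cdot\mathbf n+x_in_j\Phi\Big)\,ds.$$ The monopole coefficient $G=-\frac1{n(n-2)\alpha(n)}\int_{\partial\mathcal B}\nabla\Phi\cdot\mathbf n\,ds$ is $0$. The same expansion also holds with coefficients that depend only on $\mathcal B$ and on the values of $\varphi$ on $\partial\mathcal B$, namely with $G_i$ replaced by $-\frac1{n(n-2)\alpha(n)}\int_{\partial\mathcal B}\varphi\,n_i\,ds$ and $G_{ij}$ by $\frac1{n(n-2)\alpha(n)}\int_{\partial\mathcal B}\varphi\,x_in_j\,ds$. (b) Whether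 or not $\mathbf u$ has a single-valued potential in all of $\Omega$, there are $R',C_0>0$ and a function $\varphi$ with $\nabla\varphi=\mathbf u$ in $\{x\in\Omega:|x|\ge R'\}$ that has an expansion as displayed in (a), with $c_0=0$ and some constants $G_i,G_{ij}$, and $$|\mathbf u(x)-\mathbf u^\infty|\le C_0|x|^{-n}\qquad(x\in\Omega,\ |x|\ge R').$$ (c) There are $R',C_0>0$ that depend only on $\mathcal B$ such that every $\mathbf u$ as above that has a potential as in (a) satisfies, whatever $q$ is, $$|\mathbf u(x)-\mathbf u^\infty|\le C_0|q|\,|x|^{-n}\qquad(x\in\Omega,\ |x|\ge R').$$ -/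

import Mathlib

open MeasureTheory Filter Topology Metric Bornology
open scoped NNReal InnerProductSpace

noncomputable section

namespace AirfoilFlow

/-- `ℝⁿ` with its Euclidean norm. -/
abbrev Space (n : ℕ) : Type := EuclideanSpace ℝ (Fin n)

variable {n : ℕ}

/-- The partial derivative `∂_i f` of a real function at `x`. -/
def pd (i : Fin n) (f : Space n → ℝ) (x : Space n) : ℝ :=
  fderiv ℝ f x (EuclideanSpace.single i 1)

/-- The boundary of `B` is locally the graph of a `C^{2,α}` function, with `B` on one side of it:
every boundary point `p` has a ball around it and a unit vector `e` such that inside the ball `B` is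
the set of the points `x` whose height `⟪e, x⟫` is at most `γ (π x)`. Here `π` is the orthogonal
projection to the hyperplane `e^⊥`, and `γ` is twice continuously differentiable near `π p`,
with `α`-Hölder second derivatives. -/
def HasHolderC2Boundary (α : ℝ≥0) (B : Set (Space n)) : Prop :=
  ∀ p ∈ frontier B, ∃ (r : ℝ) (e : Space n) (γ : (Submodule.span ℝ {e})ᗮ → ℝ) (K : ℝ≥0),
    0 < r ∧ ‖e‖ = 1 ∧
    ContDiffOn ℝ 2 γ (ball ((Submodule.span ℝ {e})ᗮ.orthogonalProjectionOnto p) r) ∧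
    HolderOnWith K α (iteratedFDeriv ℝ 2 γ)
      (ball ((Submodule.span ℝ {e})ᗮ.orthogonalProjectionOnto p) r) ∧
    ∀ x ∈ ball p r,
      (x ∈ B ↔ ⟪e, x⟫_ℝ ≤ γ ((Submodule.span ℝ {e})ᗮ.orthogonalProjectionOnto x))

/-- An airfoil: a compact set with `C^{2,α}` boundary for some `0 < α < 1` and connected
exterior. (Compactness and the regularity of the boundary imply that it has finitely many
connected components.) -/
structure IsAirfoil (B : Set (Space n)) : Prop where
  isCompact : IsCompact B
  holder_boundary : ∃ α : ℝ≥0, 0 < α ∧ α < 1 ∧ HasHolderC2Boundary α B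
  exterior_connected : IsConnected Bᶜ

/-- `ν` is the unit normal at the boundary point `p` of `B` that points out of `B`: rays from `p`
that form an acute angle with `ν` start outside of `B`, those that form an obtuse angle with `ν`
start inside `B`. -/
structure IsOuterUnitNormal (B : Set (Space n)) (p ν : Space n) : Prop where
  norm_eq : ‖ν‖ = 1
  outward : ∀ v : Space n, 0 < ⟪v, ν⟫_ℝ → ∀ᶠ t : ℝ in 𝓝[>] 0, p + t • v ∉ B
  inward : ∀ v : Space n, ⟪v, ν⟫_ℝ < 0 → ∀ᶠ t : ℝ in 𝓝[>] 0, p + t • v ∈ B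

/-- The boundary integral `∫_{∂B} f ds`; the surface measure is the `(n-1)`-dimensional Hausdorff
measure, normalized to agree with Lebesgue measure on hyperplanes. -/
def boundaryIntegral (B : Set (Space n)) (f : Space n → ℝ) : ℝ :=
  ∫ x in frontier B, f x ∂(μHE[n - 1])

/-- `u` solves the incompressible airfoil problem for `B` with velocity `uInf` at infinity, where
`ν` is the outer unit normal field on `∂B`. The pressure is decoupled: it is given by
Bernoulli's law as a constant minus `‖u‖² / 2`, which puts no condition on `u`. -/
structure IsIncompressibleAirfoilFlow (B : Set (Space n)) (ν : Space n → Space n)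
    (uInf : Space n) (u : Space n → Space n) : Prop where
  contDiffOn : ContDiffOn ℝ 1 u Bᶜ
  continuousOn : ContinuousOn u (closure Bᶜ)
  div_eq_zero : ∀ x ∈ Bᶜ, ∑ i, pd i (fun y => u y i) x = 0
  curl_eq_zero : ∀ x ∈ Bᶜ, ∀ i j, pd i (fun y => u y j) x = pd j (fun y => u y i) x
  slip : ∀ x ∈ frontier B, ⟪u x, ν x⟫_ℝ = 0
  tendsto_infty : Tendsto u (cobounded (Space n)) (𝓝 uInf)

/-- The initial decay hypothesis `|u(x) - uInf| ≤ C |x|^{-1-σ}` near infinity, for some `σ > 0`. -/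
def HasInitialDecay (B : Set (Space n)) (uInf : Space n) (u : Space n → Space n) : Prop :=
  ∃ σ C R : ℝ, 0 < σ ∧ 0 < R ∧
    ∀ x ∈ Bᶜ, R ≤ ‖x‖ → ‖u x - uInf‖ ≤ C * ‖x‖ ^ (-1 - σ)

/-- `φ` is a velocity potential of `u` in the exterior of `B`, continuous up to the boundary. -/
structure IsVelocityPotential (B : Set (Space n)) (u : Space n → Space n)
    (φ : Space n → ℝ) : Prop where
  continuousOn : ContinuousOn φ (closure Bᶜ)
  hasGradientAt : ∀ x ∈ Bᶜ, HasGradientAt φ (u x) x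

/-- The function `|x|^{2-n}`. -/
def kernel (n : ℕ) (x : Space n) : ℝ := ‖x‖ ^ (2 - (n : ℝ))

/-- The constant `n (n-2) α(n)`, where `α(n)` is the volume of the unit ball of `ℝⁿ`. -/
def greenConst (n : ℕ) : ℝ :=
  n * ((n : ℝ) - 2) * volume.real (ball (0 : Space n) 1)

/-- The sum `∑ G_i ∂_i |x|^{2-n} + ∑ G_ij ∂_ij |x|^{2-n}`. -/
def multipole (G₁ : Fin n → ℝ) (G₂ : Fin n → Fin n → ℝ) (x : Space n) : ℝ :=
  ∑ i, G₁ i * pd i (kernel n) x + ∑ i, ∑ j, G₂ i j * pd i (pd j (kernel n)) x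

/-- The coefficient `G` of `|x|^{2-n}`; here `w` stands for `∇Φ`. -/
def monopoleCoeff (B : Set (Space n)) (ν w : Space n → Space n) : ℝ :=
  -(1 / greenConst n) * boundaryIntegral B (fun x => ⟪w x, ν x⟫_ℝ)

/-- The coefficients `G_i`; here `w` stands for `∇Φ`. -/
def dipoleCoeff (B : Set (Space n)) (ν w : Space n → Space n) (Φ : Space n → ℝ)
    (i : Fin n) : ℝ :=
  (1 / greenConst n) * boundaryIntegral B (fun x => x i * ⟪w x, ν x⟫_ℝ - ν x i * Φ x)

/-- The coefficients `G_ij`; here `w` stands for `∇Φ`. -/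
def quadrupoleCoeff (B : Set (Space n)) (ν w : Space n → Space n) (Φ : Space n → ℝ)
    (i j : Fin n) : ℝ :=
  (1 / greenConst n) *
    boundaryIntegral B (fun x => -(1 / 2) * x i * x j * ⟪w x, ν x⟫_ℝ + x i * ν x j * Φ x)

end AirfoilFlow

end

open AirfoilFlow

/-! Put `w = u - u∞`. This field is divergence free and curl free. Near infinity it has a potential
`Φ` that tends to zero, namely minus the integral of `w` along the ray from `x` to infinity: a field
that decays faster than `1/|x|` has no circulation at infinity (`exists_exterior_potential`).

Let `χ` be a cutoff that equals `1` on a large ball, and `T = Δ(χΦ) = 2∇χ·w + ΦΔχ`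
(`cutoffLaplacian`). The source `T` is continuous and lives in an annulus. The function `(1-χ)Φ`
makes sense on the whole space, decays, and has Laplacian `-T`. Hence, far out, `greenConst n * Φ x
= ∫ |x-y|^{2-n} T(y) dy` (`greenConst_mul_eq_integral`). Taylor's formula for the kernel
(`kernel_taylor`) turns this into a multipole expansion whose coefficients are the moments of `T` of
order at most two, with an error `O(|x|^{-n-1})`.

The total mass of `T` is minus the flux of `w` through `∂B` (`IsAirfoil.integral_cutoffLaplacian`).
The flux vanishes, since `u·n = 0` and a constant field has no flux through a closed surface. So
there is no monopole, and the gradient is `O(|x|^{-n})`. The potential enters only far from `B`, so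
this also covers flows with circulation, which is part (b).

For part (a), Green's second identity with the test functions `x_i` and `x_i x_j` expresses the
moments as boundary integrals (`IsAirfoil.integral_mul_cutoffLaplacian`). In the quadratic case it
yields only the symmetric part of `G_ij`, and up to a multiple of the identity matrix. Neither
ambiguity matters, because second derivatives commute and the kernel is harmonic
(`multipole_congr`). The coefficients in terms of `φ` alone follow from `w·n = -u∞·n` on `∂B` and
the divergence theorem inside `B`.

For part (c), if two potential flows have proportional velocities at infinity, the corresponding
combination is at rest at infinity, and an energy estimate makes it vanish
(`IsAirfoil.eq_zero_of_slip`). All potential flows past `B` are then multiples of a single one, and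
its constants serve for all.

All of this needs the Gauss–Green formula for the Hausdorff surface measure and for fields whose
derivatives may blow up at `∂B` (`IsAirfoil.gauss_green`). It comes from an area formula for graphs,
a cutoff of width `ε` above the graph in each chart, and a partition of unity. -/

noncomputable section

namespace AirfoilFlow

open scoped Gradient

/-! ### Divergence calculus for vector fields on `ℝⁿ`. -/

section

variable {n : ℕ}

/-- The divergence of a vector field. -/
def divergence (F : Space n → Space n) (x : Space n) : ℝ :=
  ∑ i, pd i (fun y => F y i) x

lemma divergence_of_hasFDerivAt {F : Space n → Space n} {F' : Space n →L[ℝ] Space n} {x : Space n}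
    (h : HasFDerivAt F F' x) : divergence F x = ∑ i, F' (EuclideanSpace.single i 1) i := by
  refine Finset.sum_congr rfl fun i _ => ?_
  have h1 : HasFDerivAt (fun y => F y i) ((EuclideanSpace.proj i : Space n →L[ℝ] ℝ).comp F') x :=
    ((EuclideanSpace.proj i : Space n →L[ℝ] ℝ).hasFDerivAt).comp x h
  rw [pd, h1.fderiv]
  simp

lemma sum_mul_single (L : Space n →L[ℝ] ℝ) (v : Space n) :
    ∑ i, v i * L (EuclideanSpace.single i 1) = L v := by
  conv_rhs => rw [← (EuclideanSpace.basisFun (Fin n) ℝ).sum_repr v]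
  simp [map_sum]

lemma divergence_congr {F G : Space n → Space n} {x : Space n} (h : F =ᶠ[𝓝 x] G) :
    divergence F x = divergence G x := by
  refine Finset.sum_congr rfl fun i _ => ?_
  have : (fun y => F y i) =ᶠ[𝓝 x] fun y => G y i := h.mono fun y hy => by simp [hy]
  rw [pd, pd, this.fderiv_eq]

lemma divergence_smul {f : Space n → ℝ} {F : Space n → Space n} {f' : Space n} {x : Space n}
    (hf : HasGradientAt f f' x) (hF : DifferentiableAt ℝ F x) :
    divergence (fun y => f y • F y) x = f x * divergence F x + ⟪f', F x⟫_ℝ := by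
  have h := (hasGradientAt_iff_hasFDerivAt.1 hf).fun_smul hF.hasFDerivAt
  rw [divergence_of_hasFDerivAt h, divergence_of_hasFDerivAt hF.hasFDerivAt, Finset.mul_sum,
    ← InnerProductSpace.toDual_apply_apply (𝕜 := ℝ), ← sum_mul_single _ (F x),
    ← Finset.sum_add_distrib]
  refine Finset.sum_congr rfl fun i _ => ?_
  simp [mul_comm]

lemma divergence_add {F G : Space n → Space n} {x : Space n}
    (hF : DifferentiableAt ℝ F x) (hG : DifferentiableAt ℝ G x) :
    divergence (fun y => F y + G y) x = divergence F x + divergence G x := by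
  rw [divergence_of_hasFDerivAt (hF.hasFDerivAt.fun_add hG.hasFDerivAt),
    divergence_of_hasFDerivAt hF.hasFDerivAt, divergence_of_hasFDerivAt hG.hasFDerivAt,
    ← Finset.sum_add_distrib]
  simp

lemma divergence_sub {F G : Space n → Space n} {x : Space n}
    (hF : DifferentiableAt ℝ F x) (hG : DifferentiableAt ℝ G x) :
    divergence (fun y => F y - G y) x = divergence F x - divergence G x := by
  rw [divergence_of_hasFDerivAt (hF.hasFDerivAt.fun_sub hG.hasFDerivAt),
    divergence_of_hasFDerivAt hF.hasFDerivAt, divergence_of_hasFDerivAt hG.hasFDerivAt,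
    ← Finset.sum_sub_distrib]
  simp

@[simp]
lemma divergence_const (v : Space n) (x : Space n) : divergence (fun _ => v) x = 0 := by
  rw [divergence_of_hasFDerivAt (hasFDerivAt_const v x)]
  simp

lemma divergence_id (x : Space n) : divergence (fun y => y) x = n := by
  rw [divergence_of_hasFDerivAt (F := fun y => y) (hasFDerivAt_id x)]
  simp

lemma divergence_comp_add {F : Space n → Space n} (x y : Space n) :
    divergence (fun z => F (x + z)) y = divergence F (x + y) := by
  simp only [divergence, pd]
  refine Finset.sum_congr rfl fun i _ => ?_
  rw [fderiv_comp_add_left (f := fun z => F z i)]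

lemma divergence_continuousOn {F : Space n → Space n} {s : Set (Space n)} (hs : IsOpen s)
    (hF : ContDiffOn ℝ 1 F s) : ContinuousOn (divergence F) s := by
  have h : ContinuousOn (fun x => ∑ i, fderiv ℝ F x (EuclideanSpace.single i 1) i) s := by
    have := hF.continuousOn_fderiv_of_isOpen hs le_rfl
    refine continuousOn_finsetSum _ fun i _ => ?_
    exact (EuclideanSpace.proj i : Space n →L[ℝ] ℝ).continuous.comp_continuousOn
      (this.clm_apply continuousOn_const)
  refine h.congr fun x hx => ?_
  exact divergence_of_hasFDerivAt
    ((hF.differentiableOn one_ne_zero).differentiableAt (hs.mem_nhds hx)).hasFDerivAt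

lemma divergence_continuous {F : Space n → Space n} (hF : ContDiff ℝ 1 F) :
    Continuous (divergence F) := by
  rw [← continuousOn_univ]
  exact divergence_continuousOn isOpen_univ hF.contDiffOn

lemma divergence_eq_zero_of_notMem_tsupport {F : Space n → Space n} {x : Space n}
    (hx : x ∉ tsupport F) : divergence F x = 0 := by
  have h : F =ᶠ[𝓝 x] fun _ => 0 := notMem_tsupport_iff_eventuallyEq.1 hx
  rw [divergence_congr h, divergence_const]

lemma hasCompactSupport_divergence {F : Space n → Space n} (hF : HasCompactSupport F) :
    HasCompactSupport (divergence F) :=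
  HasCompactSupport.intro hF fun _ hx => divergence_eq_zero_of_notMem_tsupport hx

/-- The divergence of a compactly supported vector field has mean zero. -/
lemma integral_divergence_eq_zero {F : Space n → Space n} (hF : ContDiff ℝ 1 F)
    (hc : HasCompactSupport F) : ∫ x, divergence F x = 0 := by
  have hFi (i : Fin n) : ContDiff ℝ 1 fun y => F y i :=
    (EuclideanSpace.proj i : Space n →L[ℝ] ℝ).contDiff.comp hF
  have hci (i : Fin n) : HasCompactSupport fun y => F y i :=
    hc.comp_left (g := fun v : Space n => v i) rfl
  have hint (i : Fin n) : Integrable (pd i fun y => F y i) :=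
    (((hFi i).continuous_fderiv one_ne_zero).clm_apply continuous_const).integrable_of_hasCompactSupport
      ((hci i).fderiv_apply ℝ _)
  rw [show divergence F = fun x => ∑ i, pd i (fun y => F y i) x from rfl,
    integral_finsetSum _ fun i _ => hint i]
  refine Finset.sum_eq_zero fun i _ => ?_
  -- Integration by parts against the constant function `1`.
  have := integral_mul_fderiv_eq_neg_fderiv_mul_of_integrable (μ := volume)
    (f := fun _ : Space n => (1 : ℝ)) (g := fun y => F y i) (v := EuclideanSpace.single i 1)
    (by simp) ((hint i).congr (.of_forall fun x => by simp [pd]))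
    (by simpa using (hFi i).continuous.integrable_of_hasCompactSupport (hci i))
    (fun x _ => differentiableAt_const _)
    (fun x _ => (hFi i).differentiable one_ne_zero x)
  simpa [pd] using this

end

/-! ### The Newtonian kernel as a fundamental solution of the Laplacian. -/

section

variable {n : ℕ}

/-- Radial functions are written in terms of `‖z‖ ^ 2`, which is smooth at the origin too. This is
where the exponents `1 - n / 2`, `-n / 2` and so on come from. -/
lemma hasGradientAt_comp_norm_sq {f : ℝ → ℝ} {f' : ℝ} {z : Space n}
    (h : HasDerivAt f f' (‖z‖ ^ 2)) :
    HasGradientAt (fun z : Space n => f (‖z‖ ^ 2)) ((2 * f') • z) z := by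
  rw [hasGradientAt_iff_hasFDerivAt]
  convert! h.comp_hasFDerivAt z (hasStrictFDerivAt_norm_sq z).hasFDerivAt using 1
  ext v
  simp
  ring

lemma divergence_comp_norm_sq_smul {f : ℝ → ℝ} {f' : ℝ} {z : Space n}
    (h : HasDerivAt f f' (‖z‖ ^ 2)) :
    divergence (fun z : Space n => f (‖z‖ ^ 2) • z) z = n * f (‖z‖ ^ 2) + 2 * f' * ‖z‖ ^ 2 := by
  rw [divergence_smul (F := fun y => y) (hasGradientAt_comp_norm_sq h) differentiableAt_id, divergence_id,
    inner_smul_left, real_inner_self_eq_norm_sq]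
  simp
  ring

/-- The integral of the approximate identity that arises as the Laplacian of the regularized
Newtonian kernel. -/
lemma integral_one_add_norm_sq_rpow (hn : 1 ≤ n) :
    Integrable (fun y : Space n => (1 + ‖y‖ ^ 2) ^ (-1 - (n : ℝ) / 2)) ∧
    ∫ y : Space n, (1 + ‖y‖ ^ 2) ^ (-1 - (n : ℝ) / 2) = volume.real (ball (0 : Space n) 1) := by
  have hn' : (0 : ℝ) < n := by exact_mod_cast hn
  have : Nonempty (Fin n) := ⟨⟨0, hn⟩⟩
  -- In polar coordinates the integrand has the explicit primitive `r^n (1 + r²)^{-n/2} / n`, which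
  -- grows from `0` to `1 / n`. The factor `1 / n` cancels the ratio of the sphere's area to the
  -- ball's volume.
  have hderiv : ∀ r ∈ Set.Ici (0 : ℝ),
      HasDerivAt (fun r : ℝ => (1 / n : ℝ) * (r ^ n * (1 + r ^ 2) ^ (-((n : ℝ) / 2))))
      (r ^ (n - 1) • (1 + r ^ 2) ^ (-1 - (n : ℝ) / 2)) r := by
    intro r hr
    have hpos : 0 < 1 + r ^ 2 := by positivity
    have h1 : HasDerivAt (fun r : ℝ => 1 + r ^ 2) (2 * r) r := by
      simpa using (hasDerivAt_pow 2 r).const_add 1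
    have h2 := h1.rpow_const (p := -((n : ℝ) / 2)) (Or.inl hpos.ne')
    have h3 := ((hasDerivAt_pow n r).fun_mul h2).const_mul (1 / n : ℝ)
    refine h3.congr_deriv ?_
    have e1 : (1 + r ^ 2) ^ (-((n : ℝ) / 2)) = (1 + r ^ 2) ^ (-1 - (n : ℝ) / 2) * (1 + r ^ 2) := by
      rw [← Real.rpow_add_one hpos.ne']
      ring_nf
    have e2 : -((n : ℝ) / 2) - 1 = -1 - (n : ℝ) / 2 := by ring
    have e3 : r ^ n = r ^ (n - 1) * r := by rw [← pow_succ, Nat.sub_add_cancel hn]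
    rw [e2, e1, e3, smul_eq_mul]
    field_simp
    ring
  have hlim : Tendsto (fun r : ℝ => (1 / n : ℝ) * (r ^ n * (1 + r ^ 2) ^ (-((n : ℝ) / 2)))) atTop
      (𝓝 (1 / (n : ℝ))) := by
    have h1 : Tendsto (fun r : ℝ => (1 / n : ℝ) * ((r ^ 2)⁻¹ + 1) ^ (-((n : ℝ) / 2))) atTop
        (𝓝 ((1 / n : ℝ) * (0 + 1) ^ (-((n : ℝ) / 2)))) := by
      refine Tendsto.const_mul _ (Tendsto.rpow_const ?_ (Or.inl (by norm_num)))
      exact (tendsto_inv_atTop_zero.comp (tendsto_pow_atTop two_ne_zero)).add_const 1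
    rw [zero_add, Real.one_rpow, mul_one] at h1
    refine h1.congr' ?_
    filter_upwards [eventually_gt_atTop 0] with r hr
    congr 1
    have : (1 + r ^ 2) = r ^ 2 * ((r ^ 2)⁻¹ + 1) := by field_simp
    rw [this, Real.mul_rpow (by positivity) (by positivity), ← mul_assoc, ← Real.rpow_natCast r 2,
      ← Real.rpow_mul hr.le, ← Real.rpow_natCast r n, ← Real.rpow_add hr]
    have : (n : ℝ) + ((2 : ℕ) : ℝ) * -((n : ℝ) / 2) = 0 := by push_cast; ring
    rw [this, Real.rpow_zero, one_mul]
  have hnn : ∀ r ∈ Set.Ioi (0 : ℝ), 0 ≤ r ^ (n - 1) • (1 + r ^ 2) ^ (-1 - (n : ℝ) / 2) := by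
    intro r hr
    have : (0 : ℝ) < r := hr
    simp only [smul_eq_mul]
    positivity
  constructor
  · rw [integrable_fun_norm_addHaar volume (f := fun r => (1 + r ^ 2) ^ (-1 - (n : ℝ) / 2)),
      finrank_euclideanSpace_fin]
    exact integrableOn_Ioi_deriv_of_nonneg' hderiv hnn hlim
  · rw [integral_fun_norm_addHaar volume (fun r => (1 + r ^ 2) ^ (-1 - (n : ℝ) / 2)),
      finrank_euclideanSpace_fin, integral_Ioi_of_hasDerivAt_of_nonneg' hderiv hnn hlim]
    simp only [nsmul_eq_mul, smul_eq_mul, zero_pow (by omega : n ≠ 0)]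
    field_simp
    ring

/-- The Newtonian kernel is locally integrable. -/
lemma kernel_integrableOn_ball (hn : 2 ≤ n) (r : ℝ) :
    IntegrableOn (kernel n) (ball (0 : Space n) r) := by
  have : Nonempty (Fin n) := ⟨⟨0, by omega⟩⟩
  rw [show kernel n = fun x : Space n => (fun s : ℝ => s ^ (2 - (n : ℝ))) ‖x‖ from rfl,
    integrableOn_fun_norm_addHaar volume (f := fun s : ℝ => s ^ (2 - (n : ℝ))), finrank_euclideanSpace_fin]
  -- The radial integrand is `s^{n-1} s^{2-n} = s`.
  have h : IntegrableOn (fun y : ℝ => y) (Set.Ioo 0 r) :=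
    (continuous_id.integrableOn_Icc (a := 0) (b := r)).mono_set Set.Ioo_subset_Icc_self
  refine h.congr_fun (fun y hy => ?_) measurableSet_Ioo
  have hy0 : 0 < y := hy.1
  simp only [smul_eq_mul]
  rw [← Real.rpow_natCast, ← Real.rpow_add hy0, Nat.cast_sub (by omega)]
  have : ((n : ℝ) - (1 : ℕ) + (2 - n)) = 1 := by push_cast; ring
  rw [this, Real.rpow_one]

lemma kernel_nonneg (x : Space n) : 0 ≤ kernel n x := by
  unfold kernel
  positivity

lemma integrable_kernel_mul (hn : 2 ≤ n) {f : Space n → ℝ} (hf : Continuous f)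
    (hc : HasCompactSupport f) : Integrable fun y => kernel n y * f y := by
  obtain ⟨r, hr⟩ := hc.isCompact.isBounded.subset_ball (0 : Space n)
  obtain ⟨M, hM⟩ := hf.bounded_above_of_compact_support hc
  have h : IntegrableOn (fun y => kernel n y * f y) (ball (0 : Space n) r) :=
    (kernel_integrableOn_ball hn r).mul_bdd hf.aestronglyMeasurable.restrict
      (.of_forall hM)
  rwa [integrableOn_iff_integrable_of_support_subset] at h
  intro y hy
  refine hr (subset_tsupport _ ?_)
  intro h0
  simp [h0] at hy

lemma kernel_eq_norm_sq_rpow (z : Space n) : kernel n z = (‖z‖ ^ 2) ^ (1 - (n : ℝ) / 2) := by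
  rw [kernel, ← Real.rpow_natCast, ← Real.rpow_mul (norm_nonneg z)]
  push_cast
  ring_nf

lemma hasCompactSupport_of_hasGradientAt {g : Space n → ℝ} {V : Space n → Space n}
    (hg : ∀ x, HasGradientAt g (V x) x) (hc : HasCompactSupport g) : HasCompactSupport V := by
  refine HasCompactSupport.intro hc fun x hx => ?_
  have h1 : g =ᶠ[𝓝 x] fun _ => 0 := notMem_tsupport_iff_eventuallyEq.1 hx
  exact (hg x).unique ((hasGradientAt_const x (0 : ℝ)).congr_of_eventuallyEq h1)

lemma contDiff_one_of_hasGradientAt {g : Space n → ℝ} {V : Space n → Space n}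
    (hg : ∀ x, HasGradientAt g (V x) x) (hV : Continuous V) : ContDiff ℝ 1 g := by
  rw [contDiff_one_iff_fderiv]
  refine ⟨fun x => (hg x).differentiableAt, ?_⟩
  have : fderiv ℝ g = fun x => InnerProductSpace.toDual ℝ (Space n) (V x) := by
    ext1 x
    exact (hg x).hasFDerivAt.fderiv
  rw [this]
  exact (InnerProductSpace.toDual ℝ (Space n)).continuous.comp hV

/-- The kernel `k = (‖y‖² + ε²)^{1-n/2}` is smooth with Laplacian `-n(n-2) ε² (‖y‖² + ε²)^{-1-n/2}`.
The field `k ∇g - g ∇k` has compact support, so its divergence integrates to zero. The substitution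
`y ↦ ε y` then moves `ε` into the argument of `g`, where the limit `ε → 0` is harmless. -/
lemma integral_regularized_kernel_mul_divergence {g : Space n → ℝ} {V : Space n → Space n}
    (hg : ∀ x, HasGradientAt g (V x) x) (hV : ContDiff ℝ 1 V) (hc : HasCompactSupport g)
    {ε : ℝ} (hε : 0 < ε) :
    ∫ y, (‖y‖ ^ 2 + ε ^ 2) ^ (1 - (n : ℝ) / 2) * divergence V y =
      -(n * (n - 2) * ∫ y : Space n, (1 + ‖y‖ ^ 2) ^ (-1 - (n : ℝ) / 2) * g (ε • y)) := by
  have hcV := hasCompactSupport_of_hasGradientAt hg hc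
  have hgC1 := contDiff_one_of_hasGradientAt hg hV.continuous
  have hgc := hgC1.continuous
  set m : ℝ := 1 - (n : ℝ) / 2 with hm
  have hdivc := divergence_continuous hV
  have hdivs := hasCompactSupport_divergence hcV
  have hpos (s : Space n) : 0 < ‖s‖ ^ 2 + ε ^ 2 := by positivity
  have hd (p : ℝ) (z : Space n) : HasDerivAt (fun s : ℝ => (s + ε ^ 2) ^ p)
      (p * (‖z‖ ^ 2 + ε ^ 2) ^ (p - 1)) (‖z‖ ^ 2) := by
    simpa using ((hasDerivAt_id (‖z‖ ^ 2)).add_const (ε ^ 2)).rpow_const (p := p)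
      (Or.inl (hpos z).ne')
  have hcd (p : ℝ) : ContDiff ℝ 1 fun z : Space n => (‖z‖ ^ 2 + ε ^ 2) ^ p :=
    ((contDiff_norm_sq ℝ).add contDiff_const).rpow_const_of_ne fun z => (hpos z).ne'
  have hk (z : Space n) := hasGradientAt_comp_norm_sq (hd m z)
  have hdk (z : Space n) : divergence
      (fun z : Space n => (2 * (m * (‖z‖ ^ 2 + ε ^ 2) ^ (m - 1))) • z) z =
      -(n * (n - 2) * (ε ^ 2 * (‖z‖ ^ 2 + ε ^ 2) ^ (-1 - (n : ℝ) / 2))) := by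
    have h := divergence_comp_norm_sq_smul (((hd (m - 1) z).const_mul m).const_mul 2)
    rw [h]
    have e1 : m - 1 - 1 = -1 - (n : ℝ) / 2 := by rw [hm]; ring
    have e2 : (‖z‖ ^ 2 + ε ^ 2) ^ (m - 1) =
        (‖z‖ ^ 2 + ε ^ 2) ^ (-1 - (n : ℝ) / 2) * (‖z‖ ^ 2 + ε ^ 2) := by
      rw [← Real.rpow_add_one (hpos z).ne', ← e1]
      ring_nf
    rw [e1, e2, hm]
    ring
  have hVd (z : Space n) : DifferentiableAt ℝ V z := hV.differentiable one_ne_zero z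
  have hGd : ContDiff ℝ 1
      (fun z : Space n => (2 * (m * (‖z‖ ^ 2 + ε ^ 2) ^ (m - 1))) • z) :=
    (contDiff_const.mul (contDiff_const.mul (hcd (m - 1)))).smul contDiff_id
  have h0 : ∫ z : Space n, divergence (fun z => (‖z‖ ^ 2 + ε ^ 2) ^ m • V z -
      g z • ((2 * (m * (‖z‖ ^ 2 + ε ^ 2) ^ (m - 1))) • z)) z = 0 := by
    refine integral_divergence_eq_zero (((hcd m).smul hV).sub (hgC1.smul hGd)) ?_
    refine HasCompactSupport.intro (hcV.isCompact.union hc.isCompact) fun z hz => ?_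
    rw [Set.mem_union, not_or] at hz
    rw [image_eq_zero_of_notMem_tsupport hz.1, image_eq_zero_of_notMem_tsupport hz.2, smul_zero,
      zero_smul, sub_zero]
  have hint1 : Integrable fun y : Space n => (‖y‖ ^ 2 + ε ^ 2) ^ m * divergence V y :=
    ((hcd m).continuous.mul hdivc).integrable_of_hasCompactSupport hdivs.mul_left
  have hint2 : Integrable fun y : Space n =>
      n * (n - 2) * ((ε ^ 2 * (‖y‖ ^ 2 + ε ^ 2) ^ (-1 - (n : ℝ) / 2)) * g y) :=
    (continuous_const.mul ((continuous_const.mul (hcd _).continuous).mul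
      hgc)).integrable_of_hasCompactSupport (hc.mul_left.mul_left)
  have hpt (z : Space n) : divergence (fun z => (‖z‖ ^ 2 + ε ^ 2) ^ m • V z -
      g z • ((2 * (m * (‖z‖ ^ 2 + ε ^ 2) ^ (m - 1))) • z)) z =
      (‖z‖ ^ 2 + ε ^ 2) ^ m * divergence V z +
      n * (n - 2) * ((ε ^ 2 * (‖z‖ ^ 2 + ε ^ 2) ^ (-1 - (n : ℝ) / 2)) * g z) := by
    rw [divergence_sub ((hk z).differentiableAt.fun_smul (hVd z))
      ((hg z).differentiableAt.fun_smul (hGd.differentiable one_ne_zero z)),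
      divergence_smul (hk z) (hVd z), divergence_smul (hg z) (hGd.differentiable one_ne_zero z),
      hdk]
    rw [inner_smul_left, inner_smul_right, real_inner_comm]
    simp
    ring
  simp_rw [hpt] at h0
  rw [integral_add hint1 hint2, integral_const_mul] at h0
  have hsub := Measure.integral_comp_smul (μ := (volume : Measure (Space n)))
    (fun y => (ε ^ 2 * (‖y‖ ^ 2 + ε ^ 2) ^ (-1 - (n : ℝ) / 2)) * g y) ε
  have hsc (y : Space n) : (ε ^ 2 * (‖ε • y‖ ^ 2 + ε ^ 2) ^ (-1 - (n : ℝ) / 2)) * g (ε • y) =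
      (ε ^ n)⁻¹ * ((1 + ‖y‖ ^ 2) ^ (-1 - (n : ℝ) / 2) * g (ε • y)) := by
    have e1 : ‖ε • y‖ ^ 2 + ε ^ 2 = ε ^ 2 * (1 + ‖y‖ ^ 2) := by
      rw [norm_smul, Real.norm_of_nonneg hε.le]; ring
    have e2 : ε ^ 2 * (ε ^ 2) ^ (-1 - (n : ℝ) / 2) = (ε ^ n)⁻¹ := by
      rw [mul_comm, ← Real.rpow_add_one (by positivity), ← Real.rpow_natCast ε 2,
        ← Real.rpow_mul hε.le, ← Real.rpow_natCast ε n, ← Real.rpow_neg hε.le]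
      congr 1
      push_cast
      ring
    rw [e1, Real.mul_rpow (by positivity) (by positivity), ← e2]
    ring
  simp_rw [hsc, integral_const_mul, finrank_euclideanSpace_fin, smul_eq_mul] at hsub
  rw [abs_of_pos (by positivity)] at hsub
  have := mul_left_cancel₀ (by positivity) hsub
  rw [this]
  linarith

/-- The Newtonian potential representation of a compactly supported function at the origin. -/
lemma integral_kernel_mul_divergence (hn : 3 ≤ n) {g : Space n → ℝ} {V : Space n → Space n}
    (hg : ∀ x, HasGradientAt g (V x) x) (hV : ContDiff ℝ 1 V) (hc : HasCompactSupport g) :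
    ∫ y, kernel n y * divergence V y = -(greenConst n * g 0) := by
  have hcV := hasCompactSupport_of_hasGradientAt hg hc
  have hgc := (contDiff_one_of_hasGradientAt hg hV.continuous).continuous
  set m : ℝ := 1 - (n : ℝ) / 2 with hm
  have hdivc := divergence_continuous hV
  have hdivs := hasCompactSupport_divergence hcV
  have hid (ε : ℝ) (hε : 0 < ε) := integral_regularized_kernel_mul_divergence hg hV hc hε
  have hn2 : (2 : ℝ) ≤ n := by exact_mod_cast (by omega : 2 ≤ n)
  have hm0 : m < 0 := by
    have : (3 : ℝ) ≤ n := by exact_mod_cast hn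
    rw [hm]; linarith
  have : Nonempty (Fin n) := ⟨⟨0, by omega⟩⟩
  have hne : ∀ᵐ y : Space n, y ≠ 0 := by
    simp [ae_iff]
  -- The exponent `m` is negative, so the regularized kernels lie below `kernel n`. Its product with
  -- the compactly supported `divergence V` is an integrable majorant.
  have hlim1 : Tendsto (fun ε : ℝ => ∫ y : Space n, (‖y‖ ^ 2 + ε ^ 2) ^ m * divergence V y)
      (𝓝[>] 0) (𝓝 (∫ y, kernel n y * divergence V y)) := by
    refine tendsto_integral_filter_of_dominated_convergence
      (fun y => ‖kernel n y * divergence V y‖) ?_ ?_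
      (integrable_kernel_mul (by omega) hdivc hdivs).norm ?_
    · refine .of_forall fun ε => ?_
      exact (Measurable.aestronglyMeasurable (by fun_prop)).mul hdivc.aestronglyMeasurable
    · filter_upwards [self_mem_nhdsWithin] with ε (hε : 0 < ε)
      filter_upwards [hne] with y hy
      have hy' : 0 < ‖y‖ := norm_pos_iff.2 hy
      rw [norm_mul, norm_mul, kernel_eq_norm_sq_rpow]
      gcongr ?_ * _
      rw [Real.norm_of_nonneg (by positivity), Real.norm_of_nonneg (by positivity)]
      exact Real.rpow_le_rpow_of_nonpos (by positivity) (by nlinarith [sq_nonneg ε]) hm0.le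
    · filter_upwards [hne] with y hy
      have hy' : 0 < ‖y‖ := norm_pos_iff.2 hy
      rw [kernel_eq_norm_sq_rpow]
      refine Tendsto.mul_const _ (Tendsto.rpow_const ?_ (Or.inl (by positivity)))
      have : Tendsto (fun ε : ℝ => ‖y‖ ^ 2 + ε ^ 2) (𝓝 0) (𝓝 (‖y‖ ^ 2 + 0 ^ 2)) :=
        (continuous_const.add (continuous_pow 2)).tendsto 0
      simpa using this.mono_left nhdsWithin_le_nhds
  have hI := integral_one_add_norm_sq_rpow (n := n) (by omega)
  obtain ⟨M, hM⟩ := hgc.bounded_above_of_compact_support hc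
  have hlim2 : Tendsto (fun ε : ℝ => ∫ y : Space n,
      (1 + ‖y‖ ^ 2) ^ (-1 - (n : ℝ) / 2) * g (ε • y)) (𝓝[>] 0)
      (𝓝 (∫ y : Space n, (1 + ‖y‖ ^ 2) ^ (-1 - (n : ℝ) / 2) * g 0)) := by
    refine tendsto_integral_filter_of_dominated_convergence
      (fun y => (1 + ‖y‖ ^ 2) ^ (-1 - (n : ℝ) / 2) * M) ?_ ?_ (hI.1.mul_const M) ?_
    · refine .of_forall fun ε => ?_
      exact hI.1.aestronglyMeasurable.mul
        (hgc.comp (continuous_const_smul ε)).aestronglyMeasurable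
    · refine .of_forall fun ε => .of_forall fun y => ?_
      rw [norm_mul, Real.norm_of_nonneg (by positivity)]
      gcongr
      exact hM _
    · refine .of_forall fun y => ?_
      refine Tendsto.const_mul _ ?_
      have : Tendsto (fun ε : ℝ => g (ε • y)) (𝓝 0) (𝓝 (g ((0 : ℝ) • y))) :=
        (hgc.comp (continuous_id.smul continuous_const)).tendsto 0
      rw [zero_smul] at this
      exact this.mono_left nhdsWithin_le_nhds
  have hlim3 := (hlim2.const_mul ((n : ℝ) * (n - 2))).neg
  have huniq := tendsto_nhds_unique (hlim1.congr' (by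
    filter_upwards [self_mem_nhdsWithin] with ε hε using hid ε hε)) hlim3
  rw [huniq, integral_mul_const, hI.2, greenConst]
  ring

/-- The Newtonian potential representation of a compactly supported function. -/
lemma integral_kernel_sub_mul_divergence (hn : 3 ≤ n) {g : Space n → ℝ} {V : Space n → Space n}
    (hg : ∀ x, HasGradientAt g (V x) x) (hV : ContDiff ℝ 1 V) (hc : HasCompactSupport g)
    (x : Space n) :
    ∫ y, kernel n (x - y) * divergence V y = -(greenConst n * g x) := by
  have h := integral_kernel_mul_divergence hn (g := fun y => g (x + y)) (V := fun y => V (x + y))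
    (fun y => by
      have := (hg (x + y)).hasFDerivAt
      exact (hasFDerivAt_comp_add_left x).2 this)
    (hV.comp (contDiff_const.add contDiff_id))
    (hc.comp_homeomorph (Homeomorph.addLeft x))
  simp only [add_zero] at h
  rw [← h, ← integral_add_left_eq_self _ x]
  refine integral_congr_ae (.of_forall fun y => ?_)
  simp [kernel, divergence_comp_add]

end

/-! ### Derivatives and Taylor expansion of the Newtonian kernel. -/

section

variable {n : ℕ}

/-- The gradient of the Newtonian kernel. -/
def kernelGrad (n : ℕ) (x : Space n) : Space n :=
  ((2 - (n : ℝ)) * (‖x‖ ^ 2) ^ (-((n : ℝ) / 2))) • x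

lemma hasGradientAt_kernel {x : Space n} (hx : x ≠ 0) :
    HasGradientAt (kernel n) (kernelGrad n x) x := by
  have hpos : 0 < ‖x‖ ^ 2 := by positivity
  have h := hasGradientAt_comp_norm_sq (z := x)
    (Real.hasDerivAt_rpow_const (p := 1 - (n : ℝ) / 2) (Or.inl hpos.ne'))
  have e : kernel n = fun z : Space n => (‖z‖ ^ 2) ^ (1 - (n : ℝ) / 2) :=
    funext kernel_eq_norm_sq_rpow
  rw [e, kernelGrad]
  convert! h using 2
  have : 1 - (n : ℝ) / 2 - 1 = -((n : ℝ) / 2) := by ring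
  rw [this]
  ring

lemma pd_eq_of_hasGradientAt {f : Space n → ℝ} {v x : Space n} (h : HasGradientAt f v x)
    (i : Fin n) : pd i f x = v i := by
  rw [pd, h.hasFDerivAt.fderiv]
  simp [EuclideanSpace.inner_single_right]

lemma pd_kernel {x : Space n} (hx : x ≠ 0) (i : Fin n) :
    pd i (kernel n) x = (2 - (n : ℝ)) * (‖x‖ ^ 2) ^ (-((n : ℝ) / 2)) * x i := by
  rw [pd_eq_of_hasGradientAt (hasGradientAt_kernel hx)]
  simp [kernelGrad]

lemma pd_pd_kernel {x : Space n} (hx : x ≠ 0) (i j : Fin n) :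
    pd i (pd j (kernel n)) x = (2 - (n : ℝ)) * ((‖x‖ ^ 2) ^ (-((n : ℝ) / 2)) *
      (if i = j then 1 else 0) - n * (‖x‖ ^ 2) ^ (-((n : ℝ) / 2) - 1) * (x i * x j)) := by
  have hpos : 0 < ‖x‖ ^ 2 := by positivity
  have h1 := (hasGradientAt_comp_norm_sq (z := x) ((Real.hasDerivAt_rpow_const
    (p := -((n : ℝ) / 2)) (Or.inl hpos.ne')).const_mul (2 - (n : ℝ)))).hasFDerivAt
  have h2 : HasFDerivAt
      (fun y : Space n => (2 - (n : ℝ)) * (‖y‖ ^ 2) ^ (-((n : ℝ) / 2)) * y j) _ x :=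
    h1.mul (EuclideanSpace.proj j : Space n →L[ℝ] ℝ).hasFDerivAt
  have h3 : pd j (kernel n) =ᶠ[𝓝 x]
      fun y => (2 - (n : ℝ)) * (‖y‖ ^ 2) ^ (-((n : ℝ) / 2)) * y j := by
    filter_upwards [isOpen_ne.mem_nhds hx] with y hy using pd_kernel hy j
  rw [pd, h3.fderiv_eq, h2.fderiv]
  by_cases hij : i = j
  · subst hij
    simp [EuclideanSpace.inner_single_right]
    ring
  · simp [hij, Ne.symm hij, EuclideanSpace.inner_single_right]
    ring

lemma pd_pd_kernel_comm {x : Space n} (hx : x ≠ 0) (i j : Fin n) :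
    pd i (pd j (kernel n)) x = pd j (pd i (kernel n)) x := by
  rw [pd_pd_kernel hx, pd_pd_kernel hx, mul_comm (x i)]
  simp only [eq_comm]

lemma sum_pd_pd_kernel {x : Space n} (hx : x ≠ 0) : ∑ i, pd i (pd i (kernel n)) x = 0 := by
  have hpos : 0 < ‖x‖ ^ 2 := by positivity
  simp_rw [pd_pd_kernel hx]
  rw [← Finset.mul_sum, Finset.sum_sub_distrib]
  simp only [if_true, mul_one, Finset.sum_const, Finset.card_univ, Fintype.card_fin, nsmul_eq_mul,
    ← Finset.mul_sum, ← sq]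
  rw [← EuclideanSpace.real_norm_sq_eq, mul_assoc, ← Real.rpow_add_one hpos.ne']
  simp

lemma sum_mul_pd_kernel {x : Space n} (hx : x ≠ 0) (y : Space n) :
    ∑ i, y i * pd i (kernel n) x = (2 - (n : ℝ)) * (‖x‖ ^ 2) ^ (-((n : ℝ) / 2)) * ⟪x, y⟫_ℝ := by
  simp_rw [pd_kernel hx]
  rw [PiLp.inner_apply, Finset.mul_sum]
  refine Finset.sum_congr rfl fun i _ => ?_
  simp
  ring

lemma sum_mul_pd_pd_kernel {x : Space n} (hx : x ≠ 0) (y : Space n) :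
    ∑ i, ∑ j, y i * y j * pd i (pd j (kernel n)) x =
      (2 - (n : ℝ)) * ((‖x‖ ^ 2) ^ (-((n : ℝ) / 2)) * ‖y‖ ^ 2 -
        n * (‖x‖ ^ 2) ^ (-((n : ℝ) / 2) - 1) * ⟪x, y⟫_ℝ ^ 2) := by
  have e1 : ‖y‖ ^ 2 = ∑ i, ∑ j, y i * y j * (if i = j then 1 else 0) := by
    rw [EuclideanSpace.real_norm_sq_eq]
    simp [sq]
  have e2 : ⟪x, y⟫_ℝ ^ 2 = ∑ i, ∑ j, y i * y j * (x i * x j) := by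
    rw [PiLp.inner_apply, sq, Finset.sum_mul_sum]
    refine Finset.sum_congr rfl fun i _ => Finset.sum_congr rfl fun j _ => ?_
    simp
    ring
  simp_rw [pd_pd_kernel hx]
  rw [e1, e2]
  simp only [Finset.mul_sum, ← Finset.sum_sub_distrib]
  refine Finset.sum_congr rfl fun i _ => Finset.sum_congr rfl fun j _ => ?_
  ring

/-- A third order Taylor estimate on the unit interval. -/
lemma abs_sub_taylor_two_le {f f₁ f₂ f₃ : ℝ → ℝ} {M : ℝ}
    (h0 : ∀ t ∈ Set.Icc (0 : ℝ) 1, HasDerivAt f (f₁ t) t)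
    (h1 : ∀ t ∈ Set.Icc (0 : ℝ) 1, HasDerivAt f₁ (f₂ t) t)
    (h2 : ∀ t ∈ Set.Icc (0 : ℝ) 1, HasDerivAt f₂ (f₃ t) t)
    (h3 : ∀ t ∈ Set.Icc (0 : ℝ) 1, |f₃ t| ≤ M) :
    |f 1 - (f 0 + f₁ 0 + 1 / 2 * f₂ 0)| ≤ M := by
  have hM : 0 ≤ M := (abs_nonneg _).trans (h3 0 (by simp))
  have key {g g' : ℝ → ℝ} (hg : ∀ t ∈ Set.Icc (0 : ℝ) 1, HasDerivAt g (g' t) t)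
      (hg' : ∀ t ∈ Set.Icc (0 : ℝ) 1, |g' t| ≤ M) (t : ℝ) (ht : t ∈ Set.Icc (0 : ℝ) 1) :
      |g t - g 0| ≤ M := by
    have := (convex_Icc (0 : ℝ) 1).norm_image_sub_le_of_norm_hasDerivWithin_le (f := g)
      (fun s hs => (hg s hs).hasDerivWithinAt) (fun s hs => by simpa using hg' s hs)
      (Set.left_mem_Icc.2 zero_le_one) ht
    simp only [Real.norm_eq_abs, sub_zero] at this
    refine this.trans ?_
    rw [abs_of_nonneg ht.1]
    exact mul_le_of_le_one_right hM ht.2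
  -- The bound `M` passes in turn to the Taylor remainders of `f₂`, `f₁` and `f` by the mean value
  -- inequality; the factor `1/6` is given away.
  have a2 := key h2 h3
  have a1 := key (g := fun t => f₁ t - t * f₂ 0) (g' := fun t => f₂ t - f₂ 0)
    (fun t ht => by simpa using (h1 t ht).fun_sub ((hasDerivAt_id t).mul_const (f₂ 0))) a2
  have a0 := key (g := fun t => f t - t * f₁ 0 - t ^ 2 / 2 * f₂ 0)
    (g' := fun t => f₁ t - t * f₂ 0 - (f₁ 0 - 0 * f₂ 0))
    (fun t ht => by
      have h := ((h0 t ht).fun_sub ((hasDerivAt_id t).mul_const (f₁ 0))).fun_sub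
        (((hasDerivAt_pow 2 t).div_const 2).mul_const (f₂ 0))
      refine h.congr_deriv ?_
      simp
      ring) a1 1 (by simp)
  convert! a0 using 2
  ring

/-- The whole segment from `x` to `x - y` keeps away from the singularity at the origin, so negative
powers of the norm along it are comparable to those at `x`. -/
lemma half_norm_le_norm_sub_smul {x y : Space n} (h : 2 * ‖y‖ ≤ ‖x‖) {t : ℝ}
    (ht : t ∈ Set.Icc (0 : ℝ) 1) : ‖x‖ / 2 ≤ ‖x - t • y‖ := by
  have h1 : ‖t • y‖ ≤ ‖y‖ := by
    rw [norm_smul, Real.norm_of_nonneg ht.1]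
    exact mul_le_of_le_one_left (norm_nonneg y) ht.2
  have := norm_sub_norm_le x (t • y)
  linarith

lemma norm_sq_rpow (z : Space n) (p : ℝ) : (‖z‖ ^ 2) ^ p = ‖z‖ ^ (2 * p) := by
  rw [← Real.rpow_natCast, ← Real.rpow_mul (norm_nonneg z)]
  norm_num

lemma rpow_norm_sub_le {x y : Space n} (hx : x ≠ 0) (h : 2 * ‖y‖ ≤ ‖x‖) {t : ℝ}
    (ht : t ∈ Set.Icc (0 : ℝ) 1) {p : ℝ} (hp : p ≤ 0) :
    ‖x - t • y‖ ^ p ≤ 2 ^ (-p) * ‖x‖ ^ p := by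
  have hx' : 0 < ‖x‖ := norm_pos_iff.2 hx
  refine (Real.rpow_le_rpow_of_nonpos (by positivity) (half_norm_le_norm_sub_smul h ht) hp).trans
    (le_of_eq ?_)
  rw [Real.div_rpow hx'.le (by norm_num), Real.rpow_neg (by norm_num), div_eq_inv_mul]

lemma hasDerivAt_norm_sub_smul_sq (x y : Space n) (t : ℝ) :
    HasDerivAt (fun t : ℝ => ‖x - t • y‖ ^ 2) (-2 * ⟪x - t • y, y⟫_ℝ) t := by
  have h : HasDerivAt (fun t : ℝ => x - t • y) (-y) t := by
    simpa using ((hasDerivAt_id t).smul_const y).const_sub x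
  refine h.norm_sq.congr_deriv ?_
  simp [inner_neg_right]

/-- The second order multipole expansion of the Newtonian kernel, with remainder estimate. -/
lemma kernel_taylor (n : ℕ) : ∃ C : ℝ, 0 ≤ C ∧ ∀ x y : Space n, x ≠ 0 → 2 * ‖y‖ ≤ ‖x‖ →
    |kernel n (x - y) - (kernel n x - ∑ i, y i * pd i (kernel n) x +
      1 / 2 * ∑ i, ∑ j, y i * y j * pd i (pd j (kernel n)) x)| ≤
      C * ‖y‖ ^ 3 * ‖x‖ ^ (-(n : ℝ) - 1) := by
  set m : ℝ := 1 - (n : ℝ) / 2 with hm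
  set A : ℝ := |m * (m - 1) * (m - 2)| with hA
  set D : ℝ := |m * (m - 1)| with hD
  -- Let `Q(t) = ‖x - t y‖²`, a quadratic polynomial with `|Q'| ≤ 2 s ‖y‖` and `Q'' = 2 ‖y‖²`, where
  -- `s = ‖x - t y‖`. The third derivative of `Q^m` is `3 m(m-1) Q' Q'' Q^{m-2} + m(m-1)(m-2) Q'^3
  -- Q^{m-3}`; the two terms give `12 D` and `8 A`, each times `‖y‖³ s^{-n-1}`. The power of two
  -- comes from `s ≥ ‖x‖ / 2`.
  refine ⟨(8 * A + 12 * D) * 2 ^ ((n : ℝ) + 1), by positivity, fun x y hx hxy => ?_⟩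
  have hx' : 0 < ‖x‖ := norm_pos_iff.2 hx
  have hpos {t : ℝ} (ht : t ∈ Set.Icc (0 : ℝ) 1) : 0 < ‖x - t • y‖ :=
    (by positivity : 0 < ‖x‖ / 2).trans_le (half_norm_le_norm_sub_smul hxy ht)
  have hQ (t : ℝ) := hasDerivAt_norm_sub_smul_sq x y t
  have hQ' (t : ℝ) : HasDerivAt (fun t : ℝ => -2 * ⟪x - t • y, y⟫_ℝ) (2 * ‖y‖ ^ 2) t := by
    have h : HasDerivAt (fun t : ℝ => x - t • y) (-y) t := by
      simpa using ((hasDerivAt_id t).smul_const y).const_sub x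
    have h2 := (h.inner ℝ (hasDerivAt_const t y)).const_mul (-2)
    refine h2.congr_deriv ?_
    simp [inner_neg_left]
  have hR (p : ℝ) {t : ℝ} (ht : t ∈ Set.Icc (0 : ℝ) 1) :
      HasDerivAt (fun t : ℝ => (‖x - t • y‖ ^ 2) ^ p)
        ((-2 * ⟪x - t • y, y⟫_ℝ) * p * (‖x - t • y‖ ^ 2) ^ (p - 1)) t :=
    (hQ t).rpow_const (Or.inl (pow_pos (hpos ht) 2).ne')
  have hT := abs_sub_taylor_two_le (f := fun t => kernel n (x - t • y))
    (f₁ := fun t => (-2 * ⟪x - t • y, y⟫_ℝ) * (m * (‖x - t • y‖ ^ 2) ^ (m - 1)))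
    (f₂ := fun t => (2 * ‖y‖ ^ 2) * (m * (‖x - t • y‖ ^ 2) ^ (m - 1)) +
      (-2 * ⟪x - t • y, y⟫_ℝ) ^ 2 * (m * (m - 1) * (‖x - t • y‖ ^ 2) ^ (m - 2)))
    (f₃ := fun t => 3 * (2 * ‖y‖ ^ 2) * (-2 * ⟪x - t • y, y⟫_ℝ) *
        (m * (m - 1) * (‖x - t • y‖ ^ 2) ^ (m - 2)) +
      (-2 * ⟪x - t • y, y⟫_ℝ) ^ 3 * (m * (m - 1) * (m - 2) * (‖x - t • y‖ ^ 2) ^ (m - 3)))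
    (M := (8 * A + 12 * D) * 2 ^ ((n : ℝ) + 1) * ‖y‖ ^ 3 * ‖x‖ ^ (-(n : ℝ) - 1)) ?_ ?_ ?_ ?_
  · have e1 : m - 1 = -((n : ℝ) / 2) := by rw [hm]; ring
    have e2 : m - 2 = -((n : ℝ) / 2) - 1 := by rw [hm]; ring
    simp only [one_smul, zero_smul, sub_zero, e1, e2] at hT
    rw [sum_mul_pd_kernel hx, sum_mul_pd_pd_kernel hx]
    convert! hT using 3
    rw [hm]
    ring
  · intro t ht
    simp_rw [kernel_eq_norm_sq_rpow]
    refine (hR m ht).congr_deriv ?_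
    ring
  · intro t ht
    refine ((hQ' t).mul ((hR (m - 1) ht).const_mul m)).congr_deriv ?_
    rw [show m - 1 - 1 = m - 2 by ring]
    ring
  · intro t ht
    have h := (((hR (m - 1) ht).const_mul m).const_mul (2 * ‖y‖ ^ 2)).add
      (((hQ' t).pow 2).mul ((hR (m - 2) ht).const_mul (m * (m - 1))))
    refine h.congr_deriv ?_
    rw [show m - 1 - 1 = m - 2 by ring, show m - 2 - 1 = m - 3 by ring]
    simp only [Pi.pow_apply]
    push_cast
    ring
  · intro t ht
    set s := ‖x - t • y‖ with hs
    have hs0 : 0 < s := hpos ht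
    set b := ⟪x - t • y, y⟫_ℝ with hb
    have hb' : |b| ≤ s * ‖y‖ := abs_real_inner_le_norm _ _
    have hb3 : |b| ^ 3 ≤ (s * ‖y‖) ^ 3 := pow_le_pow_left₀ (abs_nonneg b) hb' 3
    have e1 : (s ^ 2) ^ (m - 2) * s = s ^ (-(n : ℝ) - 1) := by
      rw [hs, norm_sq_rpow, ← Real.rpow_add_one hs0.ne']
      congr 1
      rw [hm]; ring
    have e2 : (s ^ 2) ^ (m - 3) * s ^ 3 = s ^ (-(n : ℝ) - 1) := by
      rw [hs, norm_sq_rpow, ← Real.rpow_natCast, ← Real.rpow_add hs0]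
      congr 1
      rw [hm]; push_cast; ring
    have hle : s ^ (-(n : ℝ) - 1) ≤ 2 ^ ((n : ℝ) + 1) * ‖x‖ ^ (-(n : ℝ) - 1) := by
      have h := rpow_norm_sub_le hx hxy ht (p := -(n : ℝ) - 1)
        (by have : (0 : ℝ) ≤ n := Nat.cast_nonneg n
            linarith)
      rwa [show -(-(n : ℝ) - 1) = (n : ℝ) + 1 by ring] at h
    calc _ ≤ |3 * (2 * ‖y‖ ^ 2) * (-2 * b) * (m * (m - 1) * (s ^ 2) ^ (m - 2))| +
          |(-2 * b) ^ 3 * (m * (m - 1) * (m - 2) * (s ^ 2) ^ (m - 3))| := abs_add_le _ _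
      _ = 12 * D * ‖y‖ ^ 2 * (s ^ 2) ^ (m - 2) * |b| +
          8 * A * (s ^ 2) ^ (m - 3) * |b| ^ 3 := by
        have p1 : 0 ≤ (s ^ 2) ^ (m - 2) := by positivity
        have p2 : 0 ≤ (s ^ 2) ^ (m - 3) := by positivity
        simp only [hA, hD, abs_mul, abs_pow, abs_neg, abs_of_nonneg p1, abs_of_nonneg p2, abs_norm,
          abs_two, abs_of_pos (zero_lt_three' ℝ)]
        ring
      _ ≤ 12 * D * ‖y‖ ^ 2 * (s ^ 2) ^ (m - 2) * (s * ‖y‖) +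
          8 * A * (s ^ 2) ^ (m - 3) * (s * ‖y‖) ^ 3 := by gcongr
      _ = (8 * A + 12 * D) * ‖y‖ ^ 3 * s ^ (-(n : ℝ) - 1) := by
        have : 12 * D * ‖y‖ ^ 2 * (s ^ 2) ^ (m - 2) * (s * ‖y‖) +
          8 * A * (s ^ 2) ^ (m - 3) * (s * ‖y‖) ^ 3 =
          12 * D * ‖y‖ ^ 3 * ((s ^ 2) ^ (m - 2) * s) +
          8 * A * ‖y‖ ^ 3 * ((s ^ 2) ^ (m - 3) * s ^ 3) := by ring
        rw [this, e1, e2]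
        ring
      _ ≤ (8 * A + 12 * D) * ‖y‖ ^ 3 * (2 ^ ((n : ℝ) + 1) * ‖x‖ ^ (-(n : ℝ) - 1)) := by gcongr
      _ = _ := by ring

/-- The variation of the gradient of the Newtonian kernel. -/
lemma norm_kernelGrad_sub_le (n : ℕ) : ∃ C : ℝ, 0 ≤ C ∧ ∀ x y : Space n, x ≠ 0 →
    2 * ‖y‖ ≤ ‖x‖ → ‖kernelGrad n (x - y) - kernelGrad n x‖ ≤ C * ‖y‖ * ‖x‖ ^ (-(n : ℝ)) := by
  -- With `z = x - t y`, the derivative in `t` is `(2 - n)` times `-‖z‖^{-n} y + n ‖z‖^{-n-2} ⟪z, y⟫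
  -- z`, whose norm is at most `(n + 1) ‖y‖ ‖z‖^{-n}`; again `‖z‖ ≥ ‖x‖ / 2`.
  refine ⟨|2 - (n : ℝ)| * (n + 1) * 2 ^ (n : ℝ), by positivity, fun x y hx hxy => ?_⟩
  have hx' : 0 < ‖x‖ := norm_pos_iff.2 hx
  have hpos {t : ℝ} (ht : t ∈ Set.Icc (0 : ℝ) 1) : 0 < ‖x - t • y‖ :=
    (by positivity : 0 < ‖x‖ / 2).trans_le (half_norm_le_norm_sub_smul hxy ht)
  have hd : ∀ t ∈ Set.Icc (0 : ℝ) 1, HasDerivAt (fun t : ℝ => kernelGrad n (x - t • y))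
      (((2 - (n : ℝ)) * (‖x - t • y‖ ^ 2) ^ (-((n : ℝ) / 2))) • (-y) +
        ((2 - (n : ℝ)) * ((-2 * ⟪x - t • y, y⟫_ℝ) * (-((n : ℝ) / 2)) *
          (‖x - t • y‖ ^ 2) ^ (-((n : ℝ) / 2) - 1))) • (x - t • y)) t := by
    intro t ht
    have h : HasDerivAt (fun t : ℝ => x - t • y) (-y) t := by
      simpa using ((hasDerivAt_id t).smul_const y).const_sub x
    exact (((hasDerivAt_norm_sub_smul_sq x y t).rpow_const
      (Or.inl (pow_pos (hpos ht) 2).ne')).const_mul _).smul h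
  have hb : ∀ t ∈ Set.Icc (0 : ℝ) 1, ‖(((2 - (n : ℝ)) * (‖x - t • y‖ ^ 2) ^ (-((n : ℝ) / 2))) • (-y) +
        ((2 - (n : ℝ)) * ((-2 * ⟪x - t • y, y⟫_ℝ) * (-((n : ℝ) / 2)) *
          (‖x - t • y‖ ^ 2) ^ (-((n : ℝ) / 2) - 1))) • (x - t • y))‖ ≤
        |2 - (n : ℝ)| * (n + 1) * 2 ^ (n : ℝ) * ‖y‖ * ‖x‖ ^ (-(n : ℝ)) := by
    intro t ht
    set s := ‖x - t • y‖ with hs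
    have hs0 : 0 < s := hpos ht
    set b := ⟪x - t • y, y⟫_ℝ with hb
    have hb' : |b| ≤ s * ‖y‖ := abs_real_inner_le_norm _ _
    have e1 : (s ^ 2) ^ (-((n : ℝ) / 2)) = s ^ (-(n : ℝ)) := by
      rw [hs, norm_sq_rpow]
      congr 1
      ring
    have e2 : (s ^ 2) ^ (-((n : ℝ) / 2) - 1) * s ^ 2 = s ^ (-(n : ℝ)) := by
      rw [hs, norm_sq_rpow, ← Real.rpow_natCast, ← Real.rpow_add hs0]
      congr 1
      push_cast
      ring
    have hle : s ^ (-(n : ℝ)) ≤ 2 ^ (n : ℝ) * ‖x‖ ^ (-(n : ℝ)) := by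
      have h := rpow_norm_sub_le hx hxy ht (p := -(n : ℝ)) (by simp)
      rwa [neg_neg] at h
    calc _ ≤ |2 - (n : ℝ)| * (s ^ 2) ^ (-((n : ℝ) / 2)) * ‖y‖ +
          |2 - (n : ℝ)| * (n * |b| * (s ^ 2) ^ (-((n : ℝ) / 2) - 1)) * s := by
            refine (norm_add_le _ _).trans (le_of_eq ?_)
            have p1 : 0 ≤ (s ^ 2) ^ (-((n : ℝ) / 2)) := by positivity
            have p2 : 0 ≤ (s ^ 2) ^ (-((n : ℝ) / 2) - 1) := by positivity
            rw [norm_smul, norm_smul, norm_neg, ← hs, Real.norm_eq_abs, Real.norm_eq_abs, abs_mul,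
              abs_mul, abs_of_nonneg p1, abs_mul _ (_ ^ (-((n : ℝ) / 2) - 1)), abs_of_nonneg p2]
            have : |-2 * b * -((n : ℝ) / 2)| = n * |b| := by
              rw [show -2 * b * -((n : ℝ) / 2) = n * b by ring, abs_mul, Nat.abs_cast]
            rw [this]
      _ ≤ |2 - (n : ℝ)| * (s ^ 2) ^ (-((n : ℝ) / 2)) * ‖y‖ +
          |2 - (n : ℝ)| * (n * (s * ‖y‖) * (s ^ 2) ^ (-((n : ℝ) / 2) - 1)) * s := by gcongr
      _ = |2 - (n : ℝ)| * (n + 1) * ‖y‖ * s ^ (-(n : ℝ)) := by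
        have : |2 - (n : ℝ)| * (n * (s * ‖y‖) * (s ^ 2) ^ (-((n : ℝ) / 2) - 1)) * s =
          |2 - (n : ℝ)| * n * ‖y‖ * ((s ^ 2) ^ (-((n : ℝ) / 2) - 1) * s ^ 2) := by ring
        rw [this, e1, e2]
        ring
      _ ≤ |2 - (n : ℝ)| * (n + 1) * ‖y‖ * (2 ^ (n : ℝ) * ‖x‖ ^ (-(n : ℝ))) := by gcongr
      _ = _ := by ring
  have := (convex_Icc (0 : ℝ) 1).norm_image_sub_le_of_norm_hasDerivWithin_le
    (fun t ht => (hd t ht).hasDerivWithinAt) hb (Set.left_mem_Icc.2 zero_le_one)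
    (Set.right_mem_Icc.2 zero_le_one)
  simpa using this

end

/-! ### An area formula for Hausdorff measure. -/

section

section AreaFormula

open Measure Module

variable {V E : Type*} [NormedAddCommGroup V] [InnerProductSpace ℝ V] [FiniteDimensional ℝ V]
  [MeasurableSpace V] [BorelSpace V] [NormedAddCommGroup E] [InnerProductSpace ℝ E]
  [MeasurableSpace E] [BorelSpace E]

/-- The hypothesis says that `a ∘ b⁻¹` is well defined and `K`-Lipschitz on `b '' A`, and such a map
enlarges `d`-dimensional measure by at most `K ^ d`. It serves to compare a map with its
linearization, in both directions. -/
lemma euclideanHausdorffMeasure_image_le_of_dist_le {X Y : Type*} [MetricSpace Y]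
    [MeasurableSpace Y] [BorelSpace Y] {a b : X → Y} {A : Set X} {K : ℝ≥0}
    (h : ∀ x ∈ A, ∀ y ∈ A, dist (a x) (a y) ≤ K * dist (b x) (b y)) (d : ℕ) :
    μHE[d] (a '' A) ≤ (K : ENNReal) ^ d * μHE[d] (b '' A) := by
  classical
  rcases A.eq_empty_or_nonempty with rfl | hne
  · simp
  have : Nonempty X := ⟨hne.some⟩
  set g : Y → Y := a ∘ Function.invFunOn b A
  have hmem {z : Y} (hz : z ∈ b '' A) : Function.invFunOn b A z ∈ A := Function.invFunOn_mem hz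
  have heq {z : Y} (hz : z ∈ b '' A) : b (Function.invFunOn b A z) = z := Function.invFunOn_eq hz
  have hL : LipschitzOnWith K g (b '' A) := by
    refine LipschitzOnWith.of_dist_le_mul fun z hz w hw => ?_
    refine (h _ (hmem hz) _ (hmem hw)).trans_eq ?_
    rw [heq hz, heq hw]
  have himg : a '' A ⊆ g '' (b '' A) := by
    rintro _ ⟨x, hx, rfl⟩
    have hbx : b x ∈ b '' A := ⟨x, hx, rfl⟩
    refine ⟨b x, hbx, ?_⟩
    have := h _ (hmem hbx) x hx
    rw [heq hbx, dist_self, mul_zero] at this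
    exact dist_le_zero.1 this
  refine (measure_mono himg).trans ?_
  rw [euclideanHausdorffMeasure_def, Measure.smul_apply, Measure.smul_apply, mul_smul_comm]
  refine smul_le_smul_of_nonneg_left ?_ (zero_le)
  simpa using hL.hausdorffMeasure_image_le (d := d) (by positivity)

/-- Up to a factor close to one, the area formula holds near every point. -/
lemma exists_nhds_area_le {f : V → E} {f' : V → V →L[ℝ] E}
    (hf : ∀ x, HasStrictFDerivAt f (f' x) x) (hge : ∀ x v, ‖v‖ ≤ ‖f' x v‖)
    (hJ : Continuous fun x => (f' x).toLinearMap.normDet) {K : ℝ≥0} (hK : 1 < K) (x₀ : V) :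
    ∃ W ∈ 𝓝 x₀, ∀ A ⊆ W, MeasurableSet A →
      μHE[finrank ℝ V] (f '' A) ≤
        (K : ENNReal) ^ (finrank ℝ V + 1) * ∫⁻ x in A, ENNReal.ofReal (f' x).toLinearMap.normDet ∧
      ∫⁻ x in A, ENNReal.ofReal (f' x).toLinearMap.normDet ≤
        (K : ENNReal) ^ (finrank ℝ V + 1) * μHE[finrank ℝ V] (f '' A) := by
  set d := finrank ℝ V
  have hK1 : (1 : ℝ) < K := by exact_mod_cast hK
  have hK0 : (0 : ℝ) < K := by linarith
  have hJpos : 0 < (f' x₀).toLinearMap.normDet := by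
    refine lt_of_le_of_ne (LinearMap.normDet_nonneg _) (Ne.symm ?_)
    rw [Ne, LinearMap.normDet_eq_zero_iff_ker_ne_bot, not_not, LinearMap.ker_eq_bot']
    intro v hv
    have h0 : ‖v‖ ≤ ‖f' x₀ v‖ := hge x₀ v
    rw [show f' x₀ v = 0 from hv, norm_zero] at h0
    exact norm_le_zero_iff.1 h0
  -- Since `‖v‖ ≤ ‖f' x₀ v‖`, a linearization error of `c ‖v‖` is a relative error of at most `c`.
  -- The two entries of the minimum give `1 + c ≤ K` and `1 - c ≥ K⁻¹`.
  set c : ℝ := min (K - 1) (1 - (K : ℝ)⁻¹) with hc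
  have hc0 : 0 < c := by
    refine lt_min (by linarith) ?_
    have := inv_lt_one_of_one_lt₀ hK1
    linarith
  obtain ⟨W₁, hW₁, hlin⟩ : ∃ W ∈ 𝓝 x₀, ∀ x ∈ W, ∀ y ∈ W,
      ‖f x - f y - f' x₀ (x - y)‖ ≤ c * ‖x - y‖ := by
    have h := (hf x₀).isLittleO.def hc0
    rw [nhds_prod_eq] at h
    obtain ⟨W, hW, hW'⟩ := eventually_prod_self_iff (r := fun x y : V =>
      ‖f x - f y - f' x₀ (x - y)‖ ≤ c * ‖x - y‖) |>.1 h
    exact ⟨W, hW, fun x hx y hy => hW' x hx y hy⟩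
  have hup {x y : V} (hx : x ∈ W₁) (hy : y ∈ W₁) : dist (f x) (f y) ≤ K * dist (f' x₀ x) (f' x₀ y) := by
    rw [dist_eq_norm, dist_eq_norm, ← map_sub]
    have h1 := hlin x hx y hy
    have h2 : ‖f x - f y‖ ≤ ‖f x - f y - f' x₀ (x - y)‖ + ‖f' x₀ (x - y)‖ := by
      simpa using norm_add_le (f x - f y - f' x₀ (x - y)) (f' x₀ (x - y))
    have h3 := hge x₀ (x - y)
    have h4 : c ≤ K - 1 := min_le_left _ _
    nlinarith [norm_nonneg (x - y), norm_nonneg (f' x₀ (x - y))]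
  have hlow {x y : V} (hx : x ∈ W₁) (hy : y ∈ W₁) : dist (f' x₀ x) (f' x₀ y) ≤ K * dist (f x) (f y) := by
    rw [dist_eq_norm, dist_eq_norm, ← map_sub]
    have h1 := hlin x hx y hy
    have h2 : ‖f' x₀ (x - y)‖ ≤ ‖f x - f y‖ + ‖f x - f y - f' x₀ (x - y)‖ := by
      simpa using norm_sub_le (f x - f y) (f x - f y - f' x₀ (x - y))
    have h3 := hge x₀ (x - y)
    have h4 : c ≤ 1 - (K : ℝ)⁻¹ := min_le_right _ _
    have h5 : (K : ℝ)⁻¹ * ‖f' x₀ (x - y)‖ ≤ ‖f x - f y‖ := by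
      nlinarith [norm_nonneg (x - y), norm_nonneg (f' x₀ (x - y))]
    rwa [inv_mul_le_iff₀ hK0] at h5
  set J := fun x => (f' x).toLinearMap.normDet with hJdef
  have hW₂ : {x | J x < K * J x₀ ∧ J x₀ < K * J x} ∈ 𝓝 x₀ := by
    have hlt : J x₀ < K * J x₀ := by
      have : 0 < J x₀ := hJpos
      nlinarith
    exact ((hJ.tendsto x₀).eventually_lt_const hlt).and
      ((tendsto_const_nhds.mul (hJ.tendsto x₀)).eventually_const_lt hlt)
  -- In the exponent `d + 1`, the power `K ^ d` accounts for the distortion of distances and one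
  -- more `K` for the variation of the Jacobian.
  refine ⟨W₁ ∩ {x | J x < K * J x₀ ∧ J x₀ < K * J x}, inter_mem hW₁ hW₂, fun A hA hAm => ?_⟩
  have hlinvol := (f' x₀).toLinearMap.euclideanHausdorffMeasure_image_eq_normDet_mul_volume A
  have hKofReal : (K : ENNReal) = ENNReal.ofReal K := by simp
  constructor
  · calc μHE[d] (f '' A) ≤ (K : ENNReal) ^ d * μHE[d] (f' x₀ '' A) :=
          euclideanHausdorffMeasure_image_le_of_dist_le
            (fun x hx y hy => hup (hA hx).1 (hA hy).1) d
      _ = (K : ENNReal) ^ d * ∫⁻ x in A, ENNReal.ofReal (J x₀) := by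
          rw [lintegral_const, Measure.restrict_apply_univ]
          exact congrArg _ hlinvol
      _ ≤ (K : ENNReal) ^ d * ∫⁻ x in A, K * ENNReal.ofReal (J x) := by
          gcongr 1
          refine setLIntegral_mono' hAm fun x hx => ?_
          rw [hKofReal, ← ENNReal.ofReal_mul hK0.le]
          exact ENNReal.ofReal_le_ofReal (hA hx).2.2.le
      _ = _ := by
          rw [lintegral_const_mul _ (by fun_prop), pow_succ, mul_assoc]
  · calc ∫⁻ x in A, ENNReal.ofReal (J x) ≤ ∫⁻ x in A, K * ENNReal.ofReal (J x₀) := by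
          refine setLIntegral_mono' hAm fun x hx => ?_
          rw [hKofReal, ← ENNReal.ofReal_mul hK0.le]
          exact ENNReal.ofReal_le_ofReal (hA hx).2.1.le
      _ = K * μHE[d] (f' x₀ '' A) := by
          rw [lintegral_const, Measure.restrict_apply_univ, mul_assoc]
          exact congrArg _ hlinvol.symm
      _ ≤ K * ((K : ENNReal) ^ d * μHE[d] (f '' A)) := by
          gcongr
          exact euclideanHausdorffMeasure_image_le_of_dist_le
            (fun x hx y hy => hlow (hA hx).1 (hA hy).1) d
      _ = _ := by rw [pow_succ', mul_assoc]

/-- Comparison of measures is a local property. -/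
lemma measure_le_of_forall_exists_nhds {X : Type*} [TopologicalSpace X]
    [SecondCountableTopology X] [MeasurableSpace X] [BorelSpace X] {μ ν : Measure X}
    (h : ∀ x, ∃ W ∈ 𝓝 x, ∀ A ⊆ W, MeasurableSet A → μ A ≤ ν A) : μ ≤ ν := by
  choose W hW hWA using h
  obtain ⟨s, hs, hcov⟩ := TopologicalSpace.countable_cover_nhds fun x => interior_mem_nhds.2 (hW x)
  rcases s.eq_empty_or_nonempty with rfl | hne
  · have : IsEmpty X := by
      rw [← Set.univ_eq_empty_iff, ← hcov]
      simp
    intro A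
    rw [Set.eq_empty_of_isEmpty A]
    simp
  obtain ⟨g, rfl⟩ := hs.exists_eq_range hne
  rw [Set.biUnion_range] at hcov
  have hD (i : ℕ) : MeasurableSet (disjointed (fun i => interior (W (g i))) i) :=
    MeasurableSet.disjointed (fun i => isOpen_interior.measurableSet) i
  rw [Measure.le_iff]
  intro A hA
  have hAeq : A = ⋃ i, A ∩ disjointed (fun i => interior (W (g i))) i := by
    rw [← Set.inter_iUnion, iUnion_disjointed, hcov, Set.inter_univ]
  have hdisj : Pairwise (Function.onFun Disjoint
      fun i => A ∩ disjointed (fun i => interior (W (g i))) i) :=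
    (disjoint_disjointed _).mono fun i j hij =>
      hij.mono Set.inter_subset_right Set.inter_subset_right
  rw [hAeq, measure_iUnion hdisj fun i => hA.inter (hD i),
    measure_iUnion hdisj fun i => hA.inter (hD i)]
  exact ENNReal.tsum_le_tsum fun i => hWA (g i) _
    (Set.inter_subset_right.trans ((disjointed_subset _ i).trans interior_subset)) (hA.inter (hD i))

/-- The area formula for embeddings whose derivative does not decrease distances. -/
theorem comap_euclideanHausdorffMeasure {f : V → E} {f' : V → V →L[ℝ] E}
    (hf : ∀ x, HasStrictFDerivAt f (f' x) x) (hge : ∀ x v, ‖v‖ ≤ ‖f' x v‖)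
    (hJ : Continuous fun x => (f' x).toLinearMap.normDet) (hemb : MeasurableEmbedding f) :
    (μHE[finrank ℝ V] : Measure E).comap f =
      volume.withDensity fun x => ENNReal.ofReal (f' x).toLinearMap.normDet := by
  set d := finrank ℝ V
  set μ := (μHE[d] : Measure E).comap f
  set ρ := (volume : Measure V).withDensity fun x => ENNReal.ofReal (f' x).toLinearMap.normDet
  -- The local comparisons add up to global ones with the same factor, and then `K` decreases to
  -- `1`.
  have hle {K : ℝ≥0} (hK : 1 < K) :
      μ ≤ ((K : ENNReal) ^ (d + 1)) • ρ ∧ ρ ≤ ((K : ENNReal) ^ (d + 1)) • μ := by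
    constructor
    · refine measure_le_of_forall_exists_nhds fun x => ?_
      obtain ⟨W, hW, h⟩ := exists_nhds_area_le hf hge hJ hK x
      refine ⟨W, hW, fun A hA hAm => ?_⟩
      rw [hemb.comap_apply, Measure.smul_apply, withDensity_apply _ hAm, smul_eq_mul]
      exact (h A hA hAm).1
    · refine measure_le_of_forall_exists_nhds fun x => ?_
      obtain ⟨W, hW, h⟩ := exists_nhds_area_le hf hge hJ hK x
      refine ⟨W, hW, fun A hA hAm => ?_⟩
      rw [Measure.smul_apply, hemb.comap_apply, withDensity_apply _ hAm, smul_eq_mul]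
      exact (h A hA hAm).2
  have hlim (z : ENNReal) : Tendsto (fun K : ℝ≥0 => (K : ENNReal) ^ (d + 1) * z) (𝓝[>] 1)
      (𝓝 z) := by
    have h1 : Tendsto (fun K : ℝ≥0 => (K : ENNReal) ^ (d + 1)) (𝓝[>] 1) (𝓝 1) := by
      have : Continuous fun K : ℝ≥0 => (K : ENNReal) ^ (d + 1) := by fun_prop
      simpa using (this.tendsto 1).mono_left nhdsWithin_le_nhds
    simpa using ENNReal.Tendsto.mul_const h1 (Or.inl one_ne_zero)
  ext A hA
  refine le_antisymm ?_ ?_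
  · refine ge_of_tendsto (hlim (ρ A)) ?_
    filter_upwards [self_mem_nhdsWithin] with K hK
    exact (hle hK).1 A
  · refine ge_of_tendsto (hlim (μ A)) ?_
    filter_upwards [self_mem_nhdsWithin] with K hK
    exact (hle hK).2 A

end AreaFormula

end

/-! ### Graphs over hyperplanes and their surface measure. -/

section

section Graph

open Measure Module

variable {n : ℕ}

/-- The hyperplane orthogonal to `e`. -/
abbrev hyperplane (e : Space n) : Submodule ℝ (Space n) := (Submodule.span ℝ {e})ᗮ

/-- The parametrization of the graph of `γ` over the hyperplane orthogonal to `e`. -/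
def graphMap (e : Space n) (γ : hyperplane e → ℝ) (y : hyperplane e) : Space n :=
  (y : Space n) + γ y • e

/-- The derivative of `graphMap`. -/
def graphMapDeriv (e : Space n) (γ : hyperplane e → ℝ) (y : hyperplane e) :
    hyperplane e →L[ℝ] Space n :=
  (hyperplane e).subtypeL + (fderiv ℝ γ y).smulRight e

/-- The upward normal of the graph of `γ`, of vertical component one. -/
def graphNormal (e : Space n) (γ : hyperplane e → ℝ) (y : hyperplane e) : Space n :=
  e - ((gradient γ y : hyperplane e) : Space n)

lemma inner_hyperplane (e : Space n) (y : hyperplane e) : ⟪e, (y : Space n)⟫_ℝ = 0 :=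
  (Submodule.mem_orthogonal_singleton_iff_inner_right.1 y.2)

lemma proj_add_smul (e : Space n) (y : hyperplane e) (s : ℝ) :
    (hyperplane e).orthogonalProjectionOnto ((y : Space n) + s • e) = y := by
  rw [map_add, map_smul, Submodule.orthogonalProjectionOnto_mem_subspace_eq_self,
    Submodule.orthogonalProjectionOnto_orthogonalComplement_singleton_eq_zero, smul_zero, add_zero]

lemma inner_add_smul {e : Space n} (he : ‖e‖ = 1) (y : hyperplane e) (s : ℝ) :
    ⟪e, (y : Space n) + s • e⟫_ℝ = s := by
  rw [inner_add_right, inner_hyperplane, inner_smul_right, real_inner_self_eq_norm_sq, he]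
  norm_num

lemma proj_add_inner_smul {e : Space n} (he : ‖e‖ = 1) (x : Space n) :
    ((hyperplane e).orthogonalProjectionOnto x : Space n) + ⟪e, x⟫_ℝ • e = x := by
  have h := Submodule.starProjection_add_starProjection_orthogonal
    (K := Submodule.span ℝ {e}) x
  rw [Submodule.starProjection_unit_singleton ℝ he] at h
  rw [add_comm]
  exact h

lemma norm_add_smul_sq {e : Space n} (he : ‖e‖ = 1) (y : hyperplane e) (s : ℝ) :
    ‖(y : Space n) + s • e‖ ^ 2 = ‖y‖ ^ 2 + s ^ 2 := by
  rw [@norm_add_sq_real, inner_smul_right, real_inner_comm, inner_hyperplane, norm_smul, he]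
  simp

lemma finrank_hyperplane {e : Space n} (he : ‖e‖ = 1) : finrank ℝ (hyperplane e) = n - 1 := by
  have he0 : e ≠ 0 := by
    intro h
    simp [h] at he
  have h := Submodule.finrank_add_finrank_orthogonal (Submodule.span ℝ {e})
  rw [finrank_span_singleton he0, finrank_euclideanSpace_fin] at h
  have : finrank ℝ (hyperplane e) = finrank ℝ (Submodule.span ℝ {e})ᗮ := rfl
  omega

lemma measurePreserving_add_smul {e : Space n} (he : ‖e‖ = 1) :
    MeasurePreserving (fun p : hyperplane e × ℝ => (p.1 : Space n) + p.2 • e) := by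
  have h1 := (Submodule.measurePreserving_measurableEquivProd
    (Submodule.span ℝ {e}) (0 : Space n)).symm
  rw [InnerProductSpace.euclideanHausdorffMeasure_eq_volume] at h1
  have h2 := (LinearIsometryEquiv.toSpanUnitSingleton (𝕜 := ℝ) e he).measurePreserving.prod
    (MeasurePreserving.id (volume : Measure (hyperplane e)))
  have h3 := (h1.comp h2).comp (Measure.measurePreserving_swap
    (μ := (volume : Measure (hyperplane e))) (ν := (volume : Measure ℝ)))
  convert! h3 using 1
  ext1 p
  simp [add_comm]

variable {e : Space n} {γ : hyperplane e → ℝ}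

lemma continuous_graphMap (hγ : Continuous γ) : Continuous (graphMap e γ) := by
  unfold graphMap
  fun_prop

lemma proj_graphMap (y : hyperplane e) :
    (hyperplane e).orthogonalProjectionOnto (graphMap e γ y) = y := proj_add_smul e y _

lemma measurableEmbedding_graphMap (hγ : Continuous γ) : MeasurableEmbedding (graphMap e γ) :=
  (continuous_graphMap hγ).measurableEmbedding fun y z h => by
    rw [← proj_graphMap (γ := γ) y, h, proj_graphMap]

/-- On each line parallel to `e` the graph contributes only the translation `s ↦ γ y + s`. The map
is thus a shear followed by an isometry, and no Jacobian appears. -/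
lemma measurePreserving_graphMap_add_smul (he : ‖e‖ = 1) (hγ : Continuous γ) :
    MeasurePreserving (fun p : hyperplane e × ℝ => graphMap e γ p.1 + p.2 • e) := by
  have h1 : MeasurePreserving (fun p : hyperplane e × ℝ => (p.1, γ p.1 + p.2))
      (volume.prod volume) (volume.prod volume) :=
    (MeasurePreserving.id volume).skew_product (g := fun y s => γ y + s) (by fun_prop)
      (.of_forall fun y => (measurePreserving_add_left volume (γ y)).map_eq)
  convert! (measurePreserving_add_smul he).comp h1 using 1
  ext1 p
  simp [graphMap, add_smul, add_assoc]

lemma measurableEmbedding_graphMap_add_smul (he : ‖e‖ = 1) (hγ : Continuous γ) :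
    MeasurableEmbedding (fun p : hyperplane e × ℝ => graphMap e γ p.1 + p.2 • e) := by
  have hc : Continuous (fun p : hyperplane e × ℝ => graphMap e γ p.1 + p.2 • e) := by
    have := continuous_graphMap hγ
    fun_prop
  refine hc.measurableEmbedding fun p q h => ?_
  have e1 (p : hyperplane e × ℝ) : graphMap e γ p.1 + p.2 • e =
      (p.1 : Space n) + (γ p.1 + p.2) • e := by
    rw [graphMap, add_smul, add_assoc]
  simp only [e1] at h
  have h1 : p.1 = q.1 := by
    rw [← proj_add_smul e p.1 (γ p.1 + p.2), h, proj_add_smul]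
  have h2 := congrArg (fun x => ⟪e, x⟫_ℝ) h
  simp only [inner_add_smul he] at h2
  rw [h1] at h2
  exact Prod.ext h1 (add_left_cancel h2)

lemma hasStrictFDerivAt_graphMap (hγ : ContDiff ℝ 1 γ) (y : hyperplane e) :
    HasStrictFDerivAt (graphMap e γ) (graphMapDeriv e γ y) y := by
  have h := hγ.contDiffAt (x := y) |>.hasStrictFDerivAt one_ne_zero
  exact (hyperplane e).subtypeL.hasStrictFDerivAt.add (h.smul_const e)

lemma norm_graphMapDeriv_sq (he : ‖e‖ = 1) (y v : hyperplane e) :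
    ‖graphMapDeriv e γ y v‖ ^ 2 = ‖v‖ ^ 2 + (fderiv ℝ γ y v) ^ 2 :=
  norm_add_smul_sq he v _

lemma inner_gradient_eq_fderiv (y v : hyperplane e) : ⟪gradient γ y, v⟫_ℝ = fderiv ℝ γ y v := by
  rw [gradient, InnerProductSpace.toDual_symm_apply]

lemma norm_graphNormal_sq (he : ‖e‖ = 1) (y : hyperplane e) :
    ‖graphNormal e γ y‖ ^ 2 = 1 + ‖gradient γ y‖ ^ 2 := by
  rw [graphNormal, @norm_sub_sq_real, inner_hyperplane, he]
  simp

lemma graphNormal_ne_zero (he : ‖e‖ = 1) (y : hyperplane e) : graphNormal e γ y ≠ 0 := by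
  intro h
  have := norm_graphNormal_sq (γ := γ) he y
  rw [h] at this
  simp at this
  nlinarith [sq_nonneg ‖gradient γ y‖]

/-- The Gram operator of the derivative is `v ↦ v + ⟪∇γ, v⟫ ∇γ`, a transvection of determinant `1 +
‖∇γ‖²`, which is also the squared length of the upward normal. -/
lemma normDet_graphMapDeriv (he : ‖e‖ = 1) (y : hyperplane e) :
    (graphMapDeriv e γ y).toLinearMap.normDet = ‖graphNormal e γ y‖ := by
  rw [← sq_eq_sq₀ (LinearMap.normDet_nonneg _) (norm_nonneg _), norm_graphNormal_sq he]
  have h := (graphMapDeriv e γ y).toLinearMap.normDet_sq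
  have h2 : (graphMapDeriv e γ y).toLinearMap.adjoint ∘ₗ (graphMapDeriv e γ y).toLinearMap =
      LinearMap.transvection (fderiv ℝ γ y).toLinearMap (gradient γ y) := by
    ext1 v
    refine ext_inner_right ℝ fun w => ?_
    rw [LinearMap.comp_apply, LinearMap.adjoint_inner_left, LinearMap.transvection.apply,
      inner_add_left, inner_smul_left, inner_gradient_eq_fderiv]
    change ⟪(v : Space n) + fderiv ℝ γ y v • e, (w : Space n) + fderiv ℝ γ y w • e⟫_ℝ = _
    rw [inner_add_left, inner_add_right, inner_smul_left, inner_smul_right, inner_add_right,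
      inner_hyperplane, inner_smul_right, real_inner_self_eq_norm_sq, he,
      real_inner_comm e (v : Space n), inner_hyperplane]
    simp
  rw [h2, LinearMap.transvection.det] at h
  have h3 : (fderiv ℝ γ y).toLinearMap (gradient γ y) = ‖gradient γ y‖ ^ 2 := by
    rw [← real_inner_self_eq_norm_sq, inner_gradient_eq_fderiv]
    rfl
  rw [h3] at h
  exact h

lemma continuous_gradient (hγ : ContDiff ℝ 1 γ) : Continuous (gradient γ) :=
  (InnerProductSpace.toDual ℝ (hyperplane e)).symm.continuous.comp
    (hγ.continuous_fderiv one_ne_zero)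

lemma continuous_graphNormal (hγ : ContDiff ℝ 1 γ) : Continuous (graphNormal e γ) := by
  have := continuous_gradient hγ
  unfold graphNormal
  fun_prop

/-- The surface measure on a graph. -/
theorem map_graphMap_withDensity (he : ‖e‖ = 1) (hγ : ContDiff ℝ 1 γ) :
    ((volume : Measure (hyperplane e)).withDensity
      fun y => ENNReal.ofReal ‖graphNormal e γ y‖).map (graphMap e γ) =
      (μHE[n - 1] : Measure (Space n)).restrict (Set.range (graphMap e γ)) := by
  have hemb := measurableEmbedding_graphMap (e := e) hγ.continuous
  rw [← hemb.map_comap, ← finrank_hyperplane he,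
    comap_euclideanHausdorffMeasure (hasStrictFDerivAt_graphMap hγ) ?_ ?_ hemb]
  · simp_rw [normDet_graphMapDeriv he]
  · intro y v
    rw [← sq_le_sq₀ (norm_nonneg _) (norm_nonneg _), norm_graphMapDeriv_sq he]
    nlinarith [sq_nonneg (fderiv ℝ γ y v)]
  · simp_rw [normDet_graphMapDeriv he]
    exact (continuous_graphNormal hγ).norm

lemma setIntegral_range_graphMap (he : ‖e‖ = 1) (hγ : ContDiff ℝ 1 γ) (g : Space n → ℝ) :
    ∫ x in Set.range (graphMap e γ), g x ∂μHE[n - 1] =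
      ∫ y, ‖graphNormal e γ y‖ * g (graphMap e γ y) := by
  have hemb := measurableEmbedding_graphMap (e := e) hγ.continuous
  rw [← map_graphMap_withDensity he hγ, hemb.integral_map,
    integral_withDensity_eq_integral_toReal_smul]
  · simp
  · have := (continuous_graphNormal hγ).norm.measurable
    fun_prop
  · simp

end Graph

end

/-! ### Boundary charts, the outer normal and a one-dimensional cutoff. -/

section

section Chart

open Measure Module

variable {n : ℕ} {e : Space n} {γ : hyperplane e → ℝ}

/-- The height of a point over the graph of `γ`. -/
def graphHeight (e : Space n) (γ : hyperplane e → ℝ) (x : Space n) : ℝ :=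
  ⟪e, x⟫_ℝ - γ ((hyperplane e).orthogonalProjectionOnto x)

lemma graphHeight_graphMap_add_smul (he : ‖e‖ = 1) (y : hyperplane e) (s : ℝ) :
    graphHeight e γ (graphMap e γ y + s • e) = s := by
  rw [graphHeight, graphMap, add_assoc, ← add_smul, inner_add_smul he, proj_add_smul]
  ring

lemma graphMap_proj_add_smul (he : ‖e‖ = 1) (x : Space n) :
    graphMap e γ ((hyperplane e).orthogonalProjectionOnto x) + graphHeight e γ x • e = x := by
  rw [graphMap, graphHeight, add_assoc, ← add_smul, add_sub_cancel, proj_add_inner_smul he]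

lemma continuous_graphHeight (hγ : Continuous γ) : Continuous (graphHeight e γ) := by
  unfold graphHeight
  fun_prop

lemma contDiff_graphHeight (hγ : ContDiff ℝ 1 γ) : ContDiff ℝ 1 (graphHeight e γ) := by
  refine ContDiff.sub (innerSL ℝ e).contDiff (hγ.comp ?_)
  exact (hyperplane e).orthogonalProjectionOnto.contDiff

lemma hasGradientAt_graphHeight (hγ : ContDiff ℝ 1 γ) (x : Space n) :
    HasGradientAt (graphHeight e γ)
      (graphNormal e γ ((hyperplane e).orthogonalProjectionOnto x)) x := by
  rw [hasGradientAt_iff_hasFDerivAt]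
  have h1 : HasFDerivAt (fun x => ⟪e, x⟫_ℝ) (innerSL ℝ e) x := (innerSL ℝ e).hasFDerivAt
  have h2 := (hγ.differentiable one_ne_zero
    ((hyperplane e).orthogonalProjectionOnto x)).hasFDerivAt.comp x
    ((hyperplane e).orthogonalProjectionOnto).hasFDerivAt
  refine (h1.sub h2).congr_fderiv ?_
  ext v
  rw [InnerProductSpace.toDual_apply_apply, graphNormal, inner_sub_left,
    ← Submodule.inner_orthogonalProjectionOnto_eq_of_mem_left, inner_gradient_eq_fderiv]
  rfl

/-- Points of positive or negative height have a whole neighbourhood outside or inside `B`. A point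
of height zero belongs to `B` and is the limit of the points `x + s • e` of height `s > 0`. -/
lemma mem_frontier_iff_graphHeight_eq_zero (he : ‖e‖ = 1) (hγ : Continuous γ) {B : Set (Space n)}
    {p : Space n} {r : ℝ} (hchart : ∀ x ∈ ball p r, (x ∈ B ↔ graphHeight e γ x ≤ 0))
    {x : Space n} (hx : x ∈ ball p r) : x ∈ frontier B ↔ graphHeight e γ x = 0 := by
  have hh := continuous_graphHeight (e := e) hγ
  rw [frontier_eq_closure_inter_closure]
  constructor
  · rintro ⟨h1, h2⟩
    refine le_antisymm ?_ ?_
    · by_contra! hlt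
      have : {y | y ∈ ball p r ∧ 0 < graphHeight e γ y} ∈ 𝓝 x :=
        inter_mem (isOpen_ball.mem_nhds hx) ((isOpen_lt continuous_const hh).mem_nhds hlt)
      obtain ⟨y, hy, hyB⟩ := mem_closure_iff_nhds.1 h1 _ this
      exact absurd ((hchart y hy.1).1 hyB) (not_le.2 hy.2)
    · by_contra! hlt
      have : {y | y ∈ ball p r ∧ graphHeight e γ y < 0} ∈ 𝓝 x :=
        inter_mem (isOpen_ball.mem_nhds hx) ((isOpen_lt hh continuous_const).mem_nhds hlt)
      obtain ⟨y, hy, hyB⟩ := mem_closure_iff_nhds.1 h2 _ this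
      exact hyB ((hchart y hy.1).2 hy.2.le)
  · intro h0
    refine ⟨subset_closure ((hchart x hx).2 h0.le), ?_⟩
    have hlim : Tendsto (fun s : ℝ => x + s • e) (𝓝[>] 0) (𝓝 x) := by
      have : Continuous fun s : ℝ => x + s • e := by fun_prop
      simpa using (this.tendsto 0).mono_left nhdsWithin_le_nhds
    refine mem_closure_of_tendsto hlim ?_
    filter_upwards [hlim.eventually (isOpen_ball.mem_nhds hx), self_mem_nhdsWithin] with s hs hs0
    rw [Set.mem_compl_iff, hchart _ hs, not_le]
    have : graphHeight e γ (x + s • e) = s := by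
      conv_lhs => rw [← graphMap_proj_add_smul (γ := γ) he x, h0, zero_smul, add_zero]
      exact graphHeight_graphMap_add_smul he _ s
    rw [this]
    exact hs0

/-- In a chart, the outer unit normal is the normalized upward normal of the graph. -/
lemma IsOuterUnitNormal.eq_graphNormal (he : ‖e‖ = 1) (hγ : ContDiff ℝ 1 γ) {B : Set (Space n)}
    {p : Space n} {r : ℝ} (hchart : ∀ x ∈ ball p r, (x ∈ B ↔ graphHeight e γ x ≤ 0))
    {x ν : Space n} (hx : x ∈ ball p r) (hfr : x ∈ frontier B) (hν : IsOuterUnitNormal B x ν) :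
    ν = ‖graphNormal e γ ((hyperplane e).orthogonalProjectionOnto x)‖⁻¹ •
      graphNormal e γ ((hyperplane e).orthogonalProjectionOnto x) := by
  set N := graphNormal e γ ((hyperplane e).orthogonalProjectionOnto x)
  have hN : N ≠ 0 := graphNormal_ne_zero he _
  have hN' : 0 < ‖N‖ := norm_pos_iff.2 hN
  have h0 := (mem_frontier_iff_graphHeight_eq_zero he hγ.continuous hchart hx).1 hfr
  -- Along such a `v` the height grows to first order, so the ray leaves `B`; if `v` formed an
  -- obtuse angle with `ν`, the ray would have to enter `B`.
  have key : ∀ v : Space n, 0 < ⟪N, v⟫_ℝ → 0 ≤ ⟪v, ν⟫_ℝ := by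
    intro v hv
    by_contra! hneg
    have hline : HasDerivAt (fun t : ℝ => x + t • v) v 0 := by
      simpa using ((hasDerivAt_id (0 : ℝ)).smul_const v).const_add x
    have hd : HasDerivAt (fun t : ℝ => graphHeight e γ (x + t • v)) ⟪N, v⟫_ℝ 0 := by
      have h := (hasGradientAt_graphHeight (e := e) hγ x).hasFDerivAt
      rw [show x = x + (0 : ℝ) • v by simp] at h
      simpa [N, Function.comp_def] using h.comp_hasDerivAt (0 : ℝ) hline
    have hslope := hd.tendsto_slope_zero_right
    have hlim : Tendsto (fun s : ℝ => x + s • v) (𝓝[>] 0) (𝓝 x) := by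
      have : Continuous fun s : ℝ => x + s • v := by fun_prop
      simpa using (this.tendsto 0).mono_left nhdsWithin_le_nhds
    obtain ⟨t, ht1, ht2, ht3, ht4⟩ := ((hslope.eventually_const_lt hv).and
      ((hν.inward v hneg).and ((hlim.eventually (isOpen_ball.mem_nhds hx)).and
        self_mem_nhdsWithin))).exists
    have ht0 : 0 < t := ht4
    simp only [zero_add, zero_smul, add_zero, h0, sub_zero, smul_eq_mul] at ht1
    have : 0 < graphHeight e γ (x + t • v) := by
      by_contra! hle
      nlinarith [inv_pos.2 ht0]
    exact absurd ((hchart _ ht3).1 ht2) (not_le.2 this)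
  set u := ‖N‖⁻¹ • N with hu
  have hu1 : ‖u‖ = 1 := norm_smul_inv_norm hN
  have hNu (v : Space n) : ⟪N, v⟫_ℝ = ‖N‖ * ⟪u, v⟫_ℝ := by
    rw [hu, inner_smul_left]
    simp
    field_simp
  clear_value u
  have hle : ⟪u, ν⟫_ℝ ≤ 1 := by
    have := real_inner_le_norm u ν
    rwa [hu1, hν.norm_eq, one_mul] at this
  have hge : 1 ≤ ⟪u, ν⟫_ℝ := by
    by_contra! hlt
    set a := ⟪u, ν⟫_ℝ with ha
    -- If `a = ⟪u, ν⟫ < 1`, this vector has product `3 (1 - a) / 2 > 0` with `u` and product `-(1 -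
    -- a) (1 - a / 2) < 0` with `ν`, which contradicts `key`.
    have h1 := key (u - ν + ((1 - a) / 2) • u) (by
      rw [hNu, inner_add_right, inner_sub_right, inner_smul_right, real_inner_self_eq_norm_sq, hu1]
      refine mul_pos hN' ?_
      linarith)
    rw [inner_add_left, inner_sub_left, inner_smul_left, real_inner_self_eq_norm_sq,
      hν.norm_eq, ← ha] at h1
    simp at h1
    nlinarith
  exact ((inner_eq_one_iff_of_norm_eq_one hu1 hν.norm_eq).1 (le_antisymm hle hge)).symm

/-- A smooth function that vanishes on `(-∞, 1]` and is equal to `1` on `[2, ∞)`. -/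
def ramp (s : ℝ) : ℝ := Real.smoothTransition (s - 1)

lemma contDiff_ramp : ContDiff ℝ 1 ramp :=
  (Real.smoothTransition.contDiff (n := 1)).comp (contDiff_id.sub contDiff_const)

lemma ramp_of_le {s : ℝ} (h : s ≤ 1) : ramp s = 0 :=
  Real.smoothTransition.zero_of_nonpos (by linarith)

lemma ramp_of_ge {s : ℝ} (h : 2 ≤ s) : ramp s = 1 :=
  Real.smoothTransition.one_of_one_le (by linarith)

lemma ramp_nonneg (s : ℝ) : 0 ≤ ramp s := Real.smoothTransition.nonneg _

lemma ramp_le_one (s : ℝ) : ramp s ≤ 1 := Real.smoothTransition.le_one _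

lemma deriv_ramp_of_le {s : ℝ} (h : s ≤ 1) : deriv ramp s = 0 :=
  IsLocalMin.deriv_eq_zero (.of_forall fun t => by rw [ramp_of_le h]; exact ramp_nonneg t)

lemma deriv_ramp_of_ge {s : ℝ} (h : 2 ≤ s) : deriv ramp s = 0 :=
  IsLocalMax.deriv_eq_zero (.of_forall fun t => by rw [ramp_of_ge h]; exact ramp_le_one t)

lemma hasDerivAt_ramp (s : ℝ) : HasDerivAt ramp (deriv ramp s) s :=
  (contDiff_ramp.differentiable one_ne_zero s).hasDerivAt

lemma continuous_deriv_ramp : Continuous (deriv ramp) :=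
  contDiff_ramp.continuous_deriv le_rfl

lemma integrable_deriv_ramp : Integrable (deriv ramp) := by
  refine continuous_deriv_ramp.integrable_of_hasCompactSupport
    (HasCompactSupport.intro (isCompact_Icc (a := (1 : ℝ)) (b := 2)) fun s hs => ?_)
  rw [Set.mem_Icc, not_and_or, not_le, not_le] at hs
  exact hs.elim (fun h => deriv_ramp_of_le h.le) fun h => deriv_ramp_of_ge h.le

lemma integral_deriv_ramp : ∫ s, deriv ramp s = 1 := by
  have h := integral_of_hasDerivAt_of_tendsto (m := 0) (n := 1) hasDerivAt_ramp
    integrable_deriv_ramp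
    (tendsto_const_nhds.congr' ((eventually_le_atBot 1).mono fun s hs => (ramp_of_le hs).symm))
    (tendsto_const_nhds.congr' ((eventually_ge_atTop 2).mono fun s hs => (ramp_of_ge hs).symm))
  simpa using h

end Chart

end

/-! ### The Gauss–Green formula in a chart. -/

section

section LocalGaussGreen

open Measure Module

variable {n : ℕ} {e : Space n} {γ : hyperplane e → ℝ}

lemma exists_norm_le_of_hasCompactSupport {X Y : Type*} [TopologicalSpace X]
    [NormedAddCommGroup Y] {F : X → Y} {s : Set X} (hs : IsClosed s) (hF : ContinuousOn F s)
    (hc : HasCompactSupport F) : ∃ M, 0 ≤ M ∧ ∀ x ∈ s, ‖F x‖ ≤ M := by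
  obtain ⟨M, hM⟩ := (hc.isCompact.inter_left hs).exists_bound_of_continuousOn
    (hF.mono Set.inter_subset_left)
  refine ⟨max M 0, le_max_right _ _, fun x hx => ?_⟩
  by_cases hxs : x ∈ tsupport F
  · exact (hM x ⟨hx, hxs⟩).trans (le_max_left _ _)
  · rw [image_eq_zero_of_notMem_tsupport hxs, norm_zero]
    exact le_max_right _ _

variable {B : Set (Space n)} {p : Space n} {r : ℝ} {F : Space n → Space n}

/-- Cutting off a vector field near the boundary. -/
lemma contDiff_ramp_smul (hγ : ContDiff ℝ 1 γ) (hB : IsClosed B)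
    (hchart : ∀ x ∈ ball p r, (x ∈ B ↔ graphHeight e γ x ≤ 0))
    (hF1 : ContDiffOn ℝ 1 F Bᶜ) (hball : tsupport F ⊆ ball p r) {ε : ℝ} (hε : 0 < ε) :
    ContDiff ℝ 1 (fun x => ramp (graphHeight e γ x / ε) • F x) := by
  rw [contDiff_iff_contDiffAt]
  intro x
  by_cases hx : x ∈ tsupport F
  · by_cases h0 : graphHeight e γ x ≤ 0
    -- Since `ramp` vanishes on `(-∞, 1]`, the product is zero on the open set of points of height
    -- below `ε`, so the behaviour of `F` at the boundary does not matter.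
    · have : ∀ᶠ y in 𝓝 x, graphHeight e γ y < ε :=
        ((continuous_graphHeight hγ.continuous).tendsto x).eventually_lt_const (h0.trans_lt hε)
      refine (contDiffAt_const (c := (0 : Space n))).congr_of_eventuallyEq ?_
      filter_upwards [this] with y hy
      rw [ramp_of_le ((div_le_one hε).2 hy.le), zero_smul]
    · have hxB : x ∈ Bᶜ := fun h => h0 ((hchart x (hball hx)).1 h)
      exact ((contDiff_ramp.comp ((contDiff_graphHeight hγ).div_const ε)).contDiffAt).smul
        (hF1.contDiffAt (hB.isOpen_compl.mem_nhds hxB))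
  · refine (contDiffAt_const (c := (0 : Space n))).congr_of_eventuallyEq ?_
    filter_upwards [notMem_tsupport_iff_eventuallyEq.1 hx] with y hy
    rw [hy, Pi.zero_apply, smul_zero]

/-- This is the product rule. Since `deriv ramp` lives on `[1, 2]`, the second term is concentrated
in the layer of heights between `ε` and `2 ε`; in the limit it becomes the flux. The indicator
discards `divergence F` on `B`, where nothing is known about it. -/
lemma divergence_ramp_smul (hγ : ContDiff ℝ 1 γ) (hB : IsClosed B)
    (hchart : ∀ x ∈ ball p r, (x ∈ B ↔ graphHeight e γ x ≤ 0))
    (hF1 : ContDiffOn ℝ 1 F Bᶜ) (hball : tsupport F ⊆ ball p r) {ε : ℝ} (hε : 0 < ε)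
    (x : Space n) :
    divergence (fun x => ramp (graphHeight e γ x / ε) • F x) x =
      Bᶜ.indicator (fun x => ramp (graphHeight e γ x / ε) * divergence F x) x +
      ε⁻¹ * deriv ramp (graphHeight e γ x / ε) *
        ⟪graphNormal e γ ((hyperplane e).orthogonalProjectionOnto x), F x⟫_ℝ := by
  by_cases hx : x ∈ tsupport F
  · by_cases h0 : graphHeight e γ x ≤ 0
    · have hle : graphHeight e γ x / ε ≤ 1 :=
        (div_nonpos_of_nonpos_of_nonneg h0 hε.le).trans zero_le_one
      have : ∀ᶠ y in 𝓝 x, graphHeight e γ y < ε :=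
        ((continuous_graphHeight hγ.continuous).tendsto x).eventually_lt_const (h0.trans_lt hε)
      have h1 : (fun x => ramp (graphHeight e γ x / ε) • F x) =ᶠ[𝓝 x] fun _ => 0 := by
        filter_upwards [this] with y hy
        rw [ramp_of_le ((div_le_one hε).2 hy.le), zero_smul]
      have hxB : x ∉ Bᶜ := Set.notMem_compl_iff.2 ((hchart x (hball hx)).2 h0)
      rw [divergence_congr h1, divergence_const, Set.indicator_of_notMem hxB, deriv_ramp_of_le hle]
      simp
    · have hxB : x ∈ Bᶜ := fun h => h0 ((hchart x (hball hx)).1 h)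
      have hd : HasGradientAt (fun x => ramp (graphHeight e γ x / ε))
          ((ε⁻¹ * deriv ramp (graphHeight e γ x / ε)) •
            graphNormal e γ ((hyperplane e).orthogonalProjectionOnto x)) x := by
        rw [hasGradientAt_iff_hasFDerivAt]
        have h1 := ((hasDerivAt_ramp (graphHeight e γ x / ε)).comp (graphHeight e γ x)
          ((hasDerivAt_id _).div_const ε)).comp_hasFDerivAt x
          (hasGradientAt_graphHeight (e := e) hγ x).hasFDerivAt
        refine h1.congr_fderiv ?_
        rw [map_smul]
        congr 1
        rw [one_div, mul_comm]
      rw [divergence_smul hd ((hF1.contDiffAt (hB.isOpen_compl.mem_nhds hxB)).differentiableAt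
        one_ne_zero), Set.indicator_of_mem hxB, inner_smul_left]
      rfl
  · have h1 : (fun x => ramp (graphHeight e γ x / ε) • F x) =ᶠ[𝓝 x] fun _ => 0 := by
      filter_upwards [notMem_tsupport_iff_eventuallyEq.1 hx] with y hy
      rw [hy, Pi.zero_apply, smul_zero]
    rw [divergence_congr h1, divergence_const, image_eq_zero_of_notMem_tsupport hx]
    simp [Set.indicator, divergence_eq_zero_of_notMem_tsupport hx]

/-- The Gauss–Green formula for a vector field supported in a chart, with the flux through the
boundary replaced by an average over a neighbourhood of the boundary. -/
lemma setIntegral_ramp_mul_divergence (he : ‖e‖ = 1) (hγ : ContDiff ℝ 1 γ) (hB : IsClosed B)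
    (hchart : ∀ x ∈ ball p r, (x ∈ B ↔ graphHeight e γ x ≤ 0))
    (hF1 : ContDiffOn ℝ 1 F Bᶜ) (hsupp : HasCompactSupport F) (hball : tsupport F ⊆ ball p r)
    (hint : IntegrableOn (divergence F) Bᶜ) {ε : ℝ} (hε : 0 < ε) :
    Integrable (fun y => ∫ s : ℝ, deriv ramp s *
        ⟪graphNormal e γ y, F (graphMap e γ y + (ε * s) • e)⟫_ℝ) ∧
    ∫ x in Bᶜ, ramp (graphHeight e γ x / ε) * divergence F x =
      -∫ y, ∫ s : ℝ, deriv ramp s *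
        ⟪graphNormal e γ y, F (graphMap e γ y + (ε * s) • e)⟫_ℝ := by
  have hcd := contDiff_ramp_smul hγ hB hchart hF1 hball hε
  have hcs : HasCompactSupport (fun x => ramp (graphHeight e γ x / ε) • F x) :=
    HasCompactSupport.intro hsupp fun x hx => by
      rw [image_eq_zero_of_notMem_tsupport hx, smul_zero]
  have h0 := integral_divergence_eq_zero hcd hcs
  have hdivint : Integrable (divergence fun x => ramp (graphHeight e γ x / ε) • F x) :=
    (divergence_continuous hcd).integrable_of_hasCompactSupport (hasCompactSupport_divergence hcs)
  have hint1 : Integrable (Bᶜ.indicator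
      (fun x => ramp (graphHeight e γ x / ε) * divergence F x)) := by
    rw [integrable_indicator_iff hB.isOpen_compl.measurableSet]
    refine Integrable.bdd_mul (c := 1) hint ?_ (.of_forall fun x => ?_)
    · exact (contDiff_ramp.continuous.comp
        ((continuous_graphHeight hγ.continuous).div_const ε)).aestronglyMeasurable
    · rw [Real.norm_of_nonneg (ramp_nonneg _)]
      exact ramp_le_one _
  set g : Space n → ℝ := fun x => ε⁻¹ * deriv ramp (graphHeight e γ x / ε) *
        ⟪graphNormal e γ ((hyperplane e).orthogonalProjectionOnto x), F x⟫_ℝ with hg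
  have hdec : g = fun x => divergence (fun x => ramp (graphHeight e γ x / ε) • F x) x -
      Bᶜ.indicator (fun x => ramp (graphHeight e γ x / ε) * divergence F x) x := by
    ext1 x
    rw [divergence_ramp_smul hγ hB hchart hF1 hball hε]
    simp [hg]
  have hgint : Integrable g := by
    rw [hdec]
    exact hdivint.sub hint1
  have hgI : ∫ x, g x = -∫ x in Bᶜ, ramp (graphHeight e γ x / ε) * divergence F x := by
    rw [hdec, integral_sub hdivint hint1, h0, integral_indicator hB.isOpen_compl.measurableSet]
    ring
  -- In the coordinates `graphMap e γ y + s • e` volume is `dy ds`, and replacing `s` by `ε s`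
  -- absorbs the factor `ε⁻¹`.
  have hmp := measurePreserving_graphMap_add_smul (e := e) he hγ.continuous
  have hemb := measurableEmbedding_graphMap_add_smul (e := e) he hγ.continuous
  have hgprod := (hmp.integrable_comp_emb hemb).2 hgint
  have hinner (y : hyperplane e) : ∫ s : ℝ, g (graphMap e γ y + s • e) =
      ∫ s : ℝ, deriv ramp s * ⟪graphNormal e γ y, F (graphMap e γ y + (ε * s) • e)⟫_ℝ := by
    have h1 := Measure.integral_comp_mul_left (fun s : ℝ => g (graphMap e γ y + s • e)) ε
    have h2 (s : ℝ) : g (graphMap e γ y + (ε * s) • e) = ε⁻¹ * (deriv ramp s *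
        ⟪graphNormal e γ y, F (graphMap e γ y + (ε * s) • e)⟫_ℝ) := by
      simp only [hg]
      rw [graphHeight_graphMap_add_smul he, mul_div_cancel_left₀ _ hε.ne', graphMap, add_assoc,
        ← add_smul, proj_add_smul]
      ring
    simp_rw [h2] at h1
    rw [integral_const_mul, abs_of_pos (inv_pos.2 hε), smul_eq_mul] at h1
    exact (mul_left_cancel₀ (inv_pos.2 hε).ne' h1).symm
  constructor
  · have := hgprod.integral_prod_left
    simpa only [Function.comp_apply, hinner] using this
  · rw [← neg_eq_iff_eq_neg, ← hgI, ← hmp.integral_comp hemb]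
    refine (integral_prod _ hgprod).trans ?_
    simp only [Function.comp_apply, hinner]

/-- The Gauss–Green formula for a vector field supported in a chart. -/
theorem setIntegral_divergence_of_chart (he : ‖e‖ = 1) (hγ : ContDiff ℝ 1 γ) (hB : IsClosed B)
    (hchart : ∀ x ∈ ball p r, (x ∈ B ↔ graphHeight e γ x ≤ 0))
    (hFc : ContinuousOn F (closure Bᶜ)) (hF1 : ContDiffOn ℝ 1 F Bᶜ) (hsupp : HasCompactSupport F)
    (hball : tsupport F ⊆ ball p r) (hint : IntegrableOn (divergence F) Bᶜ) :
    ∫ x in Bᶜ, divergence F x = -∫ y, ⟪graphNormal e γ y, F (graphMap e γ y)⟫_ℝ := by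
  obtain ⟨M, hM0, hM⟩ := exists_norm_le_of_hasCompactSupport isClosed_closure hFc hsupp
  -- The integrands vanish unless `y` lies in this compact shadow of the support, on which the
  -- normal is bounded. This gives an integrable majorant that does not depend on `ε`.
  set P : Set (hyperplane e) := (hyperplane e).orthogonalProjectionOnto '' tsupport F
  have hP : IsCompact P :=
    hsupp.isCompact.image (hyperplane e).orthogonalProjectionOnto.continuous
  obtain ⟨MN, hMN⟩ := hP.exists_bound_of_continuousOn
    (continuous_graphNormal (e := e) hγ).continuousOn
  have hbound (y : hyperplane e) {s : ℝ} (hs : 0 < s) :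
      ‖⟪graphNormal e γ y, F (graphMap e γ y + s • e)⟫_ℝ‖ ≤ P.indicator (fun _ => MN * M) y := by
    by_cases hx : graphMap e γ y + s • e ∈ tsupport F
    · have hy : y ∈ P := ⟨_, hx, by rw [graphMap, add_assoc, ← add_smul, proj_add_smul]⟩
      have hxB : graphMap e γ y + s • e ∈ Bᶜ := by
        rw [Set.mem_compl_iff, hchart _ (hball hx), graphHeight_graphMap_add_smul he, not_le]
        exact hs
      rw [Set.indicator_of_mem hy]
      refine (norm_inner_le_norm _ _).trans ?_
      exact mul_le_mul (hMN y hy) (hM _ (subset_closure hxB)) (norm_nonneg _)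
        ((norm_nonneg _).trans (hMN y hy))
    · rw [image_eq_zero_of_notMem_tsupport hx, inner_zero_right, norm_zero]
      refine Set.indicator_nonneg (fun z hz => ?_) y
      exact mul_nonneg ((norm_nonneg _).trans (hMN z hz)) hM0
  -- The approach is through points strictly above the graph. Inside the ball they lie in `Bᶜ`, so
  -- continuity on `closure Bᶜ` suffices; outside the ball `F` vanishes nearby.
  have hlimF (y : hyperplane e) {s : ℝ} (hs : 0 < s) :
      Tendsto (fun ε : ℝ => F (graphMap e γ y + (ε * s) • e)) (𝓝[>] 0) (𝓝 (F (graphMap e γ y))) := by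
    have hlim : Tendsto (fun ε : ℝ => graphMap e γ y + (ε * s) • e) (𝓝[>] 0)
        (𝓝 (graphMap e γ y)) := by
      have : Continuous fun ε : ℝ => graphMap e γ y + (ε * s) • e := by fun_prop
      simpa using (this.tendsto 0).mono_left nhdsWithin_le_nhds
    by_cases hy : graphMap e γ y ∈ ball p r
    · have hfr : graphMap e γ y ∈ frontier B := by
        rw [mem_frontier_iff_graphHeight_eq_zero he hγ.continuous hchart hy]
        simpa using graphHeight_graphMap_add_smul (γ := γ) he y 0
      have hcl : graphMap e γ y ∈ closure Bᶜ := by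
        rw [frontier_eq_closure_inter_closure] at hfr
        exact hfr.2
      refine (hFc _ hcl).tendsto.comp (tendsto_nhdsWithin_iff.2 ⟨hlim, ?_⟩)
      filter_upwards [hlim.eventually (isOpen_ball.mem_nhds hy), self_mem_nhdsWithin] with ε h1 h2
      refine subset_closure ?_
      rw [Set.mem_compl_iff, hchart _ h1, graphHeight_graphMap_add_smul he, not_le]
      exact mul_pos h2 hs
    · have hns : graphMap e γ y ∉ tsupport F := fun h => hy (hball h)
      rw [image_eq_zero_of_notMem_tsupport hns]
      refine tendsto_const_nhds.congr' ?_
      filter_upwards [hlim.eventually (notMem_tsupport_iff_eventuallyEq.1 hns)] with ε hε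
      exact hε.symm
  have hbound' (y : hyperplane e) {ε : ℝ} (hε : 0 < ε) (s : ℝ) :
      ‖deriv ramp s * ⟪graphNormal e γ y, F (graphMap e γ y + (ε * s) • e)⟫_ℝ‖ ≤
        ‖deriv ramp s‖ * P.indicator (fun _ => MN * M) y := by
    rw [norm_mul]
    rcases le_or_gt s 1 with hs | hs
    · simp [deriv_ramp_of_le hs]
    · gcongr
      exact hbound y (mul_pos hε (by linarith))
  have hIB := fun ε : ℝ => fun hε : 0 < ε =>
    setIntegral_ramp_mul_divergence he hγ hB hchart hF1 hsupp hball hint hε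
  have hH (y : hyperplane e) : Tendsto (fun ε : ℝ => ∫ s : ℝ, deriv ramp s *
      ⟪graphNormal e γ y, F (graphMap e γ y + (ε * s) • e)⟫_ℝ) (𝓝[>] 0)
      (𝓝 ⟪graphNormal e γ y, F (graphMap e γ y)⟫_ℝ) := by
    have h1 : ⟪graphNormal e γ y, F (graphMap e γ y)⟫_ℝ =
        ∫ s : ℝ, deriv ramp s * ⟪graphNormal e γ y, F (graphMap e γ y)⟫_ℝ := by
      rw [integral_mul_const, integral_deriv_ramp, one_mul]
    rw [h1]
    refine tendsto_integral_filter_of_dominated_convergence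
      (fun s => ‖deriv ramp s‖ * P.indicator (fun _ => MN * M) y) ?_ ?_
      (integrable_deriv_ramp.norm.mul_const _) ?_
    · filter_upwards [self_mem_nhdsWithin] with ε hε
      have hcont : Continuous fun s : ℝ => deriv ramp s *
          ⟪graphNormal e γ y, F (graphMap e γ y + (ε * s) • e)⟫_ℝ := by
        have h2 := (contDiff_ramp_smul hγ hB hchart hF1 hball hε).continuous
        rw [continuous_iff_continuousAt]
        intro s
        rcases lt_or_ge s 1 with hs | hs
        · have : (fun s : ℝ => deriv ramp s *
              ⟪graphNormal e γ y, F (graphMap e γ y + (ε * s) • e)⟫_ℝ) =ᶠ[𝓝 s] fun _ => 0 := by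
            filter_upwards [gt_mem_nhds hs] with t ht
            rw [deriv_ramp_of_le ht.le, zero_mul]
          exact continuousAt_const.congr this.symm
        · refine continuous_deriv_ramp.continuousAt.mul (ContinuousAt.inner continuousAt_const ?_)
          have hline : ContinuousAt (fun s : ℝ => graphMap e γ y + (ε * s) • e) s := by fun_prop
          have hFat : ContinuousAt F (graphMap e γ y + (ε * s) • e) := by
            by_cases hx : graphMap e γ y + (ε * s) • e ∈ tsupport F
            · refine (hF1.contDiffAt (hB.isOpen_compl.mem_nhds ?_)).continuousAt
              rw [Set.mem_compl_iff, hchart _ (hball hx), graphHeight_graphMap_add_smul he, not_le]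
              exact mul_pos hε (by linarith)
            · exact continuousAt_const.congr (notMem_tsupport_iff_eventuallyEq.1 hx).symm
          exact ContinuousAt.comp (f := fun s : ℝ => graphMap e γ y + (ε * s) • e) hFat hline
      exact hcont.aestronglyMeasurable
    · filter_upwards [self_mem_nhdsWithin] with ε hε
      exact .of_forall fun s => hbound' y hε s
    · refine .of_forall fun s => ?_
      rcases le_or_gt s 1 with hs | hs
      · simp [deriv_ramp_of_le hs]
      · exact tendsto_const_nhds.mul (tendsto_const_nhds.inner (hlimF y (by linarith)))
  have hR : Tendsto (fun ε : ℝ => ∫ y, ∫ s : ℝ, deriv ramp s *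
      ⟪graphNormal e γ y, F (graphMap e γ y + (ε * s) • e)⟫_ℝ) (𝓝[>] 0)
      (𝓝 (∫ y, ⟪graphNormal e γ y, F (graphMap e γ y)⟫_ℝ)) := by
    refine tendsto_integral_filter_of_dominated_convergence
      (fun y => (∫ s, ‖deriv ramp s‖) * P.indicator (fun _ => MN * M) y) ?_ ?_ ?_
      (.of_forall hH)
    · filter_upwards [self_mem_nhdsWithin] with ε hε
      exact (hIB ε hε).1.aestronglyMeasurable
    · filter_upwards [self_mem_nhdsWithin] with ε hε
      refine .of_forall fun y => ?_
      rw [← integral_mul_const]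
      exact norm_integral_le_of_norm_le (integrable_deriv_ramp.norm.mul_const _)
        (.of_forall fun s => hbound' y hε s)
    · refine Integrable.const_mul ?_ _
      rw [integrable_indicator_iff hP.measurableSet]
      exact integrableOn_const hP.measure_lt_top.ne
  have hL : Tendsto (fun ε : ℝ => ∫ x in Bᶜ, ramp (graphHeight e γ x / ε) * divergence F x)
      (𝓝[>] 0) (𝓝 (∫ x in Bᶜ, divergence F x)) := by
    refine tendsto_integral_filter_of_dominated_convergence (fun x => ‖divergence F x‖) ?_ ?_
      hint.norm ?_
    · refine .of_forall fun ε => ?_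
      exact ((contDiff_ramp.continuous.comp
        ((continuous_graphHeight hγ.continuous).div_const ε)).aestronglyMeasurable).mul
        hint.aestronglyMeasurable
    · refine .of_forall fun ε => .of_forall fun x => ?_
      rw [norm_mul, Real.norm_of_nonneg (ramp_nonneg _)]
      exact mul_le_of_le_one_left (norm_nonneg _) (ramp_le_one _)
    · rw [ae_restrict_iff' hB.isOpen_compl.measurableSet]
      refine .of_forall fun x hxB => ?_
      by_cases hx : x ∈ tsupport F
      · have hpos : 0 < graphHeight e γ x := by
          by_contra! h
          exact hxB ((hchart x (hball hx)).2 h)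
        refine tendsto_const_nhds.congr' ?_
        filter_upwards [Ioo_mem_nhdsGT (half_pos hpos)] with ε hε
        rw [ramp_of_ge, one_mul]
        rw [le_div_iff₀ hε.1]
        linarith [hε.2]
      · simp [divergence_eq_zero_of_notMem_tsupport hx]
  refine tendsto_nhds_unique hL (hR.neg.congr' ?_)
  filter_upwards [self_mem_nhdsWithin] with ε hε
  exact (hIB ε hε).2.symm

end LocalGaussGreen

end

/-! ### The Gauss–Green formula for airfoils. -/

section

section GaussGreen

open Measure Module
open scoped Manifold ContDiff

variable {n : ℕ} {B : Set (Space n)} {ν : Space n → Space n}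

lemma divergence_sum {ι : Type*} (s : Finset ι) {F : ι → Space n → Space n} {x : Space n}
    (hF : ∀ i ∈ s, DifferentiableAt ℝ (F i) x) :
    divergence (fun y => ∑ i ∈ s, F i y) x = ∑ i ∈ s, divergence (F i) x := by
  rw [divergence_of_hasFDerivAt (HasFDerivAt.fun_sum fun i hi => (hF i hi).hasFDerivAt),
    Finset.sum_congr rfl fun i hi => divergence_of_hasFDerivAt (hF i hi).hasFDerivAt,
    Finset.sum_comm]
  simp

/-- Boundaries of class `C²` have global `C¹` charts around each point. -/
lemma HasHolderC2Boundary.exists_chart {α : ℝ≥0} (hB : HasHolderC2Boundary α B) {p : Space n}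
    (hp : p ∈ frontier B) : ∃ (r : ℝ) (e : Space n) (γ : hyperplane e → ℝ), 0 < r ∧ ‖e‖ = 1 ∧
      ContDiff ℝ 1 γ ∧ ∀ x ∈ ball p r, (x ∈ B ↔ graphHeight e γ x ≤ 0) := by
  obtain ⟨r, e, γ, K, hr, he, hγ, -, hx⟩ := hB p hp
  set q := (hyperplane e).orthogonalProjectionOnto p
  -- Multiplying by a bump extends `γ` from the ball of radius `r` to the whole hyperplane. The
  -- chart keeps its form on the ball of radius `r / 3`, which projects into the region where the
  -- bump equals `1`, because projections do not increase distances.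
  let χ : ContDiffBump q := ⟨r / 3, r / 2, by positivity, by linarith⟩
  refine ⟨r / 3, e, fun y => χ y * γ y, by positivity, he, ?_, fun x hxb => ?_⟩
  · rw [contDiff_iff_contDiffAt]
    intro y
    by_cases hy : y ∈ ball q r
    · exact χ.contDiffAt.mul ((hγ.contDiffAt (isOpen_ball.mem_nhds hy)).of_le one_le_two)
    · have hy' : y ∉ tsupport χ := by
        rw [χ.tsupport_eq]
        intro h
        refine hy ?_
        rw [mem_closedBall] at h
        rw [mem_ball]
        exact h.trans_lt (show r / 2 < r by linarith)
      refine (contDiffAt_const (c := (0 : ℝ))).congr_of_eventuallyEq ?_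
      filter_upwards [notMem_tsupport_iff_eventuallyEq.1 hy'] with z hz
      rw [hz, Pi.zero_apply, zero_mul]
  · have h1 : (hyperplane e).orthogonalProjectionOnto x ∈ closedBall q χ.rIn := by
      rw [mem_closedBall, dist_eq_norm, ← map_sub]
      refine ((hyperplane e).norm_orthogonalProjectionOnto_apply_le _).trans ?_
      rw [mem_ball, dist_eq_norm] at hxb
      exact hxb.le
    rw [hx x (ball_subset_ball (by linarith) hxb), graphHeight, χ.one_of_mem_closedBall h1, one_mul,
      sub_nonpos]

section Chart

variable {e : Space n} {γ : hyperplane e → ℝ} {p : Space n} {r : ℝ}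

lemma mem_range_graphMap_iff (he : ‖e‖ = 1) {x : Space n} :
    x ∈ Set.range (graphMap e γ) ↔ graphHeight e γ x = 0 := by
  constructor
  · rintro ⟨y, rfl⟩
    simpa using graphHeight_graphMap_add_smul (γ := γ) he y 0
  · intro h
    refine ⟨(hyperplane e).orthogonalProjectionOnto x, ?_⟩
    simpa [h] using graphMap_proj_add_smul (γ := γ) he x

/-- The surface density `‖graphNormal‖` cancels the normalization of the unit normal, so the flux is
an integral over the hyperplane with the unnormalized normal. -/
lemma boundaryIntegral_of_chart (he : ‖e‖ = 1) (hγ : ContDiff ℝ 1 γ)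
    (hν : ∀ p ∈ frontier B, IsOuterUnitNormal B p (ν p))
    (hchart : ∀ x ∈ ball p r, (x ∈ B ↔ graphHeight e γ x ≤ 0)) {F : Space n → Space n}
    (hball : tsupport F ⊆ ball p r) :
    boundaryIntegral B (fun x => ⟪F x, ν x⟫_ℝ) =
      ∫ y, ⟪graphNormal e γ y, F (graphMap e γ y)⟫_ℝ := by
  have hind : (frontier B).indicator (fun x => ⟪F x, ν x⟫_ℝ) =
      (Set.range (graphMap e γ)).indicator (fun x =>
        ‖graphNormal e γ ((hyperplane e).orthogonalProjectionOnto x)‖⁻¹ *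
        ⟪graphNormal e γ ((hyperplane e).orthogonalProjectionOnto x), F x⟫_ℝ) := by
    ext1 x
    by_cases hx : x ∈ tsupport F
    · by_cases hfr : x ∈ frontier B
      · have hr : x ∈ Set.range (graphMap e γ) := (mem_range_graphMap_iff he).2
          ((mem_frontier_iff_graphHeight_eq_zero he hγ.continuous hchart (hball hx)).1 hfr)
        rw [Set.indicator_of_mem hfr, Set.indicator_of_mem hr,
          (hν x hfr).eq_graphNormal he hγ hchart (hball hx) hfr, inner_smul_right,
          real_inner_comm]
      · have hr : x ∉ Set.range (graphMap e γ) := fun h => hfr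
          ((mem_frontier_iff_graphHeight_eq_zero he hγ.continuous hchart (hball hx)).2
            ((mem_range_graphMap_iff he).1 h))
        rw [Set.indicator_of_notMem hfr, Set.indicator_of_notMem hr]
    · simp [Set.indicator, image_eq_zero_of_notMem_tsupport hx]
  rw [boundaryIntegral, ← integral_indicator isClosed_frontier.measurableSet, hind,
    integral_indicator (measurableEmbedding_graphMap hγ.continuous).measurableSet_range,
    setIntegral_range_graphMap he hγ]
  refine integral_congr_ae (.of_forall fun y => ?_)
  have := norm_ne_zero_iff.2 (graphNormal_ne_zero (γ := γ) he y)
  simp only [proj_graphMap]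
  field_simp

lemma measure_frontier_inter_ball_lt_top (he : ‖e‖ = 1) (hγ : ContDiff ℝ 1 γ)
    (hchart : ∀ x ∈ ball p r, (x ∈ B ↔ graphHeight e γ x ≤ 0)) :
    (μHE[n - 1] : Measure (Space n)) (frontier B ∩ ball p r) < ⊤ := by
  have hsub : frontier B ∩ ball p r ⊆ ball p r ∩ Set.range (graphMap e γ) := fun x hx =>
    ⟨hx.2, (mem_range_graphMap_iff he).2
      ((mem_frontier_iff_graphHeight_eq_zero he hγ.continuous hchart hx.2).1 hx.1)⟩
  refine (measure_mono hsub).trans_lt ?_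
  rw [← Measure.restrict_apply measurableSet_ball, ← map_graphMap_withDensity he hγ,
    (measurableEmbedding_graphMap hγ.continuous).map_apply,
    withDensity_apply _ ((continuous_graphMap hγ.continuous).measurable measurableSet_ball)]
  set q := (hyperplane e).orthogonalProjectionOnto p
  have hsub2 : graphMap e γ ⁻¹' ball p r ⊆ closedBall q r := by
    intro y hy
    rw [Set.mem_preimage, mem_ball, dist_eq_norm] at hy
    rw [mem_closedBall, dist_eq_norm, ← proj_graphMap (γ := γ) y, ← map_sub]
    exact ((hyperplane e).norm_orthogonalProjectionOnto_apply_le _).trans hy.le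
  refine (lintegral_mono_set hsub2).trans_lt ?_
  have hint : IntegrableOn (fun y => ‖graphNormal e γ y‖) (closedBall q r) :=
    (continuous_graphNormal hγ).norm.continuousOn.integrableOn_compact (isCompact_closedBall q r)
  have := hint.hasFiniteIntegral
  rw [hasFiniteIntegral_iff_ofReal (.of_forall fun y => norm_nonneg _)] at this
  exact this

end Chart

lemma IsAirfoil.isCompact_frontier (hB : IsAirfoil B) : IsCompact (frontier B) :=
  hB.isCompact.of_isClosed_subset isClosed_frontier hB.isCompact.isClosed.frontier_subset

lemma IsAirfoil.measure_frontier_lt_top (hB : IsAirfoil B) :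
    (μHE[n - 1] : Measure (Space n)) (frontier B) < ⊤ := by
  obtain ⟨α, -, -, hα⟩ := hB.holder_boundary
  refine hB.isCompact_frontier.measure_lt_top_of_nhdsWithin fun p hp => ?_
  obtain ⟨r, e, γ, hr, he, hγ, hchart⟩ := hα.exists_chart hp
  exact ⟨frontier B ∩ ball p r, inter_mem_nhdsWithin _ (ball_mem_nhds p hr),
    measure_frontier_inter_ball_lt_top he hγ hchart⟩

/-- The conditions on `ν` are pointwise; continuity comes from the formula for the normal in a
chart. With the finite area of `∂B` it makes the boundary integrals converge. -/
lemma IsAirfoil.continuousOn_normal (hB : IsAirfoil B)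
    (hν : ∀ p ∈ frontier B, IsOuterUnitNormal B p (ν p)) : ContinuousOn ν (frontier B) := by
  obtain ⟨α, -, -, hα⟩ := hB.holder_boundary
  intro p hp
  obtain ⟨r, e, γ, hr, he, hγ, hchart⟩ := hα.exists_chart hp
  have hN : Continuous fun x : Space n =>
      graphNormal e γ ((hyperplane e).orthogonalProjectionOnto x) :=
    (continuous_graphNormal hγ).comp (hyperplane e).orthogonalProjectionOnto.continuous
  have hc : Continuous fun x : Space n =>
      ‖graphNormal e γ ((hyperplane e).orthogonalProjectionOnto x)‖⁻¹ •
      graphNormal e γ ((hyperplane e).orthogonalProjectionOnto x) :=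
    (hN.norm.inv₀ fun x => norm_ne_zero_iff.2 (graphNormal_ne_zero he _)).smul hN
  refine (hc.continuousWithinAt).congr_of_eventuallyEq ?_
    ((hν p hp).eq_graphNormal he hγ hchart (mem_ball_self hr) hp)
  filter_upwards [self_mem_nhdsWithin, mem_nhdsWithin_of_mem_nhds (ball_mem_nhds p hr)] with x h1 h2
  exact (hν x h1).eq_graphNormal he hγ hchart h2 h1

lemma IsAirfoil.integrableOn_frontier (hB : IsAirfoil B) {f : Space n → ℝ}
    (hf : ContinuousOn f (frontier B)) : IntegrableOn f (frontier B) μHE[n - 1] := by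
  obtain ⟨M, hM⟩ := hB.isCompact_frontier.exists_bound_of_continuousOn hf
  exact IntegrableOn.of_bound hB.measure_frontier_lt_top
    (hf.aestronglyMeasurable isClosed_frontier.measurableSet) M
    ((ae_restrict_iff' isClosed_frontier.measurableSet).2 (.of_forall hM))

lemma integrableOn_of_continuousOn_of_hasCompactSupport {s : Set (Space n)} {f : Space n → ℝ}
    (hs : IsClosed s) (hf : ContinuousOn f s) (hc : HasCompactSupport f) : IntegrableOn f s := by
  have h1 : IntegrableOn f (s ∩ tsupport f) :=
    (hf.mono Set.inter_subset_left).integrableOn_compact (hc.isCompact.inter_left hs)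
  rw [← integrable_indicator_iff hs.measurableSet]
  rw [← integrable_indicator_iff (hs.inter (isClosed_tsupport f)).measurableSet] at h1
  convert! h1 using 1
  ext1 x
  by_cases hx : x ∈ tsupport f
  · by_cases hxs : x ∈ s
    · rw [Set.indicator_of_mem hxs, Set.indicator_of_mem (Set.mem_inter hxs hx)]
    · rw [Set.indicator_of_notMem hxs, Set.indicator_of_notMem fun h => hxs h.1]
  · simp [Set.indicator, image_eq_zero_of_notMem_tsupport hx]

lemma frontier_subset_closure_compl (B : Set (Space n)) : frontier B ⊆ closure Bᶜ := by
  rw [frontier_eq_closure_inter_closure]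
  exact Set.inter_subset_right

/-- Near every point, the Gauss–Green formula holds. -/
lemma IsAirfoil.exists_nhds_gauss_green (hB : IsAirfoil B)
    (hν : ∀ p ∈ frontier B, IsOuterUnitNormal B p (ν p)) (p : Space n) :
    ∃ U : Set (Space n), IsOpen U ∧ p ∈ U ∧ ∀ F : Space n → Space n,
      ContinuousOn F (closure Bᶜ) → ContDiffOn ℝ 1 F Bᶜ → HasCompactSupport F →
      IntegrableOn (divergence F) Bᶜ → tsupport F ⊆ U →
      ∫ x in Bᶜ, divergence F x = -boundaryIntegral B (fun x => ⟪F x, ν x⟫_ℝ) := by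
  have hcl := hB.isCompact.isClosed
  have hbd {F : Space n → Space n} (h : ∀ x ∈ frontier B, F x = 0) :
      boundaryIntegral B (fun x => ⟪F x, ν x⟫_ℝ) = 0 := by
    rw [boundaryIntegral, setIntegral_congr_fun isClosed_frontier.measurableSet
      (g := fun _ => (0 : ℝ)) fun x hx => by simp [h x hx]]
    simp
  by_cases hp : p ∈ frontier B
  · obtain ⟨α, -, -, hα⟩ := hB.holder_boundary
    obtain ⟨r, e, γ, hr, he, hγ, hchart⟩ := hα.exists_chart hp
    refine ⟨ball p r, isOpen_ball, mem_ball_self hr, fun F h1 h2 h3 h4 h5 => ?_⟩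
    rw [setIntegral_divergence_of_chart he hγ hcl hchart h1 h2 h3 h5 h4,
      boundaryIntegral_of_chart he hγ hν hchart h5]
  -- Off the boundary there is no flux. For fields supported in the interior of `B` the volume
  -- integral is zero term by term; those supported in `Bᶜ` are `C¹` on the whole space and have a
  -- divergence of mean zero.
  · by_cases hpB : p ∈ B
    · refine ⟨interior B, isOpen_interior, ?_, fun F h1 h2 h3 h4 h5 => ?_⟩
      · by_contra h
        exact hp ⟨subset_closure hpB, h⟩
      · rw [hbd fun x hx => image_eq_zero_of_notMem_tsupport fun h => hx.2 (h5 h), neg_zero]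
        refine setIntegral_eq_zero_of_forall_eq_zero fun x hx => ?_
        exact divergence_eq_zero_of_notMem_tsupport fun h => hx (interior_subset (h5 h))
    · refine ⟨Bᶜ, hcl.isOpen_compl, hpB, fun F h1 h2 h3 h4 h5 => ?_⟩
      rw [hbd fun x hx => image_eq_zero_of_notMem_tsupport fun h =>
        h5 h (hcl.frontier_subset hx), neg_zero, setIntegral_eq_integral_of_forall_compl_eq_zero
        fun x hx => divergence_eq_zero_of_notMem_tsupport fun h => hx (h5 h)]
      refine integral_divergence_eq_zero ?_ h3
      rw [contDiff_iff_contDiffAt]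
      intro x
      by_cases hx : x ∈ tsupport F
      · exact h2.contDiffAt (hcl.isOpen_compl.mem_nhds (h5 hx))
      · exact (contDiffAt_const (c := (0 : Space n))).congr_of_eventuallyEq
          (notMem_tsupport_iff_eventuallyEq.1 hx)

/-- The Gauss–Green formula in the exterior of an airfoil, for vector fields of compact support
that are only continuous up to the boundary. -/
theorem IsAirfoil.gauss_green (hB : IsAirfoil B)
    (hν : ∀ p ∈ frontier B, IsOuterUnitNormal B p (ν p)) {F : Space n → Space n}
    (hFc : ContinuousOn F (closure Bᶜ)) (hF1 : ContDiffOn ℝ 1 F Bᶜ) (hsupp : HasCompactSupport F)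
    (hint : IntegrableOn (divergence F) Bᶜ) :
    ∫ x in Bᶜ, divergence F x = -boundaryIntegral B (fun x => ⟪F x, ν x⟫_ℝ) := by
  have hopen : IsOpen Bᶜ := hB.isCompact.isClosed.isOpen_compl
  choose U hUo hU hUF using hB.exists_nhds_gauss_green hν
  obtain ⟨t, ht⟩ := hsupp.isCompact.elim_finite_subcover U hUo
    fun x _ => Set.mem_iUnion.2 ⟨x, hU x⟩
  have ht' : tsupport F ⊆ ⋃ i : t, U i := by
    intro x hx
    obtain ⟨i, hi, hxi⟩ := Set.mem_iUnion₂.1 (ht hx)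
    exact Set.mem_iUnion.2 ⟨⟨i, hi⟩, hxi⟩
  obtain ⟨f, hf⟩ := SmoothPartitionOfUnity.exists_isSubordinate 𝓘(ℝ, Space n)
    (isClosed_tsupport F) (fun i : t => U i) (fun i => hUo i) ht'
  have hfs (i : t) : ContDiff ℝ 1 (f i) := ((f i).contMDiff.contDiff).of_le (by simp)
  have hF : F = fun x => ∑ i, f i x • F x := by
    ext1 x
    by_cases hx : x ∈ tsupport F
    · rw [← Finset.sum_smul, ← finsum_eq_sum_of_fintype, f.sum_eq_one hx, one_smul]
    · simp [image_eq_zero_of_notMem_tsupport hx]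
  have hsup (i : t) : HasCompactSupport fun x => f i x • F x :=
    HasCompactSupport.intro hsupp fun x hx => by
      rw [image_eq_zero_of_notMem_tsupport hx, smul_zero]
  have hcont (i : t) : ContinuousOn (fun x => f i x • F x) (closure Bᶜ) :=
    (hfs i).continuous.continuousOn.smul hFc
  have hc1 (i : t) : ContDiffOn ℝ 1 (fun x => f i x • F x) Bᶜ := (hfs i).contDiffOn.smul hF1
  have hFd {x : Space n} (hx : x ∈ Bᶜ) : DifferentiableAt ℝ F x :=
    (hF1.contDiffAt (hopen.mem_nhds hx)).differentiableAt one_ne_zero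
  have hgrad (i : t) (x : Space n) : HasGradientAt (f i) (gradient (f i) x) x :=
    ((hfs i).differentiable one_ne_zero x).hasGradientAt
  -- Localizing adds only the term `⟪∇f, F⟫` to `f div F`, and this term is continuous up to the
  -- boundary with compact support.
  have hdivi (i : t) : IntegrableOn (divergence fun x => f i x • F x) Bᶜ := by
    have h1 : IntegrableOn (fun x => f i x * divergence F x) Bᶜ :=
      Integrable.bdd_mul (c := 1) hint (hfs i).continuous.aestronglyMeasurable
        (.of_forall fun x => by
          rw [Real.norm_of_nonneg (f.nonneg i x)]
          exact f.le_one i x)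
    have h2 : IntegrableOn (fun x => ⟪gradient (f i) x, F x⟫_ℝ) Bᶜ := by
      refine (integrableOn_of_continuousOn_of_hasCompactSupport isClosed_closure ?_ ?_).mono_set
        subset_closure
      · have : Continuous (gradient (f i)) :=
          (InnerProductSpace.toDual ℝ (Space n)).symm.continuous.comp
            ((hfs i).continuous_fderiv one_ne_zero)
        exact this.continuousOn.inner hFc
      · exact HasCompactSupport.intro hsupp fun x hx => by
          rw [image_eq_zero_of_notMem_tsupport hx, inner_zero_right]
    refine (h1.add h2).congr_fun (fun x hx => ?_) hopen.measurableSet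
    exact (divergence_smul (hgrad i x) (hFd hx)).symm
  have hI (i : t) : ∫ x in Bᶜ, divergence (fun x => f i x • F x) x =
      -boundaryIntegral B (fun x => ⟪f i x • F x, ν x⟫_ℝ) :=
    hUF i _ (hcont i) (hc1 i) (hsup i) (hdivi i)
      ((tsupport_smul_subset_left (f i) F).trans (hf i))
  have hbI (i : t) : IntegrableOn (fun x => ⟪f i x • F x, ν x⟫_ℝ) (frontier B) μHE[n - 1] :=
    hB.integrableOn_frontier (((hcont i).mono (frontier_subset_closure_compl B)).inner
      (hB.continuousOn_normal hν))
  calc ∫ x in Bᶜ, divergence F x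
      = ∫ x in Bᶜ, ∑ i, divergence (fun x => f i x • F x) x := by
        refine setIntegral_congr_fun hopen.measurableSet fun x hx => ?_
        rw [← divergence_sum Finset.univ (F := fun i x => f i x • F x) fun i _ =>
          ((hfs i).differentiable one_ne_zero x).fun_smul (hFd hx)]
        exact congrArg (divergence · x) hF
    _ = ∑ i, ∫ x in Bᶜ, divergence (fun x => f i x • F x) x :=
        integral_finsetSum _ fun i _ => hdivi i
    _ = -∑ i, boundaryIntegral B (fun x => ⟪f i x • F x, ν x⟫_ℝ) := by
        rw [← Finset.sum_neg_distrib]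
        exact Finset.sum_congr rfl fun i _ => hI i
    _ = -boundaryIntegral B (fun x => ⟪F x, ν x⟫_ℝ) := by
        simp only [boundaryIntegral]
        rw [← integral_finsetSum _ fun i _ => hbI i]
        congr 2
        ext1 x
        rw [← sum_inner]
        exact congrArg (⟪·, ν x⟫_ℝ) (congrFun hF x).symm

/-- The Gauss–Green formula in an airfoil, for smooth vector fields. -/
theorem IsAirfoil.boundaryIntegral_inner_normal (hB : IsAirfoil B)
    (hν : ∀ p ∈ frontier B, IsOuterUnitNormal B p (ν p)) {G : Space n → Space n}
    (hG : ContDiff ℝ 1 G) :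
    boundaryIntegral B (fun x => ⟪G x, ν x⟫_ℝ) = ∫ x in B, divergence G x := by
  have hcl := hB.isCompact.isClosed
  obtain ⟨R, hR0, hR⟩ := hB.isCompact.isBounded.subset_ball_lt 0 (0 : Space n)
  let χ : ContDiffBump (0 : Space n) := ⟨R, R + 1, hR0, by linarith⟩
  have hχ1 {x : Space n} (hx : x ∈ B) : χ =ᶠ[𝓝 x] fun _ => 1 :=
    χ.eventuallyEq_one_of_mem_ball (hR hx)
  set F : Space n → Space n := fun x => χ x • G x
  have hF1 : ContDiff ℝ 1 F := χ.contDiff.smul hG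
  have hsupp : HasCompactSupport F := HasCompactSupport.intro χ.hasCompactSupport fun x hx => by
    simp only [F]
    rw [image_eq_zero_of_notMem_tsupport hx, zero_smul]
  have hint : Integrable (divergence F) :=
    (divergence_continuous hF1).integrable_of_hasCompactSupport (hasCompactSupport_divergence hsupp)
  have h1 := hB.gauss_green hν hF1.continuous.continuousOn hF1.contDiffOn hsupp hint.integrableOn
  -- The cut-off field has a divergence of total integral zero, so the integral over `B` is minus
  -- the one over the exterior.
  have h2 := integral_add_compl hcl.measurableSet hint
  rw [integral_divergence_eq_zero hF1 hsupp, h1] at h2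
  have h3 : boundaryIntegral B (fun x => ⟪F x, ν x⟫_ℝ) =
      boundaryIntegral B (fun x => ⟪G x, ν x⟫_ℝ) := by
    refine setIntegral_congr_fun isClosed_frontier.measurableSet fun x hx => ?_
    simp only [F]
    rw [(hχ1 (hcl.frontier_subset hx)).eq_of_nhds, one_smul]
  have h4 : ∫ x in B, divergence F x = ∫ x in B, divergence G x := by
    refine setIntegral_congr_fun hcl.measurableSet fun x hx => divergence_congr ?_
    filter_upwards [hχ1 hx] with y hy
    simp only [F]
    rw [hy, one_smul]
  rw [← h3, ← h4]
  linarith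

end GaussGreen

end

/-! ### Potentials of decaying curl-free fields in the exterior of a ball. -/

section

variable {n : ℕ}

lemma fderiv_apply_single {w : Space n → Space n} {x : Space n} (h : DifferentiableAt ℝ w x)
    (i j : Fin n) : fderiv ℝ w x (EuclideanSpace.single i 1) j = pd i (fun y => w y j) x := by
  have h1 : HasFDerivAt (fun y => w y j)
      ((EuclideanSpace.proj j : Space n →L[ℝ] ℝ).comp (fderiv ℝ w x)) x :=
    ((EuclideanSpace.proj j : Space n →L[ℝ] ℝ).hasFDerivAt).comp x h.hasFDerivAt
  rw [pd, h1.fderiv]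
  simp

lemma inner_fderiv_eq_sum {w : Space n → Space n} {x : Space n} (h : DifferentiableAt ℝ w x)
    (u v : Space n) :
    ⟪fderiv ℝ w x u, v⟫_ℝ = ∑ i, ∑ j, u i * v j * pd i (fun y => w y j) x := by
  have hu : fderiv ℝ w x u = ∑ i, u i • fderiv ℝ w x (EuclideanSpace.single i 1) := by
    conv_lhs => rw [← (EuclideanSpace.basisFun (Fin n) ℝ).sum_repr u]
    simp [map_sum]
  rw [hu, sum_inner]
  refine Finset.sum_congr rfl fun i _ => ?_
  rw [inner_smul_left, PiLp.inner_apply, Finset.mul_sum]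
  refine Finset.sum_congr rfl fun j _ => ?_
  rw [← fderiv_apply_single h]
  simp
  ring

/-- A curl-free vector field on a convex open set is a gradient. -/
lemma exists_hasGradientAt_of_curl_eq_zero {s : Set (Space n)} (hs : Convex ℝ s) (hso : IsOpen s)
    {w : Space n → Space n} (hw : ContDiffOn ℝ 1 w s)
    (hcurl : ∀ x ∈ s, ∀ i j, pd i (fun y => w y j) x = pd j (fun y => w y i) x) :
    ∃ φ : Space n → ℝ, ∀ x ∈ s, HasGradientAt φ (w x) x := by
  have hd {x : Space n} (hx : x ∈ s) : DifferentiableAt ℝ w x :=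
    (hw.contDiffAt (hso.mem_nhds hx)).differentiableAt one_ne_zero
  let L : Space n →L[ℝ] StrongDual ℝ (Space n) :=
    (InnerProductSpace.toDual ℝ (Space n)).toContinuousLinearEquiv.toContinuousLinearMap
  have hω {x : Space n} (hx : x ∈ s) :
      HasFDerivAt (fun x => InnerProductSpace.toDual ℝ (Space n) (w x)) (L.comp (fderiv ℝ w x)) x :=
    L.hasFDerivAt.comp x (hd hx).hasFDerivAt
  obtain ⟨φ, hφ⟩ := hs.exists_forall_hasFDerivAt_of_fderiv_symmetric hso
    (ω := fun x => InnerProductSpace.toDual ℝ (Space n) (w x))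
    (fun x hx => (hω hx).differentiableAt.differentiableWithinAt) (fun x hx u v => by
      rw [(hω hx).fderiv]
      change ⟪fderiv ℝ w x u, v⟫_ℝ = ⟪fderiv ℝ w x v, u⟫_ℝ
      rw [inner_fderiv_eq_sum (hd hx), inner_fderiv_eq_sum (hd hx), Finset.sum_comm]
      refine Finset.sum_congr rfl fun i _ => Finset.sum_congr rfl fun j _ => ?_
      rw [hcurl x hx, mul_comm (u j)])
  exact ⟨φ, fun x hx => hasGradientAt_iff_hasFDerivAt.2 (hφ x hx)⟩

/-- A decaying curl-free vector field in the exterior of a ball has a potential that vanishes at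
infinity. -/
theorem exists_exterior_potential {w : Space n → Space n} {R C σ : ℝ} (hR : 0 < R) (hσ : 0 < σ)
    (hw : ContDiffOn ℝ 1 w {x | R < ‖x‖})
    (hcurl : ∀ x, R < ‖x‖ → ∀ i j, pd i (fun y => w y j) x = pd j (fun y => w y i) x)
    (hdecay : ∀ x, R < ‖x‖ → ‖w x‖ ≤ C * ‖x‖ ^ (-1 - σ)) :
    ∃ Φ : Space n → ℝ, (∀ x, R < ‖x‖ → HasGradientAt Φ (w x) x) ∧
      Tendsto Φ (cobounded (Space n)) (𝓝 0) := by
  have hopen : IsOpen {x : Space n | R < ‖x‖} := isOpen_lt continuous_const continuous_norm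
  have hrpow : IntegrableOn (fun t : ℝ => t ^ (-1 - σ)) (Set.Ioi 1) :=
    integrableOn_Ioi_rpow_of_lt (by linarith) one_pos
  -- Integrating along the ray from `x` to infinity gives a single-valued function without any
  -- appeal to the topology of the exterior.
  set Φ : Space n → ℝ := fun x => -∫ t in Set.Ioi (1 : ℝ), ⟪w (t • x), x⟫_ℝ with hΦ
  have hnorm {x : Space n} (hx : R < ‖x‖) {t : ℝ} (ht : 1 ≤ t) : R < ‖t • x‖ := by
    rw [norm_smul, Real.norm_of_nonneg (by linarith)]
    nlinarith
  have hbound {x : Space n} (hx : R < ‖x‖) {t : ℝ} (ht : 1 ≤ t) :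
      ‖⟪w (t • x), x⟫_ℝ‖ ≤ C * ‖x‖ ^ (-σ) * t ^ (-1 - σ) := by
    have hx0 : 0 < ‖x‖ := hR.trans hx
    have h1 := hdecay _ (hnorm hx ht)
    rw [norm_smul, Real.norm_of_nonneg (by linarith), Real.mul_rpow (by linarith) hx0.le] at h1
    calc ‖⟪w (t • x), x⟫_ℝ‖ ≤ ‖w (t • x)‖ * ‖x‖ := norm_inner_le_norm _ _
      _ ≤ C * (t ^ (-1 - σ) * ‖x‖ ^ (-1 - σ)) * ‖x‖ := by gcongr
      _ = C * t ^ (-1 - σ) * (‖x‖ ^ (-1 - σ) * ‖x‖) := by ring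
      _ = _ := by
        rw [← Real.rpow_add_one hx0.ne', show -1 - σ + 1 = -σ by ring]
        ring
  have hcont {x : Space n} (hx : R < ‖x‖) :
      ContinuousOn (fun t : ℝ => ⟪w (t • x), x⟫_ℝ) (Set.Ici 1) := by
    have h1 : ContinuousOn (fun t : ℝ => w (t • x)) (Set.Ici 1) :=
      hw.continuousOn.comp (by fun_prop) fun t ht => hnorm hx ht
    exact h1.inner continuousOn_const
  have hint {x : Space n} (hx : R < ‖x‖) :
      IntegrableOn (fun t : ℝ => ⟪w (t • x), x⟫_ℝ) (Set.Ioi 1) := by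
    refine Integrable.mono' (hrpow.const_mul (C * ‖x‖ ^ (-σ)))
      (((hcont hx).mono Set.Ioi_subset_Ici_self).aestronglyMeasurable measurableSet_Ioi) ?_
    rw [ae_restrict_iff' measurableSet_Ioi]
    exact .of_forall fun t ht => hbound hx (le_of_lt ht)
  refine ⟨Φ, fun x hx => ?_, ?_⟩
  · have hx0 : 0 < ‖x‖ := hR.trans hx
    -- This half-space contains `x`, avoids the ball of radius `R` and is stable under dilations `t
    -- ≥ 1`. Being convex, it carries a local potential `φ`, and it remains to see that `Φ - φ` is
    -- constant on it.
    set H : Set (Space n) := {y | R * ‖x‖ < ⟪x, y⟫_ℝ} with hH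
    have hHo : IsOpen H := isOpen_lt continuous_const (by fun_prop)
    have hHc : Convex ℝ H := convex_halfSpace_gt (innerSL ℝ x).isLinear _
    have hxH : x ∈ H := by
      rw [hH, Set.mem_ofPred_eq, real_inner_self_eq_norm_sq]
      nlinarith
    have hHR {y : Space n} (hy : y ∈ H) : R < ‖y‖ := by
      have h1 : R * ‖x‖ < ‖x‖ * ‖y‖ := lt_of_lt_of_le hy (real_inner_le_norm x y)
      nlinarith
    have hHt {y : Space n} (hy : y ∈ H) {t : ℝ} (ht : 1 ≤ t) : t • y ∈ H := by
      rw [hH, Set.mem_ofPred_eq, inner_smul_right]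
      have h1 : R * ‖x‖ < ⟪x, y⟫_ℝ := hy
      have h2 : 0 < R * ‖x‖ := by positivity
      nlinarith
    obtain ⟨φ, hφ⟩ := exists_hasGradientAt_of_curl_eq_zero hHc hHo
      (hw.mono fun y hy => hHR hy) fun y hy => hcurl y (hHR hy)
    have hder {y : Space n} (hy : y ∈ H) {t : ℝ} (ht : 1 ≤ t) :
        HasDerivAt (fun t : ℝ => φ (t • y)) ⟪w (t • y), y⟫_ℝ t := by
      have h1 : HasDerivAt (fun t : ℝ => t • y) y t := by
        simpa using (hasDerivAt_id t).smul_const y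
      exact (hφ _ (hHt hy ht)).hasFDerivAt.comp_hasDerivAt t h1
    have hlim {y : Space n} (hy : y ∈ H) : ∃ L, Tendsto (fun t : ℝ => φ (t • y)) atTop (𝓝 L) :=
      ⟨_, tendsto_limUnder_of_hasDerivAt_of_integrableOn_Ioi
        (fun t ht => hder hy (le_of_lt ht)) (hint (hHR hy))⟩
    obtain ⟨L, hL⟩ := hlim hxH
    have hLy {y : Space n} (hy : y ∈ H) : Tendsto (fun t : ℝ => φ (t • y)) atTop (𝓝 L) := by
      -- The segment from `t • x` to `t • y` has length `t ‖y - x‖` and lies in the dilated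
      -- half-space `t H`, at distance at least `t R` from the origin. The difference is therefore
      -- `O(t · t^{-1-σ})`, and all rays have the same limit.
      have hdiff : Tendsto (fun t : ℝ => φ (t • y) - φ (t • x)) atTop (𝓝 0) := by
        have hub : Tendsto (fun t : ℝ => |C| * R ^ (-1 - σ) * ‖y - x‖ * t ^ (-σ)) atTop (𝓝 0) := by
          simpa using (tendsto_rpow_neg_atTop hσ).const_mul (|C| * R ^ (-1 - σ) * ‖y - x‖)
        refine squeeze_zero_norm' ?_ hub
        filter_upwards [eventually_ge_atTop 1] with t ht
        have ht0 : 0 < t := by linarith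
        have hseg : Convex ℝ ((fun z : Space n => t⁻¹ • z) ⁻¹' H) :=
          hHc.is_linear_preimage (IsLinearMap.isLinearMap_smul t⁻¹)
        have hmem {z : Space n} (hz : z ∈ (fun z : Space n => t⁻¹ • z) ⁻¹' H) :
            z ∈ H ∧ t * R ≤ ‖z‖ := by
          have hz' : t⁻¹ • z ∈ H := hz
          have e1 : t • t⁻¹ • z = z := smul_inv_smul₀ ht0.ne' z
          constructor
          · rw [← e1]
            exact hHt hz' ht
          · have := hHR hz'
            rw [← e1, norm_smul, Real.norm_of_nonneg ht0.le]
            nlinarith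
        have hb := hseg.norm_image_sub_le_of_norm_hasFDerivWithin_le (f := φ)
          (f' := fun z => InnerProductSpace.toDual ℝ (Space n) (w z))
          (C := |C| * (t * R) ^ (-1 - σ))
          (fun z hz => (hφ z (hmem hz).1).hasFDerivAt.hasFDerivWithinAt) (fun z hz => by
            rw [LinearIsometryEquiv.norm_map]
            refine (hdecay z (hHR (hmem hz).1)).trans ?_
            refine mul_le_mul (le_abs_self C) ?_ (by positivity) (abs_nonneg C)
            exact Real.rpow_le_rpow_of_nonpos (by positivity) (hmem hz).2 (by linarith))
          (x := t • x) (y := t • y) (by simpa [inv_smul_smul₀ ht0.ne'] using hxH)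
          (by simpa [inv_smul_smul₀ ht0.ne'] using hy)
        refine hb.trans (le_of_eq ?_)
        rw [← smul_sub, norm_smul, Real.norm_of_nonneg ht0.le, Real.mul_rpow ht0.le hR.le,
          show -σ = -1 - σ + 1 by ring, Real.rpow_add_one ht0.ne']
        ring
      simpa using hdiff.add hL
    have heq {y : Space n} (hy : y ∈ H) : Φ y = φ y - L := by
      have h1 := integral_Ioi_of_hasDerivAt_of_tendsto' (a := 1)
        (f := fun t : ℝ => φ (t • y)) (fun t ht => hder hy ht) (hint (hHR hy)) (hLy hy)
      rw [hΦ]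
      simp only [h1, one_smul]
      ring
    refine HasGradientAt.congr_of_eventuallyEq (f := fun y => φ y - L) ?_ ?_
    · exact ((hφ x hxH).hasFDerivAt.sub_const L)
    · filter_upwards [hHo.mem_nhds hxH] with y hy using heq hy
  · set D := ∫ t in Set.Ioi (1 : ℝ), t ^ (-1 - σ)
    have hub : Tendsto (fun x : Space n => C * D * ‖x‖ ^ (-σ)) (cobounded (Space n)) (𝓝 0) := by
      simpa using ((tendsto_rpow_neg_atTop hσ).comp tendsto_norm_cobounded_atTop).const_mul (C * D)
    refine squeeze_zero_norm' ?_ hub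
    filter_upwards [tendsto_norm_cobounded_atTop.eventually_gt_atTop R] with x hx
    rw [hΦ, norm_neg]
    calc ‖∫ t in Set.Ioi (1 : ℝ), ⟪w (t • x), x⟫_ℝ‖
        ≤ ∫ t in Set.Ioi (1 : ℝ), C * ‖x‖ ^ (-σ) * t ^ (-1 - σ) := by
          refine norm_integral_le_of_norm_le (hrpow.const_mul _) ?_
          rw [ae_restrict_iff' measurableSet_Ioi]
          exact .of_forall fun t ht => hbound hx (le_of_lt ht)
      _ = C * D * ‖x‖ ^ (-σ) := by
          rw [integral_const_mul]
          ring

end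

/-! ### Cutoffs and Green's representation of exterior harmonic functions. -/

section

variable {n : ℕ}

/-- A smooth function that is `1` on the ball of radius `1` and `0` outside the one of radius `2`. -/
def unitBump (n : ℕ) : ContDiffBump (0 : Space n) := ⟨1, 2, one_pos, one_lt_two⟩

/-- A smooth function that is `1` on the ball of radius `R` and `0` outside the one of radius
`2 * R`. -/
def cutoff (R : ℝ) (x : Space n) : ℝ := unitBump n (R⁻¹ • x)

lemma contDiff_cutoff (R : ℝ) : ContDiff ℝ 2 (cutoff R : Space n → ℝ) :=
  (unitBump n).contDiff.comp (contDiff_const_smul _)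

lemma cutoff_nonneg (R : ℝ) (x : Space n) : 0 ≤ cutoff R x := (unitBump n).nonneg

lemma cutoff_eq_one {R : ℝ} (hR : 0 < R) {x : Space n} (hx : ‖x‖ ≤ R) : cutoff R x = 1 := by
  refine (unitBump n).one_of_mem_closedBall ?_
  rw [mem_closedBall_zero_iff, norm_smul, norm_inv, Real.norm_of_nonneg hR.le]
  change R⁻¹ * ‖x‖ ≤ 1
  rw [inv_mul_le_iff₀ hR]
  simpa using hx

lemma cutoff_eq_zero {R : ℝ} (hR : 0 < R) {x : Space n} (hx : 2 * R ≤ ‖x‖) : cutoff R x = 0 := by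
  refine (unitBump n).zero_of_le_dist ?_
  rw [dist_zero_right, norm_smul, norm_inv, Real.norm_of_nonneg hR.le]
  change 2 ≤ R⁻¹ * ‖x‖
  rw [le_inv_mul_iff₀ hR]
  linarith

lemma hasGradientAt_cutoff (R : ℝ) (x : Space n) :
    HasGradientAt (cutoff R) (∇ (cutoff R) x) x :=
  ((contDiff_cutoff R).differentiable two_ne_zero x).hasGradientAt

lemma contDiff_gradient {f : Space n → ℝ} (hf : ContDiff ℝ 2 f) : ContDiff ℝ 1 (∇ f) := by
  have h : ContDiff ℝ 1 (fderiv ℝ f) := hf.fderiv_right (by norm_num)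
  exact (InnerProductSpace.toDual ℝ (Space n)).symm.toContinuousLinearEquiv.contDiff.comp h

lemma gradient_cutoff (R : ℝ) (x : Space n) :
    ∇ (cutoff R) x = R⁻¹ • ∇ (unitBump n : Space n → ℝ) (R⁻¹ • x) := by
  have h1 : HasFDerivAt (unitBump n : Space n → ℝ) _ (R⁻¹ • x) :=
    (((unitBump n).contDiff (n := 1)).differentiable one_ne_zero _).hasGradientAt.hasFDerivAt
  have h2 : HasFDerivAt (fun y : Space n => R⁻¹ • y) (R⁻¹ • ContinuousLinearMap.id ℝ (Space n)) x :=
    (hasFDerivAt_id x).const_smul R⁻¹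
  refine HasGradientAt.gradient ?_
  rw [hasGradientAt_iff_hasFDerivAt]
  convert! h1.comp x h2 using 1
  ext v
  simp

lemma gradient_cutoff_eq_zero {R : ℝ} (hR : 0 < R) {x : Space n} (hx : ‖x‖ < R ∨ 2 * R < ‖x‖) :
    ∇ (cutoff R) x = 0 := by
  obtain ⟨c, hc⟩ : ∃ c : ℝ, cutoff R =ᶠ[𝓝 x] fun _ => c := by
    rcases hx with hx | hx
    · exact ⟨1, (continuous_norm.continuousAt.eventually_lt_const hx).mono fun y hy =>
        cutoff_eq_one hR (le_of_lt hy)⟩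
    · exact ⟨0, (continuous_norm.continuousAt.eventually_const_lt hx).mono fun y hy =>
        cutoff_eq_zero hR (le_of_lt hy)⟩
  exact ((hasGradientAt_const x c).congr_of_eventuallyEq hc).gradient

lemma divergence_gradient_cutoff (R : ℝ) (x : Space n) :
    divergence (∇ (cutoff R)) x =
      R⁻¹ ^ 2 * divergence (∇ (unitBump n : Space n → ℝ)) (R⁻¹ • x) := by
  have h1 := ((contDiff_gradient (unitBump n).contDiff).differentiable one_ne_zero
    (R⁻¹ • x)).hasFDerivAt
  have h2 : HasFDerivAt (fun y : Space n => R⁻¹ • y) (R⁻¹ • ContinuousLinearMap.id ℝ (Space n)) x :=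
    (hasFDerivAt_id x).const_smul R⁻¹
  have h3 : HasFDerivAt (∇ (cutoff R : Space n → ℝ)) _ x :=
    ((h1.comp x h2).const_smul R⁻¹).congr_of_eventuallyEq (.of_forall fun y => gradient_cutoff R y)
  rw [divergence_of_hasFDerivAt h3, divergence_of_hasFDerivAt h1, Finset.mul_sum]
  refine Finset.sum_congr rfl fun i _ => ?_
  simp
  ring

lemma divergence_gradient_cutoff_eq_zero {R : ℝ} (hR : 0 < R) {x : Space n}
    (hx : ‖x‖ < R ∨ 2 * R < ‖x‖) : divergence (∇ (cutoff R)) x = 0 := by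
  have h : ∇ (cutoff R) =ᶠ[𝓝 x] fun _ : Space n => (0 : Space n) := by
    rcases hx with hx | hx
    · exact (continuous_norm.continuousAt.eventually_lt_const hx).mono fun y hy =>
        gradient_cutoff_eq_zero hR (Or.inl hy)
    · exact (continuous_norm.continuousAt.eventually_const_lt hx).mono fun y hy =>
        gradient_cutoff_eq_zero hR (Or.inr hy)
  rw [divergence_congr h, divergence_const]

/-- All cutoffs are dilations of one bump, so a single constant serves for every radius; each
derivative costs a factor `R⁻¹`. -/
lemma exists_bound_cutoff (n : ℕ) : ∃ M : ℝ, 0 ≤ M ∧ ∀ (R : ℝ), 0 < R → ∀ x : Space n,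
    ‖∇ (cutoff R) x‖ ≤ M * R⁻¹ ∧ |divergence (∇ (cutoff R)) x| ≤ M * R⁻¹ ^ 2 := by
  have hg : ContDiff ℝ 1 (∇ (unitBump n : Space n → ℝ)) := contDiff_gradient (unitBump n).contDiff
  have hc : HasCompactSupport (∇ (unitBump n : Space n → ℝ)) :=
    hasCompactSupport_of_hasGradientAt (fun x =>
      (((unitBump n).contDiff (n := 1)).differentiable one_ne_zero x).hasGradientAt)
      (unitBump n).hasCompactSupport
  obtain ⟨M₁, hM₁⟩ := hg.continuous.bounded_above_of_compact_support hc
  obtain ⟨M₂, hM₂⟩ := (divergence_continuous hg).bounded_above_of_compact_support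
    (hasCompactSupport_divergence hc)
  refine ⟨max M₁ M₂, (norm_nonneg _).trans ((hM₁ 0).trans (le_max_left _ _)), fun R hR x => ?_⟩
  rw [gradient_cutoff, divergence_gradient_cutoff, norm_smul, abs_mul, norm_inv,
    Real.norm_of_nonneg hR.le, abs_of_nonneg (by positivity), mul_comm, mul_comm (R⁻¹ ^ 2)]
  constructor
  · gcongr
    exact (hM₁ _).trans (le_max_left _ _)
  · gcongr
    exact (hM₂ _).trans (le_max_right _ _)

/-- The Laplacian of `cutoff R * Φ`, where `Φ` is harmonic with gradient `w`. -/
def cutoffLaplacian (R : ℝ) (Φ : Space n → ℝ) (w : Space n → Space n) (x : Space n) : ℝ :=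
  2 * ⟪∇ (cutoff R) x, w x⟫_ℝ + Φ x * divergence (∇ (cutoff R)) x

lemma cutoffLaplacian_eq_zero {R : ℝ} (hR : 0 < R) (Φ : Space n → ℝ) (w : Space n → Space n)
    {x : Space n} (hx : ‖x‖ < R ∨ 2 * R < ‖x‖) : cutoffLaplacian R Φ w x = 0 := by
  simp [cutoffLaplacian, gradient_cutoff_eq_zero hR hx, divergence_gradient_cutoff_eq_zero hR hx]

lemma hasCompactSupport_of_norm {E : Type*} [Zero E] {f : Space n → E} {R : ℝ}
    (h : ∀ x, R < ‖x‖ → f x = 0) : HasCompactSupport f :=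
  HasCompactSupport.intro (isCompact_closedBall 0 R) fun x hx => h x (by simpa using hx)

lemma hasCompactSupport_cutoffLaplacian {R : ℝ} (hR : 0 < R) (Φ : Space n → ℝ)
    (w : Space n → Space n) : HasCompactSupport (cutoffLaplacian R Φ w) :=
  hasCompactSupport_of_norm fun _ hx => cutoffLaplacian_eq_zero hR Φ w (Or.inr hx)

lemma contDiffOn_one_of_hasGradientAt {s : Set (Space n)} (hs : IsOpen s) {Φ : Space n → ℝ}
    {w : Space n → Space n} (hΦ : ∀ x ∈ s, HasGradientAt Φ (w x) x) (hw : ContinuousOn w s) :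
    ContDiffOn ℝ 1 Φ s := by
  rw [show (1 : WithTop ℕ∞) = 0 + 1 from rfl, contDiffOn_succ_iff_fderiv_of_isOpen hs]
  refine ⟨fun x hx => (hΦ x hx).differentiableAt.differentiableWithinAt, by simp, ?_⟩
  rw [contDiffOn_zero]
  exact ((InnerProductSpace.toDual ℝ (Space n)).continuous.comp_continuousOn hw).congr
    fun x hx => (hΦ x hx).hasFDerivAt.fderiv

lemma volume_real_ball_mul {R : ℝ} (hR : 0 < R) (r : ℝ) :
    volume.real (ball (0 : Space n) (R * r)) = R ^ (n : ℝ) * volume.real (ball (0 : Space n) r) := by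
  rw [measureReal_def, Measure.addHaar_ball_mul_of_pos volume 0 hR, finrank_euclideanSpace_fin,
    ENNReal.toReal_mul, ENNReal.toReal_ofReal (by positivity), Real.rpow_natCast]
  rfl

section Harmonic

variable {Φ : Space n → ℝ} {w : Space n → Space n} {R₀ R : ℝ}

lemma continuous_cutoffLaplacian (hR₀ : 0 < R₀) (hR : R₀ < R)
    (hΦ : ∀ x, R₀ < ‖x‖ → HasGradientAt Φ (w x) x) (hw : ContDiffOn ℝ 1 w {x | R₀ < ‖x‖}) :
    Continuous (cutoffLaplacian R Φ w) := by
  have hopen : IsOpen {x : Space n | R₀ < ‖x‖} := isOpen_lt continuous_const continuous_norm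
  have hg := contDiff_gradient (contDiff_cutoff R (n := n))
  rw [continuous_iff_continuousAt]
  intro x
  rcases lt_or_ge R₀ ‖x‖ with hx | hx
  · have h1 : ContinuousAt w x := hw.continuousOn.continuousAt (hopen.mem_nhds hx)
    have h2 : ContinuousAt Φ x := (hΦ x hx).hasFDerivAt.continuousAt
    exact ((hg.continuous.continuousAt.inner h1).const_mul 2).add
      (h2.mul (divergence_continuous hg).continuousAt)
  · have h : cutoffLaplacian R Φ w =ᶠ[𝓝 x] fun _ => 0 :=
      (continuous_norm.continuousAt.eventually_lt_const (hx.trans_lt hR)).mono fun y hy =>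
        cutoffLaplacian_eq_zero (hR₀.trans hR) Φ w (Or.inl hy)
    exact continuousAt_const.congr h.symm

/-- The difference of two cutoffs vanishes near the inner ball as well as near infinity. Its product
with `Φ` is therefore a compactly supported function on the whole space, to which the Newtonian
representation applies. -/
lemma integral_kernel_sub_mul_cutoffLaplacian_sub (hn : 3 ≤ n) (hR₀ : 0 < R₀) {S : ℝ} (hR : R₀ < R)
    (hS : R₀ < S) (hΦ : ∀ x, R₀ < ‖x‖ → HasGradientAt Φ (w x) x)
    (hw : ContDiffOn ℝ 1 w {x | R₀ < ‖x‖}) (hdiv : ∀ x, R₀ < ‖x‖ → divergence w x = 0)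
    (x : Space n) :
    ∫ y, kernel n (x - y) * (cutoffLaplacian R Φ w y - cutoffLaplacian S Φ w y) =
      -(greenConst n * ((cutoff R x - cutoff S x) * Φ x)) := by
  have hopen : IsOpen {x : Space n | R₀ < ‖x‖} := isOpen_lt continuous_const continuous_norm
  have hR0 := hR₀.trans hR
  have hS0 := hR₀.trans hS
  set χ : Space n → ℝ := fun x => cutoff R x - cutoff S x with hχ
  set χ' : Space n → Space n := fun x => ∇ (cutoff R) x - ∇ (cutoff S) x with hχ'
  have hg (x : Space n) : HasGradientAt χ (χ' x) x := by
    rw [hasGradientAt_iff_hasFDerivAt, hχ', map_sub]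
    exact (hasGradientAt_cutoff R x).hasFDerivAt.fun_sub (hasGradientAt_cutoff S x).hasFDerivAt
  have hχ'1 : ContDiff ℝ 1 χ' :=
    (contDiff_gradient (contDiff_cutoff R)).sub (contDiff_gradient (contDiff_cutoff S))
  have hχ1 : ContDiff ℝ 1 χ :=
    (((contDiff_cutoff R).sub (contDiff_cutoff S)).of_le one_le_two)
  have hnear {x : Space n} (hx : ‖x‖ ≤ R₀) : ∀ᶠ y in 𝓝 x, ‖y‖ < R ∧ ‖y‖ < S :=
    (continuous_norm.continuousAt.eventually_lt_const (hx.trans_lt hR)).and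
      (continuous_norm.continuousAt.eventually_lt_const (hx.trans_lt hS))
  have hχ0 {y : Space n} (hy : ‖y‖ < R ∧ ‖y‖ < S) : χ y = 0 := by
    rw [hχ]
    simp [cutoff_eq_one hR0 hy.1.le, cutoff_eq_one hS0 hy.2.le]
  have hχ'0 {y : Space n} (hy : ‖y‖ < R ∧ ‖y‖ < S) : χ' y = 0 := by
    rw [hχ']
    simp [gradient_cutoff_eq_zero hR0 (Or.inl hy.1), gradient_cutoff_eq_zero hS0 (Or.inl hy.2)]
  set V : Space n → Space n := fun x => χ x • w x + Φ x • χ' x with hV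
  have hVnear {x : Space n} (hx : ‖x‖ ≤ R₀) : V =ᶠ[𝓝 x] fun _ => 0 :=
    (hnear hx).mono fun y hy => by simp [hV, hχ0 hy, hχ'0 hy]
  have hgrad (x : Space n) : HasGradientAt (fun x => χ x * Φ x) (V x) x := by
    rcases lt_or_ge R₀ ‖x‖ with hx | hx
    · rw [hasGradientAt_iff_hasFDerivAt, hV]
      simp only [map_add, map_smul]
      exact (hg x).hasFDerivAt.fun_mul (hΦ x hx).hasFDerivAt
    · rw [(hVnear hx).eq_of_nhds]
      exact (hasGradientAt_const x (0 : ℝ)).congr_of_eventuallyEq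
        ((hnear hx).mono fun y hy => by simp [hχ0 hy])
  have hΦ1 : ContDiffOn ℝ 1 Φ {x | R₀ < ‖x‖} :=
    contDiffOn_one_of_hasGradientAt hopen hΦ hw.continuousOn
  have hVC : ContDiff ℝ 1 V := by
    rw [contDiff_iff_contDiffAt]
    intro x
    rcases lt_or_ge R₀ ‖x‖ with hx | hx
    · exact (hχ1.contDiffAt.fun_smul (hw.contDiffAt (hopen.mem_nhds hx))).add
        ((hΦ1.contDiffAt (hopen.mem_nhds hx)).fun_smul hχ'1.contDiffAt)
    · exact contDiffAt_const.congr_of_eventuallyEq (hVnear hx)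
  have hdivV (x : Space n) :
      divergence V x = cutoffLaplacian R Φ w x - cutoffLaplacian S Φ w x := by
    rcases lt_or_ge R₀ ‖x‖ with hx | hx
    · have hwd : DifferentiableAt ℝ w x :=
        (hw.contDiffAt (hopen.mem_nhds hx)).differentiableAt one_ne_zero
      have hdR := (contDiff_gradient (contDiff_cutoff R (n := n))).differentiable one_ne_zero x
      have hdS := (contDiff_gradient (contDiff_cutoff S (n := n))).differentiable one_ne_zero x
      rw [hV, divergence_add ((hg x).differentiableAt.fun_smul hwd)
        ((hΦ x hx).differentiableAt.fun_smul (hχ'1.differentiable one_ne_zero x)),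
        divergence_smul (hg x) hwd, divergence_smul (hΦ x hx)
          (hχ'1.differentiable one_ne_zero x), hdiv x hx, hχ', divergence_sub hdR hdS,
        cutoffLaplacian, cutoffLaplacian]
      simp only [inner_sub_right, real_inner_comm (w x)]
      ring
    · rw [divergence_congr (hVnear hx), divergence_const,
        cutoffLaplacian_eq_zero hR0 _ _ (Or.inl (hx.trans_lt hR)),
        cutoffLaplacian_eq_zero hS0 _ _ (Or.inl (hx.trans_lt hS)), sub_zero]
  have hc : HasCompactSupport fun x => χ x * Φ x :=
    hasCompactSupport_of_norm (R := 2 * max R S) fun x hx => by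
      have h1 := le_max_left R S
      have h2 := le_max_right R S
      simp [hχ, cutoff_eq_zero hR0 (x := x) (by linarith), cutoff_eq_zero hS0 (x := x) (by linarith)]
  rw [← integral_kernel_sub_mul_divergence hn hgrad hVC hc x]
  simp_rw [hdivV]

lemma integrable_kernel_sub_mul (hn : 2 ≤ n) {f : Space n → ℝ} (hf : Continuous f)
    (hc : HasCompactSupport f) (x : Space n) : Integrable fun y => kernel n (x - y) * f y := by
  have h := integrable_kernel_mul hn (f := fun y => f (x - y)) (by fun_prop)
    (hc.comp_homeomorph (Homeomorph.subLeft x))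
  simpa using h.comp_sub_left x

/-- This is a matter of scaling. On the annulus `R ≤ ‖y‖ ≤ 2 R` the kernel is `O(R^{2-n})` and the
source is at most `3 M R⁻² ε`, while the volume is `O(R^n)`. The powers of `R` cancel, so the
contribution of a cutoff at infinity is governed by `ε`. -/
lemma abs_integral_kernel_sub_mul_cutoffLaplacian_le {M ε : ℝ} (hn : 2 ≤ n)
    (hR : 0 < R) (hM : ∀ x : Space n, ‖∇ (cutoff R) x‖ ≤ M * R⁻¹ ∧
      |divergence (∇ (cutoff R)) x| ≤ M * R⁻¹ ^ 2) (hM0 : 0 ≤ M) (hε0 : 0 ≤ ε)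
    (hε : ∀ y, R ≤ ‖y‖ → |Φ y| ≤ ε ∧ ‖y‖ * ‖w y‖ ≤ ε) {x : Space n} (hx : 2 * ‖x‖ ≤ R) :
    |∫ y, kernel n (x - y) * cutoffLaplacian R Φ w y| ≤
      3 * M * 2 ^ ((n : ℝ) - 2) * volume.real (ball (0 : Space n) 3) * ε := by
  have hn' : (2 : ℝ) ≤ n := by exact_mod_cast hn
  have hT {y : Space n} (hy : R ≤ ‖y‖) : |cutoffLaplacian R Φ w y| ≤ 3 * M * R⁻¹ ^ 2 * ε := by
    obtain ⟨h1, h2⟩ := hε y hy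
    obtain ⟨h3, h4⟩ := hM y
    have hwy : ‖w y‖ ≤ ε * R⁻¹ := by
      rw [← div_eq_mul_inv, le_div_iff₀ hR, mul_comm]
      exact (mul_le_mul_of_nonneg_right hy (norm_nonneg _)).trans h2
    have h5 : |⟪∇ (cutoff R) y, w y⟫_ℝ| ≤ M * R⁻¹ * (ε * R⁻¹) :=
      (abs_real_inner_le_norm _ _).trans (by gcongr)
    have h6 : |Φ y * divergence (∇ (cutoff R)) y| ≤ ε * (M * R⁻¹ ^ 2) := by
      rw [abs_mul]
      exact mul_le_mul h1 h4 (abs_nonneg _) ((abs_nonneg _).trans h1)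
    calc |cutoffLaplacian R Φ w y|
        ≤ |2 * ⟪∇ (cutoff R) y, w y⟫_ℝ| + |Φ y * divergence (∇ (cutoff R)) y| := abs_add_le _ _
      _ ≤ 2 * (M * R⁻¹ * (ε * R⁻¹)) + ε * (M * R⁻¹ ^ 2) := by
        rw [abs_mul, abs_two]
        gcongr
      _ = _ := by ring
  have hK {y : Space n} (hy : R ≤ ‖y‖) :
      kernel n (x - y) ≤ R ^ (2 - (n : ℝ)) * 2 ^ ((n : ℝ) - 2) := by
    have h1 : R / 2 ≤ ‖x - y‖ := by
      have := norm_sub_norm_le y x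
      rw [norm_sub_rev]
      linarith
    refine (Real.rpow_le_rpow_of_nonpos (by positivity) h1 (by linarith)).trans (le_of_eq ?_)
    rw [Real.div_rpow hR.le two_pos.le, div_eq_mul_inv, ← Real.rpow_neg two_pos.le, neg_sub]
  set D : ℝ := R ^ (2 - (n : ℝ)) * 2 ^ ((n : ℝ) - 2) * (3 * M * R⁻¹ ^ 2 * ε)
  have hsub : Function.support (fun y => kernel n (x - y) * cutoffLaplacian R Φ w y) ⊆
      ball (0 : Space n) (R * 3) := by
    intro y hy
    by_contra h
    refine hy ?_
    rw [mem_ball_zero_iff, not_lt] at h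
    simp [cutoffLaplacian_eq_zero hR Φ w (x := y) (Or.inr (by linarith))]
  rw [← setIntegral_eq_integral_of_forall_compl_eq_zero (s := ball (0 : Space n) (R * 3))
    (fun y hy => by_contra fun h => hy (hsub h))]
  have hb := norm_setIntegral_le_of_norm_le_const (μ := volume) (s := ball (0 : Space n) (R * 3))
    (f := fun y => kernel n (x - y) * cutoffLaplacian R Φ w y) (C := D) measure_ball_lt_top
    (fun y _ => by
      rcases lt_or_ge ‖y‖ R with hy | hy
      · rw [cutoffLaplacian_eq_zero hR Φ w (Or.inl hy), mul_zero, norm_zero]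
        positivity
      · rw [Real.norm_eq_abs, abs_mul, abs_of_nonneg (kernel_nonneg _)]
        exact mul_le_mul (hK hy) (hT hy) (abs_nonneg _) (by positivity))
  refine hb.trans (le_of_eq ?_)
  rw [volume_real_ball_mul hR]
  have e : R ^ (2 - (n : ℝ)) * R⁻¹ ^ 2 * R ^ (n : ℝ) = 1 := by
    rw [Real.rpow_sub hR]
    norm_cast
    field_simp
  linear_combination (2 ^ ((n : ℝ) - 2) * (3 * M * ε) * volume.real (ball (0 : Space n) 3)) * e

/-- Green's representation of a harmonic function in the exterior of a ball that decays at
infinity. -/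
theorem greenConst_mul_eq_integral (hn : 3 ≤ n) (hR₀ : 0 < R₀) (hR : R₀ < R)
    (hΦ : ∀ x, R₀ < ‖x‖ → HasGradientAt Φ (w x) x) (hw : ContDiffOn ℝ 1 w {x | R₀ < ‖x‖})
    (hdiv : ∀ x, R₀ < ‖x‖ → divergence w x = 0) (hΦ0 : Tendsto Φ (cobounded (Space n)) (𝓝 0))
    (hw0 : Tendsto (fun x => ‖x‖ * ‖w x‖) (cobounded (Space n)) (𝓝 0)) {x : Space n}
    (hx : 2 * R ≤ ‖x‖) :
    greenConst n * Φ x = ∫ y, kernel n (x - y) * cutoffLaplacian R Φ w y := by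
  have hR0 := hR₀.trans hR
  obtain ⟨M, hM0, hM⟩ := exists_bound_cutoff n
  have hlim : Tendsto (fun S => ∫ y, kernel n (x - y) * cutoffLaplacian S Φ w y) atTop (𝓝 0) := by
    set D := 3 * M * 2 ^ ((n : ℝ) - 2) * volume.real (ball (0 : Space n) 3)
    have hD0 : 0 ≤ D := by positivity
    rw [Metric.tendsto_atTop]
    intro ε hε
    set δ := ε / (D + 1) with hδ
    have hδ0 : 0 < δ := by positivity
    have h1 : ∀ᶠ y in cobounded (Space n), |Φ y| ≤ δ ∧ ‖y‖ * ‖w y‖ ≤ δ := by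
      filter_upwards [hΦ0.eventually (ball_mem_nhds 0 hδ0), hw0.eventually_lt_const hδ0]
        with y h1 h2
      exact ⟨by simpa using (mem_ball_zero_iff.1 h1).le, h2.le⟩
    rw [← comap_norm_atTop, eventually_comap, eventually_atTop] at h1
    obtain ⟨S₀, hS₀⟩ := h1
    refine ⟨max S₀ (max (2 * ‖x‖) 1), fun S hS => ?_⟩
    rw [ge_iff_le, max_le_iff, max_le_iff] at hS
    rw [dist_zero_right]
    have hS0 : 0 < S := by linarith
    refine (abs_integral_kernel_sub_mul_cutoffLaplacian_le (by omega) hS0 (hM S hS0) hM0 hδ0.le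
      (fun y hy => hS₀ ‖y‖ (hS.1.trans hy) y rfl) hS.2.1).trans_lt ?_
    change D * δ < ε
    rw [hδ, mul_div_assoc', div_lt_iff₀ (by positivity)]
    nlinarith
  have hcont {S : ℝ} (hS : R₀ < S) := integrable_kernel_sub_mul (by omega : 2 ≤ n)
    (continuous_cutoffLaplacian hR₀ hS hΦ hw)
    (hasCompactSupport_cutoffLaplacian (hR₀.trans hS) Φ w) x
  -- For `2 R ≤ ‖x‖ ≤ S` the cutoffs of radius `R` and `S` take the values `0` and `1` at `x`, so
  -- their difference picks out `Φ x`.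
  have heq : ∀ᶠ S in atTop, (∫ y, kernel n (x - y) * cutoffLaplacian R Φ w y) -
      greenConst n * Φ x = ∫ y, kernel n (x - y) * cutoffLaplacian S Φ w y := by
    filter_upwards [eventually_ge_atTop ‖x‖] with S hS
    have hRS : R₀ < S := by linarith
    have h := integral_kernel_sub_mul_cutoffLaplacian_sub hn hR₀ hRS hR hΦ hw hdiv x
    simp only [mul_sub] at h
    rw [integral_sub (hcont hRS) (hcont hR), cutoff_eq_one (hR₀.trans hRS) hS,
      cutoff_eq_zero hR0 hx] at h
    linarith
  have := tendsto_nhds_unique (tendsto_const_nhds.congr' heq) hlim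
  linarith

end Harmonic

end

/-! ### Far field of the Newtonian potential of a source of mass zero. -/

section

variable {n : ℕ}

lemma greenConst_pos (hn : 3 ≤ n) : 0 < greenConst n := by
  have hn' : (3 : ℝ) ≤ n := by exact_mod_cast hn
  have : 0 < volume.real (ball (0 : Space n) 1) :=
    ENNReal.toReal_pos (measure_ball_pos volume _ one_pos).ne' measure_ball_lt_top.ne
  unfold greenConst
  have h2 : 0 < (n : ℝ) - 2 := by linarith
  positivity

section Source

variable {T : Space n → ℝ} {S : ℝ}

lemma integrable_mul_of_hasCompactSupport (hT : Continuous T) (hc : HasCompactSupport T)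
    {f : Space n → ℝ} (hf : Continuous f) : Integrable fun y => f y * T y :=
  (hf.mul hT).integrable_of_hasCompactSupport (hc.mul_left (f := f))

/-- The multipole expansion of the Newtonian potential of a source of total mass zero. -/
lemma exists_abs_integral_kernel_sub_multipole_le (hn : 3 ≤ n) (hT : Continuous T)
    (hS : ∀ y, S < ‖y‖ → T y = 0) (hT0 : ∫ y, T y = 0) :
    ∃ C : ℝ, 0 ≤ C ∧ ∀ x, x ≠ 0 → 2 * S ≤ ‖x‖ →
      |(∫ y, kernel n (x - y) * T y) - multipole (fun i => -∫ y, y i * T y)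
        (fun i j => 1 / 2 * ∫ y, y i * y j * T y) x| ≤ C * ‖x‖ ^ (-(n : ℝ) - 1) := by
  have hc : HasCompactSupport T := hasCompactSupport_of_norm hS
  obtain ⟨C, hC0, hC⟩ := kernel_taylor n
  have hint {f : Space n → ℝ} (hf : Continuous f) := integrable_mul_of_hasCompactSupport hT hc hf
  have hTabs : Integrable fun y => ‖y‖ ^ 3 * |T y| :=
    integrable_mul_of_hasCompactSupport (T := fun y => |T y|) hT.abs hc.abs
      (by fun_prop : Continuous fun y : Space n => ‖y‖ ^ 3)
  refine ⟨C * ∫ y, ‖y‖ ^ 3 * |T y|, by positivity, fun x hx hxS => ?_⟩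
  have hK := integrable_kernel_sub_mul (by omega : 2 ≤ n) hT hc x
  have hlin : ∫ y, (∑ i, y i * pd i (kernel n) x) * T y =
      ∑ i, (∫ y, y i * T y) * pd i (kernel n) x := by
    simp_rw [Finset.sum_mul]
    rw [integral_finsetSum _ fun i _ => hint (by fun_prop)]
    refine Finset.sum_congr rfl fun i _ => ?_
    rw [← integral_mul_const]
    exact integral_congr_ae (.of_forall fun y => by ring)
  have hquad : ∫ y, (∑ i, ∑ j, y i * y j * pd i (pd j (kernel n)) x) * T y =
      ∑ i, ∑ j, (∫ y, y i * y j * T y) * pd i (pd j (kernel n)) x := by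
    simp_rw [Finset.sum_mul]
    rw [integral_finsetSum _ fun i _ => integrable_finsetSum _ fun j _ => hint (by fun_prop)]
    refine Finset.sum_congr rfl fun i _ => ?_
    rw [integral_finsetSum _ fun j _ => hint (by fun_prop)]
    refine Finset.sum_congr rfl fun j _ => ?_
    rw [← integral_mul_const]
    exact integral_congr_ae (.of_forall fun y => by ring)
  have hI0 : Integrable fun y => kernel n x * T y := hint continuous_const
  have hI1 : Integrable fun y => (∑ i, y i * pd i (kernel n) x) * T y := hint (by fun_prop)
  have hI2 : Integrable fun y => (∑ i, ∑ j, y i * y j * pd i (pd j (kernel n)) x) * T y :=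
    hint (by fun_prop)
  -- The term `kernel n x * ∫ T` of the expansion is absent because the mass is zero.
  have hrem : (∫ y, kernel n (x - y) * T y) - multipole (fun i => -∫ y, y i * T y)
      (fun i j => 1 / 2 * ∫ y, y i * y j * T y) x =
      ∫ y, (kernel n (x - y) - (kernel n x - ∑ i, y i * pd i (kernel n) x +
        1 / 2 * ∑ i, ∑ j, y i * y j * pd i (pd j (kernel n)) x)) * T y := by
    have e (y : Space n) : (kernel n (x - y) - (kernel n x - ∑ i, y i * pd i (kernel n) x +
        1 / 2 * ∑ i, ∑ j, y i * y j * pd i (pd j (kernel n)) x)) * T y =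
        kernel n (x - y) * T y - (kernel n x * T y - (∑ i, y i * pd i (kernel n) x) * T y +
          1 / 2 * ((∑ i, ∑ j, y i * y j * pd i (pd j (kernel n)) x) * T y)) := by ring
    simp_rw [e]
    have hI01 : Integrable fun y => kernel n x * T y - (∑ i, y i * pd i (kernel n) x) * T y :=
      hI0.sub hI1
    have hI012 : Integrable fun y => kernel n x * T y - (∑ i, y i * pd i (kernel n) x) * T y +
        1 / 2 * ((∑ i, ∑ j, y i * y j * pd i (pd j (kernel n)) x) * T y) :=
      hI01.add (hI2.const_mul _)
    rw [integral_sub hK hI012, integral_add hI01 (hI2.const_mul _), integral_sub hI0 hI1, integral_const_mul,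
      integral_const_mul, hT0, hlin, hquad, multipole, Finset.mul_sum]
    simp only [neg_mul, Finset.sum_neg_distrib, Finset.mul_sum, mul_assoc]
    ring
  rw [hrem, ← Real.norm_eq_abs, mul_right_comm, ← integral_const_mul]
  refine norm_integral_le_of_norm_le (hTabs.const_mul _) (.of_forall fun y => ?_)
  rcases lt_or_ge S ‖y‖ with hy | hy
  · simp [hS y hy]
  · rw [norm_mul, Real.norm_eq_abs, Real.norm_eq_abs]
    calc _ ≤ C * ‖y‖ ^ 3 * ‖x‖ ^ (-(n : ℝ) - 1) * |T y| :=
          mul_le_mul_of_nonneg_right (hC x y hx (by linarith)) (abs_nonneg _)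
      _ = _ := by ring

/-- The Newtonian potential of a source of total mass zero has gradient `O(‖x‖⁻ⁿ)`. -/
lemma exists_norm_gradient_integral_kernel_le (hn : 3 ≤ n) (hT : Continuous T)
    (hS0 : 0 < S) (hS : ∀ y, S < ‖y‖ → T y = 0) (hT0 : ∫ y, T y = 0) :
    ∃ C : ℝ, 0 ≤ C ∧ ∀ (x v : Space n) (Φ : Space n → ℝ), 4 * S ≤ ‖x‖ →
      (∀ᶠ z in 𝓝 x, Φ z = ∫ y, kernel n (z - y) * T y) → HasGradientAt Φ v x →
      ‖v‖ ≤ C * ‖x‖ ^ (-(n : ℝ)) := by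
  have hc : HasCompactSupport T := hasCompactSupport_of_norm hS
  obtain ⟨C, hC0, hC⟩ := norm_kernelGrad_sub_le n
  refine ⟨C * S * 2 ^ (n : ℝ) * ∫ y, |T y|, by positivity, fun x v Φ hx hΦ hv => ?_⟩
  have hx0 : 0 < ‖x‖ := by linarith
  have hball {z : Space n} (hz : z ∈ ball x (‖x‖ / 2)) : ‖x‖ / 2 ≤ ‖z‖ := by
    rw [mem_ball, dist_eq_norm, norm_sub_rev] at hz
    have := norm_sub_norm_le x z
    linarith
  set D : ℝ := C * S * (2 ^ (n : ℝ) * ‖x‖ ^ (-(n : ℝ))) with hD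
  -- Mass zero permits the subtraction of `kernel n z` under the integral. The gradient of the
  -- difference is the variation of `kernelGrad` over a shift by `y`, which gains one power of
  -- `‖x‖`. The condition `4 * S ≤ ‖x‖` ensures `2 * ‖y‖ ≤ ‖z‖` on the ball.
  have hlip {y : Space n} (hy : ‖y‖ ≤ S) {z : Space n} (hz : z ∈ ball x (‖x‖ / 2)) :
      ‖(kernel n (z - y) - kernel n z) - (kernel n (x - y) - kernel n x)‖ ≤ D * ‖z - x‖ := by
    refine (convex_ball x (‖x‖ / 2)).norm_image_sub_le_of_norm_hasFDerivWithin_le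
      (f := fun z => kernel n (z - y) - kernel n z)
      (f' := fun z => InnerProductSpace.toDual ℝ (Space n) (kernelGrad n (z - y) - kernelGrad n z))
      (fun z hz => ?_) (fun z hz => ?_) (mem_ball_self (by positivity)) hz
    · have hz' := hball hz
      have h1 : z ≠ 0 := norm_pos_iff.1 (by linarith)
      have h2 : z - y ≠ 0 := by
        have := norm_sub_norm_le z y
        exact norm_pos_iff.1 (by linarith)
      rw [map_sub]
      exact (((hasFDerivAt_comp_sub y).2 (hasGradientAt_kernel h2).hasFDerivAt).fun_sub
        (hasGradientAt_kernel h1).hasFDerivAt).hasFDerivWithinAt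
    · have hz' := hball hz
      rw [LinearIsometryEquiv.norm_map, hD]
      refine (hC z y (norm_pos_iff.1 (by linarith)) (by linarith)).trans ?_
      have h3 : ‖z‖ ^ (-(n : ℝ)) ≤ 2 ^ (n : ℝ) * ‖x‖ ^ (-(n : ℝ)) := by
        refine (Real.rpow_le_rpow_of_nonpos (by positivity) hz' (by simp)).trans (le_of_eq ?_)
        rw [Real.div_rpow hx0.le two_pos.le, Real.rpow_neg two_pos.le]
        field_simp
      gcongr
  have hdiff {z : Space n} (hz : z ∈ ball x (‖x‖ / 2)) :
      ‖(∫ y, kernel n (z - y) * T y) - ∫ y, kernel n (x - y) * T y‖ ≤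
        D * (∫ y, |T y|) * ‖z - x‖ := by
    have hK (z : Space n) := integrable_kernel_sub_mul (by omega : 2 ≤ n) hT hc z
    have hI := hT.integrable_of_hasCompactSupport hc (μ := volume)
    have e : (∫ y, kernel n (z - y) * T y) - ∫ y, kernel n (x - y) * T y =
        ∫ y, ((kernel n (z - y) - kernel n z) - (kernel n (x - y) - kernel n x)) * T y := by
      have e1 (y : Space n) :
          ((kernel n (z - y) - kernel n z) - (kernel n (x - y) - kernel n x)) * T y =
          (kernel n (z - y) * T y - kernel n (x - y) * T y) - (kernel n z - kernel n x) * T y := by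
        ring
      simp_rw [e1]
      have hKK : Integrable fun y => kernel n (z - y) * T y - kernel n (x - y) * T y :=
        (hK z).sub (hK x)
      rw [integral_sub hKK (hI.const_mul _), integral_sub (hK z) (hK x),
        integral_const_mul, hT0, mul_zero, sub_zero]
    rw [e, mul_right_comm, ← integral_const_mul]
    refine norm_integral_le_of_norm_le (hI.abs.const_mul _) (.of_forall fun y => ?_)
    rcases lt_or_ge S ‖y‖ with hy | hy
    · simp [hS y hy]
    · rw [norm_mul, Real.norm_eq_abs (T y)]
      exact mul_le_mul_of_nonneg_right (hlip hy hz) (abs_nonneg _)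
  -- A Lipschitz bound at the point `x` bounds the derivative there, so differentiation under the
  -- integral sign is avoided.
  have hmain := hv.hasFDerivAt.le_of_lip' (C := D * ∫ y, |T y|) (by positivity) (by
    filter_upwards [hΦ, ball_mem_nhds x (by positivity : 0 < ‖x‖ / 2)] with z h1 h2
    rw [h1, hΦ.self_of_nhds]
    exact hdiff h2)
  rw [LinearIsometryEquiv.norm_map] at hmain
  refine hmain.trans (le_of_eq ?_)
  rw [hD]
  ring

end Source

end

/-! ### Expansion of exterior harmonic functions without monopole part. -/

section

variable {n : ℕ}

section FarField

variable {Φ : Space n → ℝ} {w : Space n → Space n} {R₀ R : ℝ}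

/-- The multipole expansion of a harmonic function without monopole part in the exterior of a
ball. -/
theorem isBigO_sub_multipole (hn : 3 ≤ n) (hR₀ : 0 < R₀) (hR : R₀ < R)
    (hΦ : ∀ x, R₀ < ‖x‖ → HasGradientAt Φ (w x) x) (hw : ContDiffOn ℝ 1 w {x | R₀ < ‖x‖})
    (hdiv : ∀ x, R₀ < ‖x‖ → divergence w x = 0) (hΦ0 : Tendsto Φ (cobounded (Space n)) (𝓝 0))
    (hw0 : Tendsto (fun x => ‖x‖ * ‖w x‖) (cobounded (Space n)) (𝓝 0))
    (hT0 : ∫ y, cutoffLaplacian R Φ w y = 0) :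
    (fun x => Φ x - multipole
      (fun i => -(1 / greenConst n) * ∫ y, y i * cutoffLaplacian R Φ w y)
      (fun i j => 1 / (2 * greenConst n) * ∫ y, y i * y j * cutoffLaplacian R Φ w y) x)
      =O[cobounded (Space n)] fun x => ‖x‖ ^ (-(n : ℝ) - 1) := by
  have hR0 := hR₀.trans hR
  have hc := greenConst_pos hn
  obtain ⟨C, hC0, hC⟩ := exists_abs_integral_kernel_sub_multipole_le hn
    (continuous_cutoffLaplacian hR₀ hR hΦ hw)
    (fun y hy => cutoffLaplacian_eq_zero hR0 Φ w (Or.inr hy)) hT0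
  refine Asymptotics.IsBigO.of_bound (C / greenConst n) ?_
  filter_upwards [tendsto_norm_cobounded_atTop.eventually_ge_atTop (4 * R)] with x hx
  have h1 := hC x (norm_pos_iff.1 (by linarith)) (by linarith)
  rw [← greenConst_mul_eq_integral hn hR₀ hR hΦ hw hdiv hΦ0 hw0 (by linarith)] at h1
  rw [Real.norm_of_nonneg (by positivity : 0 ≤ ‖x‖ ^ (-(n : ℝ) - 1)), Real.norm_eq_abs, div_mul_eq_mul_div, le_div_iff₀' hc]
  refine le_of_eq_of_le ?_ h1
  rw [← abs_of_pos hc, ← abs_mul, abs_of_pos hc, mul_sub]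
  congr 2
  rw [multipole, multipole, mul_add, Finset.mul_sum, Finset.mul_sum]
  congr 1
  · refine Finset.sum_congr rfl fun i _ => ?_
    field_simp
  · refine Finset.sum_congr rfl fun i _ => ?_
    rw [Finset.mul_sum]
    refine Finset.sum_congr rfl fun j _ => ?_
    field_simp

/-- The gradient of a harmonic function without monopole part in the exterior of a ball is
`O(‖x‖⁻ⁿ)`. -/
theorem exists_norm_le_rpow_neg (hn : 3 ≤ n) (hR₀ : 0 < R₀) (hR : R₀ < R)
    (hΦ : ∀ x, R₀ < ‖x‖ → HasGradientAt Φ (w x) x) (hw : ContDiffOn ℝ 1 w {x | R₀ < ‖x‖})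
    (hdiv : ∀ x, R₀ < ‖x‖ → divergence w x = 0) (hΦ0 : Tendsto Φ (cobounded (Space n)) (𝓝 0))
    (hw0 : Tendsto (fun x => ‖x‖ * ‖w x‖) (cobounded (Space n)) (𝓝 0))
    (hT0 : ∫ y, cutoffLaplacian R Φ w y = 0) :
    ∃ C : ℝ, 0 ≤ C ∧ ∀ x, 8 * R ≤ ‖x‖ → ‖w x‖ ≤ C * ‖x‖ ^ (-(n : ℝ)) := by
  have hR0 := hR₀.trans hR
  have hc := greenConst_pos hn
  obtain ⟨C, hC0, hC⟩ := exists_norm_gradient_integral_kernel_le hn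
    (continuous_cutoffLaplacian hR₀ hR hΦ hw) (by positivity : 0 < 2 * R)
    (fun y hy => cutoffLaplacian_eq_zero hR0 Φ w (Or.inr hy)) hT0
  refine ⟨C / greenConst n, by positivity, fun x hx => ?_⟩
  -- The source lives in the ball of radius `2 * R`, hence the threshold `8 * R = 4 * (2 * R)`.
  have h1 := hC x (greenConst n • w x) (fun z => greenConst n * Φ z) (by linarith) (by
    filter_upwards [continuous_norm.continuousAt.eventually_const_lt
      (by linarith : 2 * R < ‖x‖)] with z hz
    exact greenConst_mul_eq_integral hn hR₀ hR hΦ hw hdiv hΦ0 hw0 hz.le) (by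
    rw [hasGradientAt_iff_hasFDerivAt, map_smul]
    exact (hΦ x (by linarith)).hasFDerivAt.const_mul _)
  rw [norm_smul, Real.norm_of_nonneg hc.le] at h1
  rw [div_mul_eq_mul_div, le_div_iff₀' hc]
  exact h1

/-- Second derivatives commute, so only the symmetric part of the coefficients matters; the kernel
is harmonic, so multiples of the identity matrix drop out. -/
lemma multipole_congr {G₁ : Fin n → ℝ} {A Q : Fin n → Fin n → ℝ} {κ : ℝ}
    (h : ∀ i j, A i j + A j i = Q i j + Q j i + if i = j then κ else 0) {x : Space n}
    (hx : x ≠ 0) : multipole G₁ A x = multipole G₁ Q x := by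
  have hsymm (A : Fin n → Fin n → ℝ) : 2 * ∑ i, ∑ j, A i j * pd i (pd j (kernel n)) x =
      ∑ i, ∑ j, (A i j + A j i) * pd i (pd j (kernel n)) x := by
    simp only [add_mul, Finset.sum_add_distrib]
    rw [two_mul]
    congr 1
    rw [Finset.sum_comm]
    refine Finset.sum_congr rfl fun i _ => Finset.sum_congr rfl fun j _ => ?_
    rw [pd_pd_kernel_comm hx]
  have h2 : 2 * ∑ i, ∑ j, A i j * pd i (pd j (kernel n)) x =
      2 * ∑ i, ∑ j, Q i j * pd i (pd j (kernel n)) x := by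
    rw [hsymm, hsymm]
    simp only [h, add_mul (_ + _), Finset.sum_add_distrib, ite_mul, zero_mul, Finset.sum_ite_eq,
      Finset.mem_univ, if_true, ← Finset.mul_sum, sum_pd_pd_kernel hx, mul_zero, add_zero]
  rw [multipole, multipole]
  linarith

end FarField

/-! ### Moments of the source as boundary integrals. -/

section Boundary

variable {B : Set (Space n)} {ν : Space n → Space n} {Φ : Space n → ℝ} {w : Space n → Space n}
  {R₀ R : ℝ}

/-- The individual derivatives of `F` may blow up at the boundary. In the applications they cancel
in the divergence because `div w = 0`, and what is left extends continuously to `∂B`, which gives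
the integrability. -/
lemma IsAirfoil.gauss_green_of_eqOn (hB : IsAirfoil B)
    (hν : ∀ p ∈ frontier B, IsOuterUnitNormal B p (ν p)) {F : Space n → Space n} {f : Space n → ℝ}
    (hFc : ContinuousOn F (closure Bᶜ)) (hF1 : ContDiffOn ℝ 1 F Bᶜ) (hsupp : HasCompactSupport F)
    (hf : ContinuousOn f (closure Bᶜ)) (hfs : HasCompactSupport f)
    (hdiv : ∀ x ∈ Bᶜ, divergence F x = f x) :
    ∫ x in Bᶜ, f x = -boundaryIntegral B (fun x => ⟪F x, ν x⟫_ℝ) := by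
  have hm : MeasurableSet Bᶜ := hB.isCompact.isClosed.isOpen_compl.measurableSet
  rw [← hB.gauss_green hν hFc hF1 hsupp]
  · exact setIntegral_congr_fun hm fun x hx => (hdiv x hx).symm
  · exact ((integrableOn_of_continuousOn_of_hasCompactSupport isClosed_closure hf hfs).mono_set
      subset_closure).congr_fun (fun x hx => (hdiv x hx).symm) hm

lemma integral_compl_mul_cutoffLaplacian (hR₀ : 0 < R₀) (hBR : B ⊆ ball 0 R₀) (hR : R₀ < R)
    (p : Space n → ℝ) :
    ∫ x in Bᶜ, p x * cutoffLaplacian R Φ w x = ∫ x, p x * cutoffLaplacian R Φ w x := by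
  refine setIntegral_eq_integral_of_forall_compl_eq_zero fun x hx => ?_
  rw [Set.mem_compl_iff, not_not] at hx
  have := mem_ball_zero_iff.1 (hBR hx)
  rw [cutoffLaplacian_eq_zero (hR₀.trans hR) Φ w (Or.inl (by linarith)), mul_zero]

/-- Green's second identity in the exterior of an airfoil. -/
theorem IsAirfoil.integral_mul_cutoffLaplacian (hB : IsAirfoil B)
    (hν : ∀ p ∈ frontier B, IsOuterUnitNormal B p (ν p)) (hR₀ : 0 < R₀) (hBR : B ⊆ ball 0 R₀)
    (hR : R₀ < R) (hΦ : ∀ x ∈ Bᶜ, HasGradientAt Φ (w x) x) (hΦc : ContinuousOn Φ (closure Bᶜ))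
    (hw : ContDiffOn ℝ 1 w Bᶜ) (hwc : ContinuousOn w (closure Bᶜ))
    (hdiv : ∀ x ∈ Bᶜ, divergence w x = 0) {p : Space n → ℝ} {P : Space n → Space n}
    (hp : ∀ x, HasGradientAt p (P x) x) (hP : ContDiff ℝ 1 P) :
    ∫ x, p x * cutoffLaplacian R Φ w x = (∫ x in Bᶜ, cutoff R x * Φ x * divergence P x) -
      boundaryIntegral B (fun x => p x * ⟪w x, ν x⟫_ℝ - Φ x * ⟪P x, ν x⟫_ℝ) := by
  have hR0 := hR₀.trans hR
  have hopen : IsOpen Bᶜ := hB.isCompact.isClosed.isOpen_compl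
  have hp1 : ContDiff ℝ 1 p := contDiff_one_of_hasGradientAt hp hP.continuous
  have hχ1 : ContDiff ℝ 1 (cutoff R : Space n → ℝ) := (contDiff_cutoff R).of_le one_le_two
  have hχ'1 : ContDiff ℝ 1 (∇ (cutoff R) : Space n → Space n) := contDiff_gradient (contDiff_cutoff R)
  have hχ'd := hχ'1.differentiable one_ne_zero
  have hPd := hP.differentiable one_ne_zero
  -- The field `F` below is `p ∇(χΦ) - χΦ ∇p`, sorted so that `w` and `Φ` have smooth coefficients.
  -- Near `B` the cutoff is `1` and `F` reduces to `p w - Φ P`.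
  set G : Space n → Space n := fun x => p x • ∇ (cutoff R) x - cutoff R x • P x with hG
  have hG1 : ContDiff ℝ 1 G := (hp1.smul hχ'1).sub (hχ1.smul hP)
  set F : Space n → Space n := fun x => (p x * cutoff R x) • w x + Φ x • G x with hF
  have hgrad (x : Space n) : HasGradientAt (fun x => p x * cutoff R x)
      (p x • ∇ (cutoff R) x + cutoff R x • P x) x := by
    rw [hasGradientAt_iff_hasFDerivAt]
    simp only [map_add, map_smul]
    exact (hp x).hasFDerivAt.fun_mul (hasGradientAt_cutoff R x).hasFDerivAt
  have hdivG (x : Space n) :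
      divergence G x = p x * divergence (∇ (cutoff R)) x - cutoff R x * divergence P x := by
    rw [hG, divergence_sub ((hp x).differentiableAt.fun_smul (hχ'd x))
      ((hasGradientAt_cutoff R x).differentiableAt.fun_smul (hPd x)),
      divergence_smul (hp x) (hχ'd x), divergence_smul (hasGradientAt_cutoff R x) (hPd x),
      real_inner_comm]
    ring
  have hdivF : ∀ x ∈ Bᶜ, divergence F x =
      p x * cutoffLaplacian R Φ w x - cutoff R x * Φ x * divergence P x := by
    intro x hx
    have hwd : DifferentiableAt ℝ w x :=
      (hw.contDiffAt (hopen.mem_nhds hx)).differentiableAt one_ne_zero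
    rw [hF, divergence_add ((hgrad x).differentiableAt.fun_smul hwd)
      ((hΦ x hx).differentiableAt.fun_smul (hG1.differentiable one_ne_zero x)),
      divergence_smul (hgrad x) hwd, divergence_smul (hΦ x hx) (hG1.differentiable one_ne_zero x),
      hdiv x hx, hdivG, cutoffLaplacian,
      show G x = p x • ∇ (cutoff R) x - cutoff R x • P x from rfl]
    generalize ∇ (cutoff R) x = d
    simp only [inner_add_left, inner_sub_right, real_inner_smul_left, real_inner_smul_right,
      real_inner_comm d (w x), real_inner_comm (P x) (w x)]
    ring
  have hTc : ContinuousOn (fun x => p x * cutoffLaplacian R Φ w x) (closure Bᶜ) := by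
    unfold cutoffLaplacian
    exact hp1.continuous.continuousOn.mul (((hχ'1.continuous.continuousOn.inner hwc).const_mul 2).add
      (hΦc.mul (divergence_continuous hχ'1).continuousOn))
  have hLc : ContinuousOn (fun x => cutoff R x * Φ x * divergence P x) (closure Bᶜ) :=
    (hχ1.continuous.continuousOn.mul hΦc).mul (divergence_continuous hP).continuousOn
  have hTs : HasCompactSupport fun x => p x * cutoffLaplacian R Φ w x :=
    hasCompactSupport_of_norm (R := 2 * R) fun x hx => by
      rw [cutoffLaplacian_eq_zero hR0 Φ w (Or.inr hx), mul_zero]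
  have hLs : HasCompactSupport fun x => cutoff R x * Φ x * divergence P x :=
    hasCompactSupport_of_norm (R := 2 * R) fun x hx => by
      rw [cutoff_eq_zero hR0 hx.le, zero_mul, zero_mul]
  have hFs : HasCompactSupport F := hasCompactSupport_of_norm (R := 2 * R) fun x hx => by
    simp [hF, hG, cutoff_eq_zero hR0 hx.le, gradient_cutoff_eq_zero hR0 (Or.inr hx)]
  have hFc : ContinuousOn F (closure Bᶜ) :=
    ((hp1.continuous.mul hχ1.continuous).continuousOn.smul hwc).add
      (hΦc.smul hG1.continuous.continuousOn)
  have hF1 : ContDiffOn ℝ 1 F Bᶜ :=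
    ((hp1.mul hχ1).contDiffOn.smul hw).add
      ((contDiffOn_one_of_hasGradientAt hopen hΦ hw.continuousOn).smul hG1.contDiffOn)
  have key := hB.gauss_green_of_eqOn hν hFc hF1 hFs (hTc.sub hLc)
    (hasCompactSupport_of_norm (R := 2 * R) fun x hx => by
      simp [cutoffLaplacian_eq_zero hR0 Φ w (Or.inr hx), cutoff_eq_zero hR0 hx.le]) hdivF
  have hTi := (integrableOn_of_continuousOn_of_hasCompactSupport isClosed_closure hTc hTs).mono_set
    (subset_closure (s := Bᶜ))
  have hLi := (integrableOn_of_continuousOn_of_hasCompactSupport isClosed_closure hLc hLs).mono_set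
    (subset_closure (s := Bᶜ))
  have hbd : boundaryIntegral B (fun x => ⟪F x, ν x⟫_ℝ) =
      boundaryIntegral B (fun x => p x * ⟪w x, ν x⟫_ℝ - Φ x * ⟪P x, ν x⟫_ℝ) := by
    refine setIntegral_congr_fun isClosed_frontier.measurableSet fun x hx => ?_
    have hx' : ‖x‖ < R := (mem_ball_zero_iff.1
      (hBR (hB.isCompact.isClosed.frontier_subset hx))).trans hR
    simp only [hF, hG, cutoff_eq_one hR0 hx'.le, gradient_cutoff_eq_zero hR0 (Or.inl hx'), smul_zero,
      zero_sub, one_smul, mul_one, inner_add_left, smul_neg, inner_neg_left, inner_smul_left]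
    simp
    ring
  rw [← integral_compl_mul_cutoffLaplacian hR₀ hBR hR, ← hbd]
  simp only [Pi.sub_apply] at key
  rw [integral_sub hTi hLi] at key
  linarith

/-- The total mass of the source is the flux of `w` through the boundary. -/
theorem IsAirfoil.integral_cutoffLaplacian (hB : IsAirfoil B)
    (hν : ∀ p ∈ frontier B, IsOuterUnitNormal B p (ν p)) (hR₀ : 0 < R₀) (hBR : B ⊆ ball 0 R₀)
    (hR : R₀ < R) (hΦ : ∀ x, R₀ < ‖x‖ → HasGradientAt Φ (w x) x)
    (hw : ContDiffOn ℝ 1 w Bᶜ) (hwc : ContinuousOn w (closure Bᶜ))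
    (hdiv : ∀ x ∈ Bᶜ, divergence w x = 0) :
    ∫ x, cutoffLaplacian R Φ w x = -boundaryIntegral B (fun x => ⟪w x, ν x⟫_ℝ) := by
  have hR0 := hR₀.trans hR
  have hopen : IsOpen Bᶜ := hB.isCompact.isClosed.isOpen_compl
  have hopen' : IsOpen {x : Space n | R₀ < ‖x‖} := isOpen_lt continuous_const continuous_norm
  have hsub : {x : Space n | R₀ < ‖x‖} ⊆ Bᶜ := fun x hx hxB =>
    lt_asymm hx (mem_ball_zero_iff.1 (hBR hxB))
  have hχ1 : ContDiff ℝ 1 (cutoff R : Space n → ℝ) := (contDiff_cutoff R).of_le one_le_two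
  have hχ'1 : ContDiff ℝ 1 (∇ (cutoff R) : Space n → Space n) := contDiff_gradient (contDiff_cutoff R)
  have hχ'd := hχ'1.differentiable one_ne_zero
  -- The source is split as `f + g` with `f = div(χ w)` and `g = div(Φ ∇χ)`. The first part yields
  -- the flux and involves no potential; in the second, `Φ` occurs only in the annulus where `∇χ`
  -- lives, so a potential near infinity is enough.
  set f : Space n → ℝ := fun x => ⟪∇ (cutoff R) x, w x⟫_ℝ with hf
  set g : Space n → ℝ := fun x => f x + Φ x * divergence (∇ (cutoff R)) x with hg
  have hfc : ContinuousOn f (closure Bᶜ) := hχ'1.continuous.continuousOn.inner hwc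
  have hfs : HasCompactSupport f := hasCompactSupport_of_norm (R := 2 * R) fun x hx => by
    simp only [hf, gradient_cutoff_eq_zero hR0 (Or.inr hx), inner_zero_left]
  have h1 : ∫ x in Bᶜ, f x = -boundaryIntegral B (fun x => ⟪w x, ν x⟫_ℝ) := by
    rw [hB.gauss_green_of_eqOn hν (F := fun x => cutoff R x • w x)
      (hχ1.continuous.continuousOn.smul hwc) (hχ1.contDiffOn.smul hw)
      (hasCompactSupport_of_norm (R := 2 * R) fun x hx => by
        rw [cutoff_eq_zero hR0 hx.le, zero_smul]) hfc hfs fun x hx => ?_]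
    · refine congrArg Neg.neg (setIntegral_congr_fun isClosed_frontier.measurableSet fun x hx => ?_)
      have hx' : ‖x‖ < R := (mem_ball_zero_iff.1
        (hBR (hB.isCompact.isClosed.frontier_subset hx))).trans hR
      simp [cutoff_eq_one hR0 hx'.le]
    · rw [divergence_smul (hasGradientAt_cutoff R x)
        ((hw.contDiffAt (hopen.mem_nhds hx)).differentiableAt one_ne_zero), hdiv x hx, mul_zero,
        zero_add]
  set V : Space n → Space n := fun x => Φ x • ∇ (cutoff R) x with hV
  have hVnear {x : Space n} (hx : ‖x‖ ≤ R₀) : V =ᶠ[𝓝 x] fun _ => 0 :=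
    (continuous_norm.continuousAt.eventually_lt_const (hx.trans_lt hR)).mono fun y hy => by
      simp [hV, gradient_cutoff_eq_zero hR0 (Or.inl hy)]
  have hV1 : ContDiff ℝ 1 V := by
    rw [contDiff_iff_contDiffAt]
    intro x
    rcases lt_or_ge R₀ ‖x‖ with hx | hx
    · exact ((contDiffOn_one_of_hasGradientAt hopen' hΦ (hw.continuousOn.mono hsub)).contDiffAt
        (hopen'.mem_nhds hx)).smul hχ'1.contDiffAt
    · exact contDiffAt_const.congr_of_eventuallyEq (hVnear hx)
  have hVs : HasCompactSupport V := hasCompactSupport_of_norm (R := 2 * R) fun x hx => by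
    simp [hV, gradient_cutoff_eq_zero hR0 (Or.inr hx)]
  have hdivV : divergence V = g := by
    ext x
    rcases lt_or_ge R₀ ‖x‖ with hx | hx
    · rw [hV, divergence_smul (hΦ x hx) (hχ'd x), hg, hf, real_inner_comm]
      ring
    · have hx' : ‖x‖ < R := hx.trans_lt hR
      simp only [divergence_congr (hVnear hx), divergence_const, hg, hf, inner_zero_left, mul_zero,
        gradient_cutoff_eq_zero hR0 (Or.inl hx'), divergence_gradient_cutoff_eq_zero hR0 (Or.inl hx'),
        add_zero]
  have h2 : ∫ x in Bᶜ, g x = 0 := by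
    rw [setIntegral_eq_integral_of_forall_compl_eq_zero, ← hdivV,
      integral_divergence_eq_zero hV1 hVs]
    intro x hx
    rw [Set.mem_compl_iff, not_not] at hx
    have hx' : ‖x‖ < R := (mem_ball_zero_iff.1 (hBR hx)).trans hR
    simp only [hg, hf, gradient_cutoff_eq_zero hR0 (Or.inl hx'), inner_zero_left, mul_zero, add_zero,
      divergence_gradient_cutoff_eq_zero hR0 (Or.inl hx')]
  have hgi : Integrable g := by
    rw [← hdivV]
    exact (divergence_continuous hV1).integrable_of_hasCompactSupport
      (hasCompactSupport_divergence hVs)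
  have hfi := (integrableOn_of_continuousOn_of_hasCompactSupport isClosed_closure hfc hfs).mono_set
    (subset_closure (s := Bᶜ))
  have h3 := integral_compl_mul_cutoffLaplacian (Φ := Φ) (w := w) hR₀ hBR hR
    fun _ => 1
  simp only [one_mul] at h3
  rw [← h3, ← h1, ← add_zero (∫ x in Bᶜ, f x), ← h2, ← integral_add hfi hgi.integrableOn]
  refine integral_congr_ae (.of_forall fun x => ?_)
  simp only [cutoffLaplacian, hg, hf]
  ring

end Boundary

end

/-! ### Uniqueness by the energy method. -/

section

variable {n : ℕ}

section Uniqueness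

variable {B : Set (Space n)} {ν : Space n → Space n} {Φ : Space n → ℝ} {v : Space n → Space n}

/-- A potential flow without circulation that is at rest at infinity vanishes. -/
theorem IsAirfoil.eq_zero_of_slip (hB : IsAirfoil B)
    (hν : ∀ p ∈ frontier B, IsOuterUnitNormal B p (ν p))
    (hΦ : ∀ x ∈ Bᶜ, HasGradientAt Φ (v x) x) (hΦc : ContinuousOn Φ (closure Bᶜ))
    (hv : ContDiffOn ℝ 1 v Bᶜ) (hvc : ContinuousOn v (closure Bᶜ))
    (hdiv : ∀ x ∈ Bᶜ, divergence v x = 0) (hslip : ∀ x ∈ frontier B, ⟪v x, ν x⟫_ℝ = 0)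
    {M C R₁ : ℝ} (hM : ∀ x ∈ Bᶜ, R₁ ≤ ‖x‖ → |Φ x| ≤ M)
    (hC : ∀ x ∈ Bᶜ, R₁ ≤ ‖x‖ → ‖v x‖ ≤ C * ‖x‖ ^ (-(n : ℝ))) :
    ∀ x ∈ Bᶜ, v x = 0 := by
  have hopen : IsOpen Bᶜ := hB.isCompact.isClosed.isOpen_compl
  have hm : MeasurableSet Bᶜ := hopen.measurableSet
  obtain ⟨D, hD0, hD⟩ := exists_bound_cutoff n
  set L := |M| * D * |C| * volume.real (ball (0 : Space n) 3) with hL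
  set f : ℝ → Space n → ℝ := fun R x => cutoff R x * ‖v x‖ ^ 2 with hf
  set g : ℝ → Space n → ℝ := fun R x => Φ x * ⟪∇ (cutoff R) x, v x⟫_ℝ with hg
  have hfc (R : ℝ) : ContinuousOn (f R) (closure Bᶜ) :=
    (contDiff_cutoff R).continuous.continuousOn.mul (hvc.norm.pow 2)
  have hgc (R : ℝ) : ContinuousOn (g R) (closure Bᶜ) :=
    hΦc.mul ((contDiff_gradient (contDiff_cutoff R)).continuous.continuousOn.inner hvc)
  have hfs {R : ℝ} (hR : 0 < R) : HasCompactSupport (f R) :=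
    hasCompactSupport_of_norm (R := 2 * R) fun x hx => by
      simp [hf, cutoff_eq_zero hR hx.le]
  have hgs {R : ℝ} (hR : 0 < R) : HasCompactSupport (g R) :=
    hasCompactSupport_of_norm (R := 2 * R) fun x hx => by
      simp only [hg, gradient_cutoff_eq_zero hR (Or.inr hx), inner_zero_left, mul_zero]
  have hfi {R : ℝ} (hR : 0 < R) : IntegrableOn (f R) Bᶜ :=
    (integrableOn_of_continuousOn_of_hasCompactSupport isClosed_closure (hfc R) (hfs hR)).mono_set
      subset_closure
  have hgi {R : ℝ} (hR : 0 < R) : IntegrableOn (g R) Bᶜ :=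
    (integrableOn_of_continuousOn_of_hasCompactSupport isClosed_closure (hgc R) (hgs hR)).mono_set
      subset_closure
  -- Here `div(χ Φ v) = χ |v|² + Φ ∇χ·v`, and the slip condition removes the boundary term.
  have henergy {R : ℝ} (hR : 0 < R) : ∫ x in Bᶜ, f R x = -∫ x in Bᶜ, g R x := by
    have hΦ1 := contDiffOn_one_of_hasGradientAt hopen hΦ hv.continuousOn
    have hχ1 : ContDiff ℝ 1 (cutoff R : Space n → ℝ) := (contDiff_cutoff R).of_le one_le_two
    have h := hB.gauss_green_of_eqOn hν (F := fun x => (cutoff R x * Φ x) • v x)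
      (f := fun x => f R x + g R x)
      ((hχ1.continuous.continuousOn.mul hΦc).smul hvc) ((hχ1.contDiffOn.mul hΦ1).smul hv)
      (hasCompactSupport_of_norm (R := 2 * R) fun x hx => by simp [cutoff_eq_zero hR hx.le])
      ((hfc R).add (hgc R)) ((hfs hR).add (hgs hR)) fun x hx => by
        have hgrad : HasGradientAt (fun x => cutoff R x * Φ x)
            (cutoff R x • v x + Φ x • ∇ (cutoff R) x) x := by
          rw [hasGradientAt_iff_hasFDerivAt]
          simp only [map_add, map_smul]
          exact (hasGradientAt_cutoff R x).hasFDerivAt.fun_mul (hΦ x hx).hasFDerivAt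
        rw [divergence_smul hgrad ((hv.contDiffAt (hopen.mem_nhds hx)).differentiableAt one_ne_zero),
          hdiv x hx, mul_zero, zero_add, inner_add_left, real_inner_smul_left, real_inner_smul_left,
          real_inner_self_eq_norm_sq]
    have h0 : boundaryIntegral B (fun x => ⟪(cutoff R x * Φ x) • v x, ν x⟫_ℝ) = 0 :=
      setIntegral_eq_zero_of_forall_eq_zero fun x hx => by
        rw [real_inner_smul_left, hslip x hx, mul_zero]
    rw [h0, integral_add (hfi hR) (hgi hR)] at h
    linarith
  -- With `Φ` bounded, `|∇χ| ≤ D / R` and `|v| ≤ |C| R^{-n}` on the annulus, a volume of order `R^n`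
  -- leaves a factor `1 / R`.
  have hbound {R : ℝ} (hR : 0 < R) (hR₁ : R₁ ≤ R) : ∫ x in Bᶜ, f R x ≤ L * R⁻¹ := by
    rw [henergy hR]
    refine (neg_le_abs _).trans ?_
    have hb := norm_setIntegral_le_of_norm_le_const (μ := volume)
      (s := ball (0 : Space n) (R * 3) ∩ Bᶜ) (f := g R)
      (C := |M| * (D * R⁻¹ * (|C| * R ^ (-(n : ℝ)))))
      (lt_of_le_of_lt (measure_mono Set.inter_subset_left) measure_ball_lt_top) (fun x hx => by
        rcases lt_or_ge ‖x‖ R with hxR | hxR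
        · simp only [hg, gradient_cutoff_eq_zero hR (Or.inl hxR), inner_zero_left, mul_zero,
            norm_zero]
          positivity
        · rw [hg, norm_mul, Real.norm_eq_abs, Real.norm_eq_abs]
          refine mul_le_mul ((hM x hx.2 (hR₁.trans hxR)).trans (le_abs_self M)) ?_ (abs_nonneg _)
            (abs_nonneg _)
          refine (abs_real_inner_le_norm _ _).trans ?_
          refine mul_le_mul (hD R hR x).1 ((hC x hx.2 (hR₁.trans hxR)).trans ?_) (norm_nonneg _)
            (by positivity)
          exact mul_le_mul (le_abs_self C) (Real.rpow_le_rpow_of_nonpos hR hxR (by simp))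
            (by positivity) (abs_nonneg _))
    have hsupp : ∫ x in ball (0 : Space n) (R * 3) ∩ Bᶜ, g R x = ∫ x in Bᶜ, g R x := by
      refine (setIntegral_eq_of_subset_of_forall_sdiff_eq_zero hm Set.inter_subset_right ?_).symm
      intro x hx
      have hx' : R * 3 ≤ ‖x‖ := by
        by_contra h
        exact hx.2 ⟨mem_ball_zero_iff.2 (not_le.1 h), hx.1⟩
      simp only [hg, gradient_cutoff_eq_zero hR (x := x) (Or.inr (by linarith)), inner_zero_left,
        mul_zero]
    rw [hsupp] at hb
    refine hb.trans ?_
    calc _ ≤ |M| * (D * R⁻¹ * (|C| * R ^ (-(n : ℝ)))) * volume.real (ball (0 : Space n) (R * 3)) := by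
          gcongr
          · exact measure_ball_lt_top.ne
          · exact Set.inter_subset_left
      _ = L * R⁻¹ := by
          rw [volume_real_ball_mul hR, Real.rpow_neg hR.le, hL]
          field_simp
  intro x₀ hx₀
  set S := ‖x₀‖ + 1
  have hS : 0 < S := by positivity
  set U := Bᶜ ∩ ball (0 : Space n) S with hU
  have hUo : IsOpen U := hopen.inter isOpen_ball
  have hfU {R : ℝ} (hR : 0 < R) (hRS : S ≤ R) : Set.EqOn (f R) (fun x => ‖v x‖ ^ 2) U :=
    fun x hx => by
      have : ‖x‖ < S := mem_ball_zero_iff.1 hx.2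
      simp [hf, cutoff_eq_one hR (x := x) (by linarith)]
  have hle : ∫ x in U, ‖v x‖ ^ 2 ≤ 0 := by
    have hlim : Tendsto (fun R : ℝ => L * R⁻¹) atTop (𝓝 0) := by
      simpa using tendsto_inv_atTop_zero.const_mul L
    refine ge_of_tendsto hlim ?_
    filter_upwards [eventually_ge_atTop (max S R₁)] with R hR
    rw [max_le_iff] at hR
    have hR0 := hS.trans_le hR.1
    rw [← setIntegral_congr_fun hUo.measurableSet (hfU hR0 hR.1)]
    refine (setIntegral_mono_set (hfi hR0) ?_ (.of_forall Set.inter_subset_left)).trans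
      (hbound hR0 hR.2)
    exact .of_forall fun x => mul_nonneg (cutoff_nonneg _ _) (sq_nonneg _)
  have hUi : IntegrableOn (fun x => ‖v x‖ ^ 2) U :=
    ((hfi hS).mono_set Set.inter_subset_left).congr_fun (hfU hS le_rfl) hUo.measurableSet
  have hzero := (setIntegral_eq_zero_iff_of_nonneg_ae (.of_forall fun x => sq_nonneg ‖v x‖) hUi).1
    (le_antisymm hle (integral_nonneg fun x => sq_nonneg _))
  have heq := Measure.eqOn_open_of_ae_eq hzero hUo
    ((hv.continuousOn.mono Set.inter_subset_left).norm.pow 2) continuousOn_const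
    (⟨hx₀, by simp [S]⟩ : x₀ ∈ U)
  simpa using heq

end Uniqueness

end

/-! ### Airfoil flows. -/

section

variable {n : ℕ}

/-- In polar form the set is an image of `(R, ∞)` times the unit sphere, which is connected from
dimension two on. Consequently two potentials near infinity differ by one constant. -/
lemma isPreconnected_norm_gt (hn : 2 ≤ n) {R : ℝ} (hR : 0 ≤ R) :
    IsPreconnected {x : Space n | R < ‖x‖} := by
  have hrank : 1 < Module.rank ℝ (Space n) := by
    rw [← Module.finrank_eq_rank, finrank_euclideanSpace_fin]
    exact_mod_cast hn
  have h := (isPreconnected_Ioi (a := R)).prod (isPreconnected_sphere hrank 0 1)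
  convert! h.image (fun p : ℝ × Space n => p.1 • p.2) (by fun_prop) using 1
  ext x
  constructor
  · intro hx
    have hx0 : 0 < ‖x‖ := hR.trans_lt hx
    exact ⟨(‖x‖, ‖x‖⁻¹ • x), ⟨hx, by simp [norm_smul, hx0.ne']⟩, smul_inv_smul₀ hx0.ne' x⟩
  · rintro ⟨⟨t, y⟩, ⟨ht, hy⟩, rfl⟩
    have ht' : R < t := ht
    have hy' : ‖y‖ = 1 := by simpa using hy
    simpa [norm_smul, hy', abs_of_pos (hR.trans_lt ht')] using ht'

lemma hasGradientAt_apply (i : Fin n) (x : Space n) :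
    HasGradientAt (fun y : Space n => y i) (EuclideanSpace.single i 1) x := by
  rw [hasGradientAt_iff_hasFDerivAt]
  convert! (EuclideanSpace.proj i : Space n →L[ℝ] ℝ).hasFDerivAt using 1
  ext v
  simp [EuclideanSpace.inner_single_left]

lemma hasGradientAt_apply_mul_apply (i j : Fin n) (x : Space n) :
    HasGradientAt (fun y : Space n => y i * y j)
      (x i • EuclideanSpace.single j 1 + x j • EuclideanSpace.single i 1) x := by
  rw [hasGradientAt_iff_hasFDerivAt]
  simp only [map_add, map_smul]
  exact (hasGradientAt_apply i x).hasFDerivAt.fun_mul (hasGradientAt_apply j x).hasFDerivAt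

lemma divergence_gradient_apply_mul_apply (i j : Fin n) (x : Space n) :
    divergence (fun y : Space n =>
      y i • EuclideanSpace.single j (1 : ℝ) + y j • EuclideanSpace.single i (1 : ℝ)) x =
      if i = j then 2 else 0 := by
  have h (i j : Fin n) : divergence (fun y : Space n => y i • EuclideanSpace.single j (1 : ℝ)) x =
      if i = j then 1 else 0 := by
    rw [divergence_smul (hasGradientAt_apply i x) (differentiableAt_const _), divergence_const]
    simp [EuclideanSpace.inner_single_left]
  rw [divergence_add ((hasGradientAt_apply i x).differentiableAt.fun_smul (differentiableAt_const _))
    ((hasGradientAt_apply j x).differentiableAt.fun_smul (differentiableAt_const _)), h, h]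
  rcases eq_or_ne i j with rfl | hij
  · norm_num
  · simp [hij, hij.symm]

lemma hasGradientAt_inner_left (U x : Space n) : HasGradientAt (fun y => ⟪U, y⟫_ℝ) U x := by
  rw [hasGradientAt_iff_hasFDerivAt]
  exact (innerSL ℝ U).hasFDerivAt

section Flow

variable {B : Set (Space n)} {ν : Space n → Space n} {U : Space n} {u : Space n → Space n}

lemma IsIncompressibleAirfoilFlow.divergence_sub_const (h : IsIncompressibleAirfoilFlow B ν U u)
    (hB : IsAirfoil B) {x : Space n} (hx : x ∈ Bᶜ) : divergence (fun y => u y - U) x = 0 := by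
  rw [divergence_sub ((h.contDiffOn.contDiffAt
    (hB.isCompact.isClosed.isOpen_compl.mem_nhds hx)).differentiableAt one_ne_zero)
    (differentiableAt_const _), divergence_const, sub_zero]
  exact h.div_eq_zero x hx

/-- The perturbation velocity has a potential near infinity that vanishes at infinity. -/
theorem IsIncompressibleAirfoilFlow.exists_far_potential
    (h : IsIncompressibleAirfoilFlow B ν U u) (hB : IsAirfoil B) (hd : HasInitialDecay B U u) :
    ∃ (R₀ : ℝ) (Ψ : Space n → ℝ), 0 < R₀ ∧ B ⊆ ball 0 R₀ ∧
      (∀ x, R₀ < ‖x‖ → HasGradientAt Ψ (u x - U) x) ∧ Tendsto Ψ (cobounded (Space n)) (𝓝 0) ∧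
      Tendsto (fun x => ‖x‖ * ‖u x - U‖) (cobounded (Space n)) (𝓝 0) := by
  obtain ⟨σ, C, R, hσ, hR, hC⟩ := hd
  obtain ⟨r, hr0, hr⟩ := hB.isCompact.isBounded.subset_ball_lt 0 (0 : Space n)
  set R₀ := max R r with hR₀
  have hBR : B ⊆ ball 0 R₀ := hr.trans (ball_subset_ball (le_max_right _ _))
  have hR0 : 0 < R₀ := hR.trans_le (le_max_left _ _)
  have hsub : {x : Space n | R₀ < ‖x‖} ⊆ Bᶜ := fun x hx hxB =>
    lt_asymm hx (mem_ball_zero_iff.1 (hBR hxB))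
  have hdecay (x : Space n) (hx : R₀ < ‖x‖) : ‖u x - U‖ ≤ C * ‖x‖ ^ (-1 - σ) :=
    hC x (hsub hx) ((le_max_left _ _).trans hx.le)
  obtain ⟨Ψ, hΨ, hΨ0⟩ := exists_exterior_potential (w := fun x => u x - U) hR0 hσ
    ((h.contDiffOn.sub contDiffOn_const).mono hsub) (fun x hx i j => by
      have := h.curl_eq_zero x (hsub hx) i j
      simpa [pd, fderiv_sub_const] using this) hdecay
  refine ⟨R₀, Ψ, hR0, hBR, hΨ, hΨ0, ?_⟩
  have hlim : Tendsto (fun x : Space n => C * ‖x‖ ^ (-σ)) (cobounded (Space n)) (𝓝 0) := by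
    simpa using ((tendsto_rpow_neg_atTop hσ).comp tendsto_norm_cobounded_atTop).const_mul C
  refine squeeze_zero' (.of_forall fun x => by positivity) ?_ hlim
  filter_upwards [tendsto_norm_cobounded_atTop.eventually_gt_atTop R₀] with x hx
  have hx0 : 0 < ‖x‖ := hR0.trans hx
  calc ‖x‖ * ‖u x - U‖ ≤ ‖x‖ * (C * ‖x‖ ^ (-1 - σ)) := by
        gcongr
        exact hdecay x hx
    _ = C * (‖x‖ ^ (-1 - σ) * ‖x‖) := by ring
    _ = _ := by rw [← Real.rpow_add_one hx0.ne', show -1 - σ + 1 = -σ by ring]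

/-- The flux of the perturbation velocity through the boundary vanishes. -/
lemma IsIncompressibleAirfoilFlow.boundaryIntegral_sub_const
    (h : IsIncompressibleAirfoilFlow B ν U u) (hB : IsAirfoil B)
    (hν : ∀ p ∈ frontier B, IsOuterUnitNormal B p (ν p)) :
    boundaryIntegral B (fun x => ⟪u x - U, ν x⟫_ℝ) = 0 := by
  -- By the slip condition only the flux of the constant field remains, and its divergence inside
  -- `B` is zero.
  have h1 : boundaryIntegral B (fun x => ⟪u x - U, ν x⟫_ℝ) =
      boundaryIntegral B (fun x => -⟪U, ν x⟫_ℝ) :=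
    setIntegral_congr_fun isClosed_frontier.measurableSet fun x hx => by
      simp only [inner_sub_left, h.slip x hx, zero_sub]
  have h2 := hB.boundaryIntegral_inner_normal hν (contDiff_const (c := U))
  simp only [divergence_const, integral_zero] at h2
  rw [h1, boundaryIntegral, integral_neg]
  simpa [boundaryIntegral] using h2

lemma IsVelocityPotential.hasGradientAt_perturbation {φ : Space n → ℝ}
    (hφ : IsVelocityPotential B u φ) (U : Space n) (c : ℝ) {x : Space n} (hx : x ∈ Bᶜ) :
    HasGradientAt (fun x => φ x - ⟪U, x⟫_ℝ + c) (u x - U) x := by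
  rw [hasGradientAt_iff_hasFDerivAt, map_sub]
  exact ((hφ.hasGradientAt x hx).hasFDerivAt.fun_sub
    (hasGradientAt_inner_left U x).hasFDerivAt).add_const c

/-- The potential of an airfoil flow can be normalized at infinity. -/
lemma IsVelocityPotential.exists_tendsto {φ : Space n → ℝ} (hφ : IsVelocityPotential B u φ)
    (hn : 2 ≤ n) (h : IsIncompressibleAirfoilFlow B ν U u) (hB : IsAirfoil B)
    (hd : HasInitialDecay B U u) :
    ∃ c : ℝ, Tendsto (fun x => φ x - ⟪U, x⟫_ℝ + c) (cobounded (Space n)) (𝓝 0) := by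
  obtain ⟨R₀, Ψ, hR₀, hBR, hΨ, hΨ0, -⟩ := h.exists_far_potential hB hd
  have hsub {x : Space n} (hx : R₀ < ‖x‖) : x ∈ Bᶜ := fun hxB =>
    lt_asymm hx (mem_ball_zero_iff.1 (hBR hxB))
  have hgrad (x : Space n) (hx : R₀ < ‖x‖) :
      HasFDerivAt (fun x => Ψ x - (φ x - ⟪U, x⟫_ℝ + 0)) (0 : Space n →L[ℝ] ℝ) x := by
    refine ((hΨ x hx).hasFDerivAt.fun_sub
      (hφ.hasGradientAt_perturbation U 0 (hsub hx)).hasFDerivAt).congr_fderiv ?_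
    exact sub_self _
  obtain ⟨c, hc⟩ := (isOpen_lt continuous_const continuous_norm).exists_is_const_of_fderiv_eq_zero
    (isPreconnected_norm_gt hn hR₀.le)
    (fun x hx => (hgrad x hx).differentiableAt.differentiableWithinAt)
    (fun x hx => (hgrad x hx).fderiv)
  refine ⟨c, hΨ0.congr' ?_⟩
  filter_upwards [tendsto_norm_cobounded_atTop.eventually_gt_atTop R₀] with x hx
  linarith [hc x hx]

/-- The slip condition turns the boundary terms into integrals of the total potential. -/
lemma IsIncompressibleAirfoilFlow.boundaryIntegral_perturbation
    (h : IsIncompressibleAirfoilFlow B ν U u) (hB : IsAirfoil B)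
    (hν : ∀ p ∈ frontier B, IsOuterUnitNormal B p (ν p)) {φ : Space n → ℝ}
    (hφ : IsVelocityPotential B u φ) (c : ℝ) {p : Space n → ℝ} {P : Space n → Space n}
    (hp : ∀ x, HasGradientAt p (P x) x) (hP : ContDiff ℝ 1 P) :
    boundaryIntegral B (fun x => p x * ⟪u x - U, ν x⟫_ℝ -
      (φ x - ⟪U, x⟫_ℝ + c) * ⟪P x, ν x⟫_ℝ) =
      -boundaryIntegral B (fun x => φ x * ⟪P x, ν x⟫_ℝ) -
        ∫ x in B, (c - ⟪U, x⟫_ℝ) * divergence P x := by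
  have hp1 : ContDiff ℝ 1 p := contDiff_one_of_hasGradientAt hp hP.continuous
  have hl (x : Space n) : HasGradientAt (fun x => c - ⟪U, x⟫_ℝ) (-U) x := by
    rw [hasGradientAt_iff_hasFDerivAt, map_neg]
    exact (hasGradientAt_inner_left U x).hasFDerivAt.const_sub c
  have hl1 : ContDiff ℝ 1 fun x : Space n => c - ⟪U, x⟫_ℝ :=
    contDiff_const.sub (contDiff_const.inner ℝ contDiff_id)
  -- After the slip condition, everything except `-φ ⟪P, ν⟫` is the flux of `-G`. This field is
  -- defined on `B` too, and in its divergence the two products of `P` and `U` cancel.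
  set G : Space n → Space n := fun x => p x • U + (c - ⟪U, x⟫_ℝ) • P x with hG
  have hG1 : ContDiff ℝ 1 G := (hp1.smul contDiff_const).add (hl1.smul hP)
  have hdivG (x : Space n) : divergence G x = (c - ⟪U, x⟫_ℝ) * divergence P x := by
    have hPd := hP.differentiable one_ne_zero x
    rw [hG, divergence_add ((hp x).differentiableAt.fun_smul (differentiableAt_const _))
      ((hl x).differentiableAt.fun_smul hPd), divergence_smul (hp x) (differentiableAt_const _),
      divergence_smul (hl x) hPd, divergence_const, inner_neg_left, real_inner_comm]
    ring
  have hφc : ContinuousOn φ (frontier B) := hφ.continuousOn.mono (frontier_subset_closure_compl B)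
  have hνc := hB.continuousOn_normal hν
  have hi1 : IntegrableOn (fun x => φ x * ⟪P x, ν x⟫_ℝ) (frontier B) μHE[n - 1] :=
    hB.integrableOn_frontier (hφc.mul (hP.continuous.continuousOn.inner hνc))
  have hi2 : IntegrableOn (fun x => ⟪G x, ν x⟫_ℝ) (frontier B) μHE[n - 1] :=
    hB.integrableOn_frontier (hG1.continuous.continuousOn.inner hνc)
  have h2 := hB.boundaryIntegral_inner_normal hν hG1
  simp only [hdivG] at h2
  rw [← h2, boundaryIntegral, boundaryIntegral, boundaryIntegral, ← integral_neg,
    ← integral_sub (f := fun x => -(φ x * ⟪P x, ν x⟫_ℝ)) hi1.neg hi2]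
  refine setIntegral_congr_fun isClosed_frontier.measurableSet fun x hx => ?_
  simp only [hG, inner_sub_left, inner_add_left, real_inner_smul_left, h.slip x hx]
  ring

/-- The expansion of the potential of an airfoil flow at infinity. -/
theorem IsVelocityPotential.isBigO_sub_multipole {φ : Space n → ℝ}
    (hφ : IsVelocityPotential B u φ) (hn : 3 ≤ n) (h : IsIncompressibleAirfoilFlow B ν U u)
    (hB : IsAirfoil B) (hν : ∀ p ∈ frontier B, IsOuterUnitNormal B p (ν p))
    (hd : HasInitialDecay B U u) {c : ℝ}
    (hc : Tendsto (fun x => φ x - ⟪U, x⟫_ℝ + c) (cobounded (Space n)) (𝓝 0)) :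
    ((fun x => φ x - ⟪U, x⟫_ℝ + c - multipole
      (dipoleCoeff B ν (fun x => u x - U) fun x => φ x - ⟪U, x⟫_ℝ + c)
      (quadrupoleCoeff B ν (fun x => u x - U) fun x => φ x - ⟪U, x⟫_ℝ + c) x)
      =O[cobounded (Space n)] fun x => ‖x‖ ^ (-(n : ℝ) - 1)) ∧
    ((fun x => φ x - ⟪U, x⟫_ℝ + c - multipole
      (fun i => -(1 / greenConst n) * boundaryIntegral B (fun z => φ z * ν z i))
      (fun i j => (1 / greenConst n) * boundaryIntegral B (fun z => φ z * z i * ν z j)) x)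
      =O[cobounded (Space n)] fun x => ‖x‖ ^ (-(n : ℝ) - 1)) := by
  obtain ⟨R₀, -, hR₀, hBR, hΨ, -, hw0⟩ := h.exists_far_potential hB hd
  set w : Space n → Space n := fun x => u x - U with hw
  set Φ : Space n → ℝ := fun x => φ x - ⟪U, x⟫_ℝ + c with hΦ
  set R := R₀ + 1
  have hR : R₀ < R := lt_add_one _
  have hsub {x : Space n} (hx : R₀ < ‖x‖) : x ∈ Bᶜ := fun hxB =>
    lt_asymm hx (mem_ball_zero_iff.1 (hBR hxB))
  have hgrad (x : Space n) (hx : x ∈ Bᶜ) : HasGradientAt Φ (w x) x :=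
    hφ.hasGradientAt_perturbation U c hx
  have hwC : ContDiffOn ℝ 1 w Bᶜ := h.contDiffOn.sub contDiffOn_const
  have hwc : ContinuousOn w (closure Bᶜ) := h.continuousOn.sub continuousOn_const
  have hΦc : ContinuousOn Φ (closure Bᶜ) :=
    (hφ.continuousOn.sub (by fun_prop)).add continuousOn_const
  have hdiv (x : Space n) (hx : x ∈ Bᶜ) : divergence w x = 0 := h.divergence_sub_const hB hx
  have hfc := frontier_subset_closure_compl B
  have hνc := hB.continuousOn_normal hν
  have hνi (i : Fin n) : ContinuousOn (fun x => ν x i) (frontier B) :=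
    (EuclideanSpace.proj i : Space n →L[ℝ] ℝ).continuous.comp_continuousOn hνc
  have hmain := AirfoilFlow.isBigO_sub_multipole hn hR₀ hR (fun x hx => hgrad x (hsub hx))
    (hwC.mono fun x hx => hsub hx) (fun x hx => hdiv x (hsub hx)) hc hw0
    ((hB.integral_cutoffLaplacian hν hR₀ hBR hR (fun x hx => hgrad x (hsub hx)) hwC hwc hdiv).trans
      (by rw [h.boundaryIntegral_sub_const hB hν, neg_zero]))
  have hgreen {p : Space n → ℝ} {P : Space n → Space n} (hp : ∀ x, HasGradientAt p (P x) x)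
      (hP : ContDiff ℝ 1 P) := hB.integral_mul_cutoffLaplacian hν hR₀ hBR hR hgrad hΦc hwC hwc hdiv
        hp hP
  have hbd {p : Space n → ℝ} {P : Space n → Space n} (hp : ∀ x, HasGradientAt p (P x) x)
      (hP : ContDiff ℝ 1 P) : boundaryIntegral B
        (fun x => p x * ⟪w x, ν x⟫_ℝ - Φ x * ⟪P x, ν x⟫_ℝ) = _ :=
    h.boundaryIntegral_perturbation hB hν hφ c hp hP
  -- The coordinate functions are harmonic, so Green's identity leaves no volume term.
  have hlin (i : Fin n) : ∫ x, x i * cutoffLaplacian R Φ w x =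
      -boundaryIntegral B (fun x => x i * ⟪w x, ν x⟫_ℝ - ν x i * Φ x) := by
    have h1 := hgreen (hasGradientAt_apply i) contDiff_const
    simp only [divergence_const, mul_zero, integral_zero, zero_sub,
      EuclideanSpace.inner_single_left, map_one, one_mul, mul_comm (Φ _)] at h1
    exact h1
  have hlin' (i : Fin n) : ∫ x, x i * cutoffLaplacian R Φ w x =
      boundaryIntegral B (fun x => φ x * ν x i) := by
    have h1 := hgreen (hasGradientAt_apply i) contDiff_const
    rw [hbd (hasGradientAt_apply i) contDiff_const] at h1
    simpa [divergence_const, EuclideanSpace.inner_single_left] using h1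
  have hPC (i j : Fin n) : ContDiff ℝ 1 fun x : Space n =>
      x i • EuclideanSpace.single j (1 : ℝ) + x j • EuclideanSpace.single i (1 : ℝ) := by fun_prop
  -- The Laplacian of `x_i x_j` is `2 δ_ij`. The volume terms `κ` and `κ'` therefore occur on the
  -- diagonal only, with the same value for all `i`, as `multipole_congr` requires.
  set κ := ∫ x in Bᶜ, cutoff R x * Φ x * 2
  set κ' := ∫ x in B, (c - ⟪U, x⟫_ℝ) * 2
  have hquad (i j : Fin n) : ∫ x, x i * x j * cutoffLaplacian R Φ w x =
      (if i = j then κ else 0) + (boundaryIntegral B (fun x => -(1 / 2) * x i * x j * ⟪w x, ν x⟫_ℝ +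
        x i * ν x j * Φ x) + boundaryIntegral B (fun x => -(1 / 2) * x j * x i * ⟪w x, ν x⟫_ℝ +
        x j * ν x i * Φ x)) := by
    have hint (i j : Fin n) : IntegrableOn (fun x => -(1 / 2) * x i * x j * ⟪w x, ν x⟫_ℝ +
        x i * ν x j * Φ x) (frontier B) μHE[n - 1] :=
      hB.integrableOn_frontier (((by fun_prop : Continuous fun x : Space n =>
        -(1 / 2) * x i * x j).continuousOn.mul ((hwc.mono hfc).inner hνc)).add
        (((by fun_prop : Continuous fun x : Space n => x i).continuousOn.mul (hνi j)).mul
          (hΦc.mono hfc)))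
    rw [hgreen (hasGradientAt_apply_mul_apply i j) (hPC i j), sub_eq_add_neg]
    congr 1
    · simp only [divergence_gradient_apply_mul_apply]
      split_ifs
      · rfl
      · simp
    · rw [boundaryIntegral, boundaryIntegral, boundaryIntegral, ← integral_add (hint i j) (hint j i),
        ← integral_neg]
      refine integral_congr_ae (.of_forall fun x => ?_)
      simp only [inner_add_left, real_inner_smul_left, EuclideanSpace.inner_single_left, map_one]
      ring
  have hquad' (i j : Fin n) : ∫ x, x i * x j * cutoffLaplacian R Φ w x =
      (if i = j then κ + κ' else 0) + (boundaryIntegral B (fun x => φ x * x i * ν x j) +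
        boundaryIntegral B (fun x => φ x * x j * ν x i)) := by
    have hint (i j : Fin n) : IntegrableOn (fun x => φ x * x i * ν x j) (frontier B) μHE[n - 1] :=
      hB.integrableOn_frontier (((hφ.continuousOn.mono hfc).mul
        (by fun_prop : Continuous fun x : Space n => x i).continuousOn).mul (hνi j))
    have e : boundaryIntegral B (fun x => φ x * ⟪x i • EuclideanSpace.single j (1 : ℝ) +
        x j • EuclideanSpace.single i (1 : ℝ), ν x⟫_ℝ) =
        boundaryIntegral B (fun x => φ x * x i * ν x j) +
          boundaryIntegral B (fun x => φ x * x j * ν x i) := by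
      rw [boundaryIntegral, boundaryIntegral, boundaryIntegral, ← integral_add (hint i j) (hint j i)]
      refine integral_congr_ae (.of_forall fun x => ?_)
      simp only [inner_add_left, real_inner_smul_left, EuclideanSpace.inner_single_left, map_one]
      ring
    rw [hgreen (hasGradientAt_apply_mul_apply i j) (hPC i j),
      hbd (hasGradientAt_apply_mul_apply i j) (hPC i j), e]
    simp only [divergence_gradient_apply_mul_apply]
    split_ifs
    · ring
    · simp
  have hne : ∀ᶠ x : Space n in cobounded (Space n), x ≠ 0 :=
    (tendsto_norm_cobounded_atTop.eventually_gt_atTop 0).mono fun x hx => norm_pos_iff.1 hx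
  have hcpos := greenConst_pos hn
  constructor
  · refine hmain.congr' (hne.mono fun x hx => ?_) .rfl
    refine congrArg (Φ x - ·) ?_
    rw [multipole_congr (Q := quadrupoleCoeff B ν w Φ) (κ := κ / greenConst n) (fun i j => ?_) hx]
    · congr 1
      ext i
      rw [hlin, dipoleCoeff]
      ring
    · simp only [hquad, quadrupoleCoeff, @eq_comm _ j i]
      split_ifs <;> field_simp <;> ring
  · refine hmain.congr' (hne.mono fun x hx => ?_) .rfl
    refine congrArg (Φ x - ·) ?_
    rw [multipole_congr (Q := fun i j => (1 / greenConst n) *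
      boundaryIntegral B (fun z => φ z * z i * ν z j)) (κ := (κ + κ') / greenConst n)
      (fun i j => ?_) hx]
    · simp only [hlin']
    · simp only [hquad', @eq_comm _ j i]
      split_ifs <;> field_simp <;> ring

/-- The expansion of the potential and the decay of the velocity near infinity. -/
theorem IsIncompressibleAirfoilFlow.exists_expansion (hn : 3 ≤ n)
    (h : IsIncompressibleAirfoilFlow B ν U u) (hB : IsAirfoil B)
    (hν : ∀ p ∈ frontier B, IsOuterUnitNormal B p (ν p)) (hd : HasInitialDecay B U u) :
    ∃ (R C : ℝ) (φ : Space n → ℝ) (G₁ : Fin n → ℝ) (G₂ : Fin n → Fin n → ℝ), 0 < R ∧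
      (∀ x ∈ Bᶜ, R ≤ ‖x‖ → HasGradientAt φ (u x) x) ∧
      ((fun x => φ x - (⟪U, x⟫_ℝ + multipole G₁ G₂ x))
        =O[cobounded (Space n)] fun x => ‖x‖ ^ (-(n : ℝ) - 1)) ∧
      ∀ x ∈ Bᶜ, R ≤ ‖x‖ → ‖u x - U‖ ≤ C * ‖x‖ ^ (-(n : ℝ)) := by
  obtain ⟨R₀, Ψ, hR₀, hBR, hΨ, hΨ0, hw0⟩ := h.exists_far_potential hB hd
  have hR : R₀ < R₀ + 1 := lt_add_one _
  have hsub {x : Space n} (hx : R₀ < ‖x‖) : x ∈ Bᶜ := fun hxB =>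
    lt_asymm hx (mem_ball_zero_iff.1 (hBR hxB))
  have hwC : ContDiffOn ℝ 1 (fun x => u x - U) Bᶜ := h.contDiffOn.sub contDiffOn_const
  have hT := (hB.integral_cutoffLaplacian hν hR₀ hBR hR hΨ hwC
    (h.continuousOn.sub continuousOn_const) fun x hx => h.divergence_sub_const hB hx).trans
    (by rw [h.boundaryIntegral_sub_const hB hν, neg_zero])
  have hwC' : ContDiffOn ℝ 1 (fun x => u x - U) {x | R₀ < ‖x‖} := hwC.mono fun x hx => hsub hx
  have hdiv (x : Space n) (hx : R₀ < ‖x‖) := h.divergence_sub_const hB (hsub hx)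
  have hexp := isBigO_sub_multipole hn hR₀ hR hΨ hwC' hdiv hΨ0 hw0 hT
  obtain ⟨C, -, hC⟩ := exists_norm_le_rpow_neg hn hR₀ hR hΨ hwC' hdiv hΨ0 hw0 hT
  refine ⟨8 * (R₀ + 1), C, fun x => Ψ x + ⟪U, x⟫_ℝ,
    fun i => -(1 / greenConst n) * ∫ y, y i * cutoffLaplacian (R₀ + 1) Ψ (fun x => u x - U) y,
    fun i j => 1 / (2 * greenConst n) *
      ∫ y, y i * y j * cutoffLaplacian (R₀ + 1) Ψ (fun x => u x - U) y, by positivity, fun x _ hx => ?_,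
    hexp.congr_left fun x => ?_, fun x _ hx => hC x hx⟩
  · have h1 := (hΨ x (by linarith)).hasFDerivAt.fun_add (hasGradientAt_inner_left U x).hasFDerivAt
    rw [← map_add, sub_add_cancel] at h1
    exact h1
  · ring

/-- Potential flows at the same airfoil are determined by their velocities at infinity. -/
theorem IsIncompressibleAirfoilFlow.eq_smul (hn : 3 ≤ n)
    (hB : IsAirfoil B) (hν : ∀ p ∈ frontier B, IsOuterUnitNormal B p (ν p))
    {U' : Space n} {u' : Space n → Space n} {φ φ' : Space n → ℝ}
    (h : IsIncompressibleAirfoilFlow B ν U u) (hd : HasInitialDecay B U u)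
    (hφ : IsVelocityPotential B u φ) (h' : IsIncompressibleAirfoilFlow B ν U' u')
    (hd' : HasInitialDecay B U' u') (hφ' : IsVelocityPotential B u' φ') {k : ℝ} (hk : U' = k • U) :
    ∀ x ∈ Bᶜ, u' x = k • u x := by
  have hopen := hB.isCompact.isClosed.isOpen_compl
  obtain ⟨c, hc⟩ := hφ.exists_tendsto (by omega) h hB hd
  obtain ⟨c', hc'⟩ := hφ'.exists_tendsto (by omega) h' hB hd'
  obtain ⟨R, C, -, -, -, -, -, -, hC⟩ := h.exists_expansion hn hB hν hd
  obtain ⟨R', C', -, -, -, -, -, -, hC'⟩ := h'.exists_expansion hn hB hν hd'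
  -- As `U' = k • U`, the linear parts cancel, so this potential of `u' - k • u` tends to zero; far
  -- out it is bounded by `1`.
  have hlim : Tendsto (fun x => φ' x - k * φ x + (c' - k * c)) (cobounded (Space n)) (𝓝 0) := by
    have h1 := hc'.sub (hc.const_mul k)
    rw [mul_zero, sub_zero] at h1
    refine h1.congr fun x => ?_
    rw [hk, real_inner_smul_left]
    ring
  have hbd : ∀ᶠ x in cobounded (Space n), |φ' x - k * φ x + (c' - k * c)| ≤ 1 := by
    filter_upwards [hlim.eventually (ball_mem_nhds 0 one_pos)] with x hx
    simpa using (mem_ball_zero_iff.1 hx).le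
  rw [← comap_norm_atTop, eventually_comap, eventually_atTop] at hbd
  obtain ⟨S, hS⟩ := hbd
  have hud {x : Space n} (hx : x ∈ Bᶜ) : DifferentiableAt ℝ u x :=
    (h.contDiffOn.contDiffAt (hopen.mem_nhds hx)).differentiableAt one_ne_zero
  have hud' {x : Space n} (hx : x ∈ Bᶜ) : DifferentiableAt ℝ u' x :=
    (h'.contDiffOn.contDiffAt (hopen.mem_nhds hx)).differentiableAt one_ne_zero
  have key := hB.eq_zero_of_slip hν (Φ := fun x => φ' x - k * φ x + (c' - k * c))
    (v := fun x => u' x - k • u x) (fun x hx => by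
      rw [hasGradientAt_iff_hasFDerivAt, map_sub, map_smul]
      exact ((hφ'.hasGradientAt x hx).hasFDerivAt.fun_sub
        ((hφ.hasGradientAt x hx).hasFDerivAt.const_mul k)).add_const _)
    ((hφ'.continuousOn.sub (continuousOn_const.mul hφ.continuousOn)).add continuousOn_const)
    (h'.contDiffOn.sub (h.contDiffOn.const_smul k))
    (h'.continuousOn.sub (h.continuousOn.const_smul k))
    (fun x hx => by
      rw [divergence_sub (hud' hx) ((hud hx).fun_const_smul k), divergence_smul
        (f := fun _ => k) (hasGradientAt_const x k) (hud hx), inner_zero_left, add_zero,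
        show divergence u' x = 0 from h'.div_eq_zero x hx,
        show divergence u x = 0 from h.div_eq_zero x hx, mul_zero, sub_zero])
    (fun x hx => by
      rw [inner_sub_left, real_inner_smul_left, h'.slip x hx, h.slip x hx, mul_zero, sub_zero])
    (M := 1) (C := C' + |k| * C) (R₁ := max S (max R R'))
    (fun x _ hx => hS ‖x‖ ((le_max_left _ _).trans hx) x rfl) (fun x hxB hx => by
      rw [max_le_iff, max_le_iff] at hx
      have e : u' x - k • u x = (u' x - U') - k • (u x - U) := by
        rw [hk, smul_sub]
        abel
      calc ‖u' x - k • u x‖ ≤ ‖u' x - U'‖ + |k| * ‖u x - U‖ := by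
            rw [e, ← Real.norm_eq_abs, ← norm_smul]
            exact norm_sub_le _ _
        _ ≤ C' * ‖x‖ ^ (-(n : ℝ)) + |k| * (C * ‖x‖ ^ (-(n : ℝ))) := by
            gcongr
            · exact hC' x hxB hx.2.2
            · exact hC x hxB hx.2.1
        _ = _ := by ring)
  exact fun x hx => sub_eq_zero.1 (key x hx)

end Flow

end

end AirfoilFlow

end

theorem theorem3p1 (n : ℕ) (hn : 3 ≤ n)
    (B : Set (Space n)) (hB : IsAirfoil B)
    (ν : Space n → Space n)
    (hν : ∀ p ∈ frontier B, IsOuterUnitNormal B p (ν p)) :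
    -- the expansion of the potential at infinity
    (∀ (q : ℝ) (u : Space n → Space n) (φ : Space n → ℝ),
      IsIncompressibleAirfoilFlow B ν (EuclideanSpace.single ⟨0, by omega⟩ q) u →
      HasInitialDecay B (EuclideanSpace.single ⟨0, by omega⟩ q) u →
      IsVelocityPotential B u φ →
      ∃ c₀ : ℝ, ∃ (Φ : Space n → ℝ) (w : Space n → Space n),
        Φ = (fun x => φ x - q * x ⟨0, by omega⟩ + c₀) ∧
        w = (fun x => u x - EuclideanSpace.single ⟨0, by omega⟩ q) ∧
        Tendsto Φ (cobounded (Space n)) (𝓝 0) ∧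
        -- the monopole coefficient vanishes
        monopoleCoeff B ν w = 0 ∧
        (fun x => (φ x + c₀) - (q * x ⟨0, by omega⟩ +
            multipole (dipoleCoeff B ν w Φ)
              (quadrupoleCoeff B ν w Φ) x))
          =O[cobounded (Space n)] (fun x => ‖x‖ ^ (-(n : ℝ) - 1)) ∧
        -- the same expansion, with coefficients that depend only on `B` and on `φ` on `∂B`
        (fun x => (φ x + c₀) - (q * x ⟨0, by omega⟩ +
            multipole
              (fun i => -(1 / greenConst n) *
                boundaryIntegral B (fun z => φ z * ν z i))
              (fun i j => (1 / greenConst n) *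
                boundaryIntegral B (fun z => φ z * z i * ν z j)) x))
          =O[cobounded (Space n)] (fun x => ‖x‖ ^ (-(n : ℝ) - 1))) ∧
    -- near infinity, without a potential up to the boundary: expansion and decay of the velocity
    (∀ (q : ℝ) (u : Space n → Space n),
      IsIncompressibleAirfoilFlow B ν (EuclideanSpace.single ⟨0, by omega⟩ q) u →
      HasInitialDecay B (EuclideanSpace.single ⟨0, by omega⟩ q) u →
      ∃ (R C : ℝ) (φ : Space n → ℝ) (G₁ : Fin n → ℝ) (G₂ : Fin n → Fin n → ℝ), 0 < R ∧
        (∀ x ∈ Bᶜ, R ≤ ‖x‖ → HasGradientAt φ (u x) x) ∧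
        (fun x => φ x - (q * x ⟨0, by omega⟩ + multipole G₁ G₂ x))
          =O[cobounded (Space n)] (fun x => ‖x‖ ^ (-(n : ℝ) - 1)) ∧
        ∀ x ∈ Bᶜ, R ≤ ‖x‖ →
          ‖u x - EuclideanSpace.single ⟨0, by omega⟩ q‖ ≤ C * ‖x‖ ^ (-(n : ℝ))) ∧
    -- for potential flows, the constants depend only on `B`, up to the factor `|q|`
    (∃ R C : ℝ, 0 < R ∧ ∀ (q : ℝ) (u : Space n → Space n),
      IsIncompressibleAirfoilFlow B ν (EuclideanSpace.single ⟨0, by omega⟩ q) u →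
      HasInitialDecay B (EuclideanSpace.single ⟨0, by omega⟩ q) u →
      (∃ φ : Space n → ℝ, IsVelocityPotential B u φ) →
      ∀ x ∈ Bᶜ, R ≤ ‖x‖ →
        ‖u x - EuclideanSpace.single ⟨0, by omega⟩ q‖ ≤ C * |q| * ‖x‖ ^ (-(n : ℝ))) := by
  have hU (q : ℝ) (x : Space n) :
      ⟪(EuclideanSpace.single ⟨0, by omega⟩ q : Space n), x⟫_ℝ = q * x ⟨0, by omega⟩ := by
    simp [EuclideanSpace.inner_single_left]
  refine ⟨fun q u φ h hd hφ => ?_, fun q u h hd => ?_, ?_⟩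
  · obtain ⟨c, hc⟩ := hφ.exists_tendsto (by omega) h hB hd
    obtain ⟨h1, h2⟩ := hφ.isBigO_sub_multipole hn h hB hν hd hc
    simp only [hU] at hc h1 h2
    refine ⟨c, _, _, rfl, rfl, hc, ?_, h1.congr_left fun x => by ring,
      h2.congr_left fun x => by ring⟩
    rw [monopoleCoeff, h.boundaryIntegral_sub_const hB hν, mul_zero]
  · have h1 := h.exists_expansion hn hB hν hd
    simpa only [hU] using h1
  -- If some potential flow has `q ≠ 0`, every other one is its multiple by `q' / q`, and the
  -- constants of that one flow, divided by `|q|`, serve for all.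
  · by_cases hex : ∃ (q : ℝ) (u : Space n → Space n) (φ : Space n → ℝ), q ≠ 0 ∧
      IsIncompressibleAirfoilFlow B ν (EuclideanSpace.single ⟨0, by omega⟩ q) u ∧
      HasInitialDecay B (EuclideanSpace.single ⟨0, by omega⟩ q) u ∧ IsVelocityPotential B u φ
    · obtain ⟨q, u, φ, hq, h, hd, hφ⟩ := hex
      obtain ⟨R, C, -, -, -, hR, -, -, hC⟩ := h.exists_expansion hn hB hν hd
      refine ⟨R, C / |q|, hR, fun q' u' h' hd' hφ' x hx hRx => ?_⟩
      obtain ⟨φ', hφ'⟩ := hφ'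
      have hk : (EuclideanSpace.single ⟨0, by omega⟩ q' : Space n) =
          (q' / q) • EuclideanSpace.single ⟨0, by omega⟩ q := by
        ext i
        rcases eq_or_ne i ⟨0, by omega⟩ with rfl | hi
        · simp [div_mul_cancel₀ _ hq]
        · simp [hi]
      rw [IsIncompressibleAirfoilFlow.eq_smul hn hB hν h hd hφ h' hd' hφ' hk x hx, hk, ← smul_sub,
        norm_smul, Real.norm_eq_abs, abs_div]
      calc _ ≤ |q'| / |q| * (C * ‖x‖ ^ (-(n : ℝ))) := by
            gcongr
            exact hC x hx hRx
        _ = _ := by ring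
    · refine ⟨1, 0, one_pos, fun q u h hd hφ x hx _ => ?_⟩
      obtain ⟨φ, hφ⟩ := hφ
      have hq : q = 0 := by
        by_contra hq
        exact hex ⟨q, u, φ, hq, h, hd, hφ⟩
      -- Only `q = 0` is left. Compared with itself under the factor `0`, the flow is seen to
      -- vanish.
      have h0 := IsIncompressibleAirfoilFlow.eq_smul hn hB hν h hd hφ h hd hφ (k := 0)
        (by simp [hq]) x hx
      rw [h0, zero_smul]
      simp [hq]
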